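/- Let $\phi_n$ ($n\in\mathbb Z$) be the neutral fermions, $\phi_m\phi_n+\phi_n\phi_m=(-1)^m\delta_{m,-n}$, acting on the Fock space over $\mathbb C$ with basis $\phi_{n_1}\cdots\phi_{n_k}|0\rangle$, $n_1>\dots>n_k\ge 0$, where $\phi_m|0\rangle=0$ for $m<0$, $\langle 0|\phi_m=0$ for $m>0$, $\langle 0|0\rangle=1$ and $\langle 0|\phi_0|0\rangle=0$. Let $r:\mathbb Z\to\mathbb C$ satisfy $r(n)=r(1-n)$ and $r(n)\neq 0$ for all $n$. For odd $k>0$ put $$H_k=\tfrac12\sum_{n\in\mathbb Z}(-1)^{n+1}\phi_n\phi_{-n-k},\qquad B_k=\tfrac12\sum_{n\in\mathbb Z}(-1)^n\phi_n\phi_{k-n}\,r(n)r(n-1)\cdots r(n-k+1),$$ $H(\mathbf t)=\sum_{k\text{ odd}>0}t_kH_k$, $B(\mathbf t^*)=\sum_{k\text{ odd}>0}t^*_kB_k$, and define the formal power series $$\tau_r(\mathbf t,\mathbf t^*)=\langle 0|e^{H(\mathbf t)}e^{-B(\mathbf t^*)}|0\rangle .$$ Let $N\ge 0$, let $x_1,\dots,x_N,y_1,\dots,y_N$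 be independent variables, and let $\mathbf t(\mathbf x^N)$, $\mathbf t^*(\mathbf y^N)$ be given by $m t_m=\sum_k(x_k^m-(-x_k)^m)$ and $m t^*_m=\sum_k(y_k^m-(-y_k)^m)$ for odd $m>0$. Then there is $T:\mathbb Z\to\mathbb C$ with $T_{-n}=-T_n$ and $e^{T_{n-1}-T_n}=r(n)$ for all $n\in\mathbb Z$, and for every such $T$ $$\tau_r(\mathbf t(\mathbf x^N),\mathbf t^*(\mathbf y^N))=\frac{2^N\,\mathrm{Pfaff}(S)}{\Delta(\mathbf x^N)\,\Delta(\mathbf y^N)},\qquad \Delta(\mathbf z^N)=\prod_{1\le i<j\le N}\frac{z_i-z_j}{z_i+z_j},$$ as an identity in the field of fractions of $\mathbb C[[x_1,\dots,x_N,y_1,\dots,y_N]]$. Here $\mathrm{Pfaff}(S)=\frac{1}{2^NN!}\sum_{\sigma\in\mathfrak S_{2N}}\mathrm{sgn}(\sigma)\prod_{i=1}^N S_{\sigma(2i-1),\sigma(2i)}$ and $S$ is the $2N\times 2N$ skew-symmetric matrix whose rows and columns are labelled, in this order, by $x_N,x_{N-1},\dots,x_1,y_1,y_2,\dots,y_N$,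 with the entries $$S_{x_k,x_m}=\frac12\,\frac{x_m-x_k}{x_m+x_k},\qquad S_{y_k,y_m}=\frac12\,\frac{y_k-y_m}{y_k+y_m},\qquad S_{x_k,y_m}=-S_{y_m,x_k}=\frac12+\sum_{n=1}^\infty e^{-T_n}x_k^ny_m^n .$$ -/

import Mathlib

open Finset
open scoped BigOperators

noncomputable section

namespace BKP

/-! ### Neutral fermions -/

/-- The fermionic Fock space.  The finite set `S = {n₁ > ⋯ > n_k ≥ 0}` labels the basis vector
`φ_{n₁} ⋯ φ_{n_k} |0⟩`. -/
abbrev Fock : Type := Finset ℕ →₀ ℂ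

/-- The right vacuum vector `|0⟩`. -/
def vacuum : Fock := Finsupp.single ∅ 1

/-- The sign obtained by moving the mode `m` to its place in the decreasing product
labelled by `S`. -/
def modeSign (m : ℕ) (S : Finset ℕ) : ℂ := (-1) ^ (S.filter (fun s => m < s)).card

/-- Creation of the mode `m`. -/
def create (m : ℕ) : Module.End ℂ Fock :=
  Finsupp.linearCombination ℂ fun S =>
    if m ∈ S then 0 else Finsupp.single (insert m S) (modeSign m S)

/-- Annihilation of the mode `m`. -/
def annihilate (m : ℕ) : Module.End ℂ Fock :=
  Finsupp.linearCombination ℂ fun S =>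
    if m ∈ S then Finsupp.single (S.erase m) (modeSign m S) else 0

/-- The neutral fermion `φ_n`, `n ∈ ℤ`; the relations
`φ_m φ_n + φ_n φ_m = (-1)^m δ_{m,-n}` and `φ_m |0⟩ = 0` for `m < 0` hold. -/
def fermion (n : ℤ) : Module.End ℂ Fock :=
  if 0 < n then create n.natAbs
  else if n < 0 then ((-1 : ℂ) ^ n) • annihilate n.natAbs
  else create 0 + (1 / 2 : ℂ) • annihilate 0

theorem modeSign_insert (m k : ℕ) (S : Finset ℕ) (h : k ∉ S) : modeSign m (insert k S) = (if m < k then -1 else 1) * modeSign m S := by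
  unfold modeSign
  rw [Finset.filter_insert]
  split_ifs with hk
  · rw [Finset.card_insert_of_notMem (by simp [h]), pow_succ]; ring
  · simp

theorem modeSign_erase (m k : ℕ) (S : Finset ℕ) (h : k ∈ S) : modeSign m (S.erase k) = (if m < k then -1 else 1) * modeSign m S := by
  conv_rhs => rw [← Finset.insert_erase h, modeSign_insert _ _ _ (Finset.notMem_erase _ _)]
  split_ifs <;> ring

theorem modeSign_mul_self (m : ℕ) (S : Finset ℕ) : modeSign m S * modeSign m S = 1 := by
  unfold modeSign; rw [← pow_add, ← two_mul, pow_mul]; simp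

theorem create_create (m k : ℕ) : create m * create k + create k * create m = 0 := by
  ext1 S; ext1; 
  simp only [create, LinearMap.comp_apply, Module.End.mul_apply, LinearMap.add_apply, Finsupp.lsingle_apply, Finsupp.linearCombination_single, one_smul, LinearMap.zero_apply]
  by_cases hm : m ∈ S <;> by_cases hk : k ∈ S <;> by_cases e : m = k <;> try (subst e) <;> simp_all
  all_goals try simp_all
  rw [if_neg (fun h => e h.symm), modeSign_insert _ _ _ hk, modeSign_insert _ _ _ hm, Finset.insert_comm, ← Finsupp.single_mul, ← Finsupp.single_mul, ← Finsupp.single_add]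
  rcases lt_or_gt_of_ne e with h | h <;> simp [h, not_lt.2 h.le, mul_comm] 

theorem annihilate_annihilate (m k : ℕ) : annihilate m * annihilate k + annihilate k * annihilate m = 0 := by
  ext1 S; ext1; 
  simp only [annihilate, LinearMap.comp_apply, Module.End.mul_apply, LinearMap.add_apply, Finsupp.lsingle_apply, Finsupp.linearCombination_single, one_smul, LinearMap.zero_apply]
  by_cases hm : m ∈ S <;> by_cases hk : k ∈ S <;> by_cases e : m = k <;> try (subst e) <;> simp_all
  all_goals try simp_all
  rw [if_neg (fun h => e h.symm), modeSign_erase _ _ _ hk, modeSign_erase _ _ _ hm, Finset.erase_right_comm, ← Finsupp.single_mul, ← Finsupp.single_mul, ← Finsupp.single_add]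
  rcases lt_or_gt_of_ne e with h | h <;> simp [h, not_lt.2 h.le, mul_comm] 

theorem create_annihilate (m k : ℕ) : create m * annihilate k + annihilate k * create m = if m = k then 1 else 0 := by
  ext1 S; ext1; 
  simp only [create, annihilate, LinearMap.comp_apply, Module.End.mul_apply, LinearMap.add_apply, Finsupp.lsingle_apply, Finsupp.linearCombination_single, one_smul, LinearMap.zero_apply]
  by_cases e : m = k
  · subst e
    by_cases hm : m ∈ S
    · simp [hm, modeSign_erase, modeSign_mul_self]
    · simp [hm, modeSign_insert, modeSign_mul_self]
  · have e' : k ≠ m := fun h => e h.symm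
    by_cases hm : m ∈ S <;> by_cases hk : k ∈ S <;> simp [hm, hk, e, e']
    rw [modeSign_insert _ _ _ hm, modeSign_erase _ _ _ hk, Finset.erase_insert_of_ne e, ← Finsupp.single_mul, ← Finsupp.single_mul, ← Finsupp.single_add]
    rcases lt_or_gt_of_ne e with h | h <;> simp [h, not_lt.2 h.le, mul_comm]

theorem annihilate_create (m k : ℕ) : annihilate m * create k + create k * annihilate m = if m = k then 1 else 0 := by
  rw [add_comm, create_annihilate]; simp [eq_comm]

theorem fermion_eq (n : ℤ) : fermion n = (if 0 ≤ n then (1:ℂ) else 0) • create n.natAbs + (if n < 0 then (-1:ℂ)^n else if n = 0 then 1/2 else 0) • annihilate n.natAbs := by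
  unfold fermion
  rcases lt_trichotomy n 0 with h | h | h
  · simp [h, h.le, not_lt.2 h.le, not_le.2 h]
  · subst h; simp
  · simp [h, h.le, not_lt.2 h.le, h.ne']

theorem anticomm_expand (A A' B B' : Module.End ℂ Fock) (a b c d : ℂ) : (a • A + b • A') * (c • B + d • B') + (c • B + d • B') * (a • A + b • A') =
   (a*c) • (A*B+B*A) + (a*d) • (A*B'+B'*A) + (b*c) • (A'*B+B*A') + (b*d) • (A'*B'+B'*A') := by
  simp only [add_mul, mul_add, smul_mul_assoc, mul_smul_comm, smul_smul, smul_add]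
  rw [mul_comm c a, mul_comm d a, mul_comm c b, mul_comm d b]; abel

/-- The canonical anticommutation relations. -/
theorem fermion_anticomm (m n : ℤ) : fermion m * fermion n + fermion n * fermion m = if m = -n then algebraMap ℂ _ ((-1)^m) else 0 := by
  rw [fermion_eq, fermion_eq, anticomm_expand, create_create, annihilate_annihilate, create_annihilate, annihilate_create]
  by_cases h : m = -n
  · subst h
    simp only [Int.natAbs_neg, if_true, Algebra.algebraMap_eq_smul_one, smul_zero, zero_add, add_zero, ← add_smul]
    congr 1
    rcases lt_trichotomy n 0 with h | h | h
    · have : ¬ (0 ≤ n) := by omega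
      have h2 : ¬ (0 < n) := by omega
      have h3 : n ≤ 0 := by omega
      simp [h, h.ne, this, h2, h3]
      rcases Int.even_or_odd n with e | e <;> simp [e.neg_one_zpow]
    · subst h; norm_num
    · have : ¬ (n ≤ 0) := by omega
      have h2 : ¬ (n < 0) := by omega
      have h3 : 0 ≤ n := by omega
      simp [h, h.ne', this, h2, h3]
  · rw [if_neg h]
    by_cases e : m.natAbs = n.natAbs
    · have : m = n := by omega
      subst this
      have h0 : m ≠ 0 := by omega
      rcases lt_or_gt_of_ne h0 with h | h
      · simp [h, not_le.2 h]
      · simp [h.ne', not_lt.2 h.le]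
    · simp [e]

/-- `φ_m |0⟩ = 0` for `m < 0`. -/
theorem fermion_vacuum (m : ℤ) (h : m < 0) : fermion m vacuum = 0 := by
  simp only [fermion_eq, vacuum, annihilate, create, LinearMap.add_apply, LinearMap.smul_apply, Finsupp.linearCombination_single]
  simp [not_le.2 h]

/-- `⟨0| φ_m = 0` for `m > 0`. -/
theorem vacuum_fermion (m : ℤ) (h : 0 < m) (v : Fock) : fermion m v ∅ = 0 := by
  induction v using Finsupp.induction_linear with
  | zero => simp
  | add f g hf hg => rw [map_add, Finsupp.add_apply, hf, hg, add_zero]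
  | single S a =>
    simp only [fermion, if_pos h, create, Finsupp.linearCombination_single]
    split_ifs <;> simp

/-- The vacuum expectation value `A ↦ ⟨0| A |0⟩`. -/
def vev (A : Module.End ℂ Fock) : ℂ := A vacuum ∅

/-- The operator `∑_{n ∈ ℤ} c(n) φ_n φ_{m-n}`, given on the basis of the Fock space.  For `m ≠ 0`
only finitely many terms are nonzero on each basis vector. -/
def bilinear (m : ℤ) (c : ℤ → ℂ) : Module.End ℂ Fock :=
  Finsupp.linearCombination ℂ fun S =>
    ∑ᶠ n : ℤ, c n • fermion n (fermion (m - n) (Finsupp.single S 1))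

/-- `H_n = (1/2) ∑_k (-1)^{k+1} φ_k φ_{-k-n}` (used for odd `n`). -/
def hamiltonian (n : ℤ) : Module.End ℂ Fock :=
  bilinear (-n) fun k => (1 / 2) * (-1) ^ (k + 1)

/-- `B_k = (1/2) ∑_n (-1)^n φ_n φ_{k-n} r(n) r(n-1) ⋯ r(n-k+1)` (used for odd `k > 0`). -/
def flow (r : ℤ → ℂ) (k : ℕ) : Module.End ℂ Fock :=
  bilinear k fun n => (1 / 2) * (-1) ^ n * ∏ i ∈ range k, r (n - i)

/-- On each basis vector the sum defining `bilinear` is finite. -/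
theorem bilinear_finite (m : ℤ) (hm : m ≠ 0) (c : ℤ → ℂ) (S : Finset ℕ) :
    (Function.support fun n : ℤ =>
      c n • fermion n (fermion (m - n) (Finsupp.single S (1 : ℂ)))).Finite := by
  have hS : ∀ k : ℕ, k ∈ S → k ≤ S.sup id := fun k hk => Finset.le_sup (f := id) hk
  refine (Set.finite_Icc (-(((S.sup id : ℕ) : ℤ) + |m|)) (((S.sup id : ℕ) : ℤ) + |m|)).subset fun n hn => ?_
  rw [Function.mem_support] at hn
  by_contra hout
  apply hn
  rw [Set.mem_Icc, not_and_or, not_le, not_le] at hout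
  have h1 := le_abs_self m
  have h2 := neg_abs_le m
  have h3 : (0 : ℤ) ≤ ((S.sup id : ℕ) : ℤ) := Int.natCast_nonneg _
  rcases hout with h | h
  · have hpos : 0 < m - n := by linarith
    have hneg : n < 0 := by linarith [abs_nonneg m]
    have hnot : ¬ 0 < n := by linarith
    have hmem : n.natAbs ∉ S := fun hk => by have := hS _ hk; omega
    have hdiff : n.natAbs ≠ (m - n).natAbs := by omega
    have hmem' : n.natAbs ∉ insert (m - n).natAbs S := by
      rw [Finset.mem_insert, not_or]; exact ⟨hdiff, hmem⟩
    simp only [fermion, if_pos hpos, if_pos hneg, if_neg hnot, create, annihilate,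
      LinearMap.smul_apply, Finsupp.linearCombination_single, one_smul]
    split_ifs
    · simp
    · simp [Finsupp.linearCombination_single, hdiff, hmem]
  · have hneg : m - n < 0 := by linarith
    have hnot : ¬ 0 < m - n := by linarith
    have hmem : (m - n).natAbs ∉ S := fun hk => by have := hS _ hk; omega
    have hzero : fermion (m - n) (Finsupp.single S (1 : ℂ)) = 0 := by
      simp only [fermion, if_neg hnot, if_pos hneg, annihilate, LinearMap.smul_apply,
        Finsupp.linearCombination_single, if_neg hmem, smul_zero]
    rw [hzero, map_zero, smul_zero]

/-! ### The tau function as a formal power series -/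

/-- The linear form `∑_i t_i a_i` in the variables `t_i`, with coefficients `a_i`. -/
def linearForm {σ E : Type*} [DecidableEq σ] [Semiring E] (a : σ → E) : MvPowerSeries σ E :=
  fun d => ∑ i ∈ d.support, if d = Finsupp.single i 1 then a i else 0

/-- The exponential `∑_k A^k / k!` of a formal power series `A` without constant term.  The
coefficient at a monomial of degree `|d|` gets no contribution from `k > |d|`. -/
def formalExp {σ E : Type*} [Ring E] [Algebra ℂ E] (A : MvPowerSeries σ E) : MvPowerSeries σ E :=
  fun d => ∑ k ∈ range (d.degree + 1), ((k.factorial : ℂ)⁻¹) • MvPowerSeries.coeff d (A ^ k)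

/-- `H(t) = ∑ t_n H_n` over odd `n > 0`.  The variable `Sum.inl j` stands for `t_{2j+1}` and the
variable `Sum.inr j` for `t*_{2j+1}`. -/
def hamiltonianSeries : MvPowerSeries (ℕ ⊕ ℕ) (Module.End ℂ Fock) :=
  linearForm (Sum.elim (fun j => hamiltonian (2 * j + 1)) (fun _ => 0))

/-- `B(t*) = ∑ t*_n B_n` over odd `n > 0`. -/
def flowSeries (r : ℤ → ℂ) : MvPowerSeries (ℕ ⊕ ℕ) (Module.End ℂ Fock) :=
  linearForm (Sum.elim (fun _ => 0) (fun j => flow r (2 * j + 1)))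

/-- The hypergeometric tau function `τ_r(t, t*) = ⟨0| e^{H(t)} e^{-B(t*)} |0⟩`, a formal power
series in the times. -/
def tau (r : ℤ → ℂ) : MvPowerSeries (ℕ ⊕ ℕ) ℂ :=
  fun d => vev (MvPowerSeries.coeff d (formalExp hamiltonianSeries * formalExp (-flowSeries r)))

/-! ### Specialized times -/

/-- Formal power series in `x_1, …, x_N` (variables `Sum.inl i`) and `y_1, …, y_N`
(variables `Sum.inr i`). -/
abbrev XYSeries (N : ℕ) : Type := MvPowerSeries (Fin N ⊕ Fin N) ℂ

/-- The power sum times `m t_m = ∑_k (z_k^m - (-z_k)^m)`, for `m = 2j+1`. -/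
def powerTime {N : ℕ} (z : Fin N → XYSeries N) (j : ℕ) : XYSeries N :=
  (1 / (2 * j + 1) : ℂ) • ∑ k, (z k ^ (2 * j + 1) - (-z k) ^ (2 * j + 1))

/-- The times `t(x^N)` and `t*(y^N)`. -/
def xyTimes (N : ℕ) : ℕ ⊕ ℕ → XYSeries N :=
  Sum.elim (powerTime fun k => MvPowerSeries.X (Sum.inl k))
    (powerTime fun k => MvPowerSeries.X (Sum.inr k))

/-- `τ_r(t(x^N), t*(y^N))`. -/
def tauXY (N : ℕ) (r : ℤ → ℂ) : XYSeries N := MvPowerSeries.subst (xyTimes N) (tau r)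

/-- The specialization of the times is an admissible substitution. -/
theorem hasSubst_xyTimes (N : ℕ) : MvPowerSeries.HasSubst (xyTimes N) := by
  have hc : ∀ (z : Fin N → Fin N ⊕ Fin N) (j : ℕ) (d : Fin N ⊕ Fin N →₀ ℕ), d.degree ≠ 2 * j + 1 →
      MvPowerSeries.coeff d (powerTime (fun k => MvPowerSeries.X (z k)) j : XYSeries N) = 0 := by
    intro z j d hd
    have hX : ∀ s : Fin N ⊕ Fin N,
        MvPowerSeries.coeff d ((MvPowerSeries.X s : XYSeries N) ^ (2 * j + 1)) = 0 := by
      intro s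
      rw [MvPowerSeries.coeff_X_pow, if_neg]
      rintro rfl
      exact hd (Finsupp.degree_single _ _)
    have hodd : Odd (2 * j + 1) := ⟨j, rfl⟩
    simp [powerTime, hodd.neg_pow, hX]
  constructor
  · rintro (j | j)
    · rw [← MvPowerSeries.coeff_zero_eq_constantCoeff_apply, xyTimes, Sum.elim_inl, hc _ _ _ (by simp)]
      exact IsNilpotent.zero
    · rw [← MvPowerSeries.coeff_zero_eq_constantCoeff_apply, xyTimes, Sum.elim_inr, hc _ _ _ (by simp)]
      exact IsNilpotent.zero
  · intro d
    refine (((Set.finite_Iic d.degree).image Sum.inl).union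
      ((Set.finite_Iic d.degree).image Sum.inr)).subset ?_
    rintro (j | j) hj
    · refine Or.inl ⟨j, ?_, rfl⟩
      by_contra hlt
      rw [Set.mem_Iic] at hlt
      exact hj (hc _ _ _ (by omega))
    · refine Or.inr ⟨j, ?_, rfl⟩
      by_contra hlt
      rw [Set.mem_Iic] at hlt
      exact hj (hc _ _ _ (by omega))

/-! ### The Pfaffian formula -/

/-- The Pfaffian of a `2n × 2n` skew-symmetric matrix over a field of characteristic zero. -/
def pfaffian {K : Type*} [Field K] {n : ℕ} (A : Matrix (Fin (2 * n)) (Fin (2 * n)) K) : K :=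
  (2 ^ n * (n.factorial : K))⁻¹ * ∑ σ : Equiv.Perm (Fin (2 * n)),
    ((Equiv.Perm.sign σ : ℤ) : K) *
      ∏ i : Fin n, A (σ ⟨2 * i, by omega⟩) (σ ⟨2 * i + 1, by omega⟩)

/-- The field of fractions of the ring of formal power series in the `x_i` and `y_i`. -/
abbrev XYField (N : ℕ) : Type := FractionRing (XYSeries N)

/-- The variable `x_i` as an element of the field. -/
def xVar {N : ℕ} (i : Fin N) : XYField N :=
  algebraMap (XYSeries N) (XYField N) (MvPowerSeries.X (Sum.inl i))

/-- The variable `y_i` as an element of the field. -/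
def yVar {N : ℕ} (i : Fin N) : XYField N :=
  algebraMap (XYSeries N) (XYField N) (MvPowerSeries.X (Sum.inr i))

/-- `Δ(z) = ∏_{i<j} (z_i - z_j)/(z_i + z_j)`. -/
def delta {N : ℕ} {K : Type*} [Field K] (z : Fin N → K) : K :=
  ∏ i : Fin N, ∏ j ∈ Ioi i, (z i - z j) / (z i + z j)

/-- The formal power series `1/2 + ∑_{n ≥ 1} e^{-T_n} x_i^n y_j^n`. -/
def mixedSeries {N : ℕ} (T : ℤ → ℂ) (i j : Fin N) : XYSeries N :=
  PowerSeries.subst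
    (MvPowerSeries.X (Sum.inl i) * MvPowerSeries.X (Sum.inr j) : XYSeries N)
    (PowerSeries.mk fun n : ℕ => if n = 0 then (1 / 2 : ℂ) else Complex.exp (-T n))

/-- The skew-symmetric matrix of the pair correlations of the fermions
`φ(1/x_N), …, φ(1/x_1), φ(T,-y_1), …, φ(T,-y_N)`, enumerated from the left to the right. -/
def corrMatrix (N : ℕ) (T : ℤ → ℂ) : Matrix (Fin N ⊕ Fin N) (Fin N ⊕ Fin N) (XYField N) :=
  Matrix.fromBlocks
    (fun k m => (1 / 2) * ((xVar m.rev - xVar k.rev) / (xVar m.rev + xVar k.rev)))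
    (fun k m => algebraMap (XYSeries N) (XYField N) (mixedSeries T k.rev m))
    (fun k m => -algebraMap (XYSeries N) (XYField N) (mixedSeries T m.rev k))
    (fun k m => (1 / 2) * ((yVar k - yVar m) / (yVar k + yVar m)))

/-- The same matrix with rows and columns numbered by `0, …, 2N-1`, the block of the `x_i`
coming first. -/
def pfaffMatrix (N : ℕ) (T : ℤ → ℂ) : Matrix (Fin (2 * N)) (Fin (2 * N)) (XYField N) :=
  Matrix.reindex (finSumFinEquiv.trans (finCongr (two_mul N).symm))
    (finSumFinEquiv.trans (finCongr (two_mul N).symm)) (corrMatrix N T)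

end BKP

end

/-! Put χ_n = e^{-T_n} φ_n. The telescoping of r and its symmetry give [-B_k, χ_n] = χ_{n+k}, so
conjugating φ_{-m}|0⟩ = 0 (m ≥ 1) by e^{-B} shows that v = e^{-B}|0⟩ satisfies the linear relations
∑_k q_k χ_{k-m} v = 0, where ∑ q_k z^k = exp(∑ t*_k z^k). At the special times this generating
function becomes ∏ (1 + y_i z)/(1 - y_i z). The covector ⟨0|e^H, transposed, satisfies the same
relations with T = 0 and x in place of y.

Let V(y) be the product φ(y_1)⋯φ(y_N)|0⟩ with φ(y) = ∑ y^n χ_n, its contractions being read as the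
rational functions (y_i - y_j)/(2(y_i + y_j)). By partial fractions, q_k = ∑ c_i y_i^k for k ≥ 1, so
the creation part of each relation is a combination of creation parts of the φ(y_i). On V(y) the
latter reduce to contractions, because φ(y_i)² = 0, and these cancel the annihilation part
(`annihilated_fermiVec`). A triangularity argument in the energy shows that a solution of the
relations is determined by its coefficients at ∅ and {0} (`Annihilated.eq_zero`). Hence V(y) is a
multiple of v, or of v multiplied on the right by φ_0 when N is odd, and the Schur Pfaffian
evaluates the factor as 2^{-⌊N/2⌋} Δ(y) (`fermiVec_eq_smul`). No bosonization is needed.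

Thus Δ(x) Δ(y) τ equals 2^N times the pairing of V(x) with V(y); for odd N the missing factor 1/2 is
φ_0². By Wick's rule the pairing is the Pfaffian of the pair correlations (`pf_eq_pairing`), where
`pf` is defined by row expansion and identified with the permutation sum in `pf_image_eq_pfaffian`.

The pairing is an infinite sum over the Fock basis. Every identity is therefore proved exactly with
the modes n < M only, which truncates the mixed correlations to n < M. By the grading, the truncated
tau function agrees with τ up to order M, and `pfaffian_limit` lets M tend to infinity after
clearing denominators. -/

set_option linter.unusedSectionVars false

noncomputable section

namespace BKP

/-! ### Annihilation and creation operators on functions of finite sets -/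

section CAR

variable {ι K W : Type*} [DecidableEq ι] [CommRing K] [AddCommGroup W] [Module K W]
variable (r : ι → ι → Prop) [DecidableRel r] [Std.Asymm r] [Std.Trichotomous r]

/-- The sign obtained by moving `i` to its place in the product labelled by `I`, where `r k i`
means that `k` stands to the left of `i`. -/
def sgn (K : Type*) [CommRing K] (i : ι) (I : Finset ι) : K := (-1) ^ (I.filter (fun k => r k i)).card

/-- The annihilation operator of the mode `i` on functions of finite sets. -/
def ann (K : Type*) [CommRing K] {W : Type*} [AddCommGroup W] [Module K W] (i : ι)
    (f : Finset ι → W) (I : Finset ι) : W :=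
  if i ∈ I then 0 else sgn r K i I • f (insert i I)

/-- The creation operator of the combination of modes with coefficients `β`. -/
def crs (β : ι → K) (f : Finset ι → W) (I : Finset ι) : W :=
  ∑ j ∈ I, (β j * sgn r K j I) • f (I.erase j)

theorem sgn_insert {k : ι} (i : ι) {I : Finset ι} (h : k ∉ I) :
    sgn r K i (insert k I) = (if r k i then -1 else 1) * sgn r K i I := by
  unfold sgn
  rw [filter_insert]
  split_ifs with hk
  · rw [card_insert_of_notMem (by simp [h]), pow_succ]; ring
  · simp

theorem sgn_erase {k : ι} (i : ι) {I : Finset ι} (h : k ∈ I) :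
    sgn r K i (I.erase k) = (if r k i then -1 else 1) * sgn r K i I := by
  conv_rhs => rw [← insert_erase h, sgn_insert _ _ (notMem_erase _ _)]
  split_ifs <;> ring

theorem sgn_mul_self (i : ι) (I : Finset ι) : sgn r K i I * sgn r K i I = 1 := by
  unfold sgn; rw [← pow_add, ← two_mul, pow_mul]; simp

theorem sgn_ite {i j : ι} (h : i ≠ j) :
    (if r i j then (-1 : K) else 1) = -(if r j i then (-1 : K) else 1) := by
  by_cases h1 : r i j
  · have : ¬ r j i := Std.Asymm.asymm _ _ h1
    simp [h1, this]
  · by_cases h2 : r j i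
    · simp [h1, h2]
    · exact absurd (Std.Trichotomous.trichotomous (r := r) i j h1 h2) h

theorem sgn_erase_self (i : ι) (I : Finset ι) : sgn r K i (I.erase i) = sgn r K i I := by
  by_cases h : i ∈ I
  · have : ¬ r i i := fun h => Std.Asymm.asymm _ _ h h
    rw [sgn_erase r i h, if_neg this, one_mul]
  · rw [erase_eq_of_notMem h]

theorem sgn_insert_self (i : ι) (I : Finset ι) : sgn r K i (insert i I) = sgn r K i I := by
  rw [← sgn_erase_self, erase_insert_eq_erase, sgn_erase_self]

theorem sgn_erase_mul {i j : ι} {I : Finset ι} (hi : i ∈ I) (hj : j ∈ I) (h : i ≠ j) :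
    sgn r K i I * sgn r K j (I.erase i) = -(sgn r K j I * sgn r K i (I.erase j)) := by
  rw [sgn_erase _ _ hi, sgn_erase _ _ hj, sgn_ite r h]; ring

theorem sgn_insert_mul {i j : ι} {I : Finset ι} (hi : i ∉ I) (hj : j ∉ I) (h : i ≠ j) :
    sgn r K i I * sgn r K j (insert i I) = -(sgn r K j I * sgn r K i (insert j I)) := by
  rw [sgn_insert _ _ hi, sgn_insert _ _ hj, sgn_ite r h]; ring

/-- Removing j and then k carries the opposite sign to removing k and then j, so the double sum
cancels term by term after exchanging the indices. -/
theorem crs_crs_add (α β : ι → K) (f : Finset ι → W) (I : Finset ι) :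
    crs r α (crs r β f) I + crs r β (crs r α f) I = 0 := by
  have key : ∀ α β : ι → K, crs r α (crs r β f) I = ∑ j ∈ I, ∑ k ∈ I, if j = k then 0 else
      (α j * β k * (sgn r K j I * sgn r K k (I.erase j))) • f ((I.erase j).erase k) := by
    intro α β
    refine sum_congr rfl fun j hj => ?_
    rw [crs, smul_sum, ← sum_erase I (a := j) (by simp)]
    refine sum_congr rfl fun k hk => ?_
    rw [if_neg (Finset.ne_of_mem_erase hk).symm, smul_smul]
    congr 1; ring
  rw [key α β, key β α, sum_comm, ← sum_add_distrib]
  refine sum_eq_zero fun j hj => ?_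
  rw [← sum_add_distrib]
  refine sum_eq_zero fun k hk => ?_
  by_cases h : j = k
  · simp [h]
  · rw [if_neg h, if_neg (Ne.symm h), sgn_erase_mul r hj hk h, erase_right_comm, ← add_smul]
    convert zero_smul K _ using 2
    ring

theorem ann_ann_add (i j : ι) (f : Finset ι → W) (I : Finset ι) :
    ann r K i (ann r K j f) I + ann r K j (ann r K i f) I = 0 := by
  unfold ann
  by_cases h : i = j
  · subst h; simp
  by_cases hi : i ∈ I
  · simp [hi]
  by_cases hj : j ∈ I
  · simp [hj]
  rw [if_neg hi, if_neg hj, if_neg (by simp [hj, Ne.symm h]), if_neg (by simp [hi, h]), smul_smul,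
    smul_smul, sgn_insert_mul r hi hj h, insert_comm, neg_smul, neg_add_cancel]

/-- If i ∈ I, only the summand j = i of the second term survives. If i ∉ I, the summand j = i of the
first term gives the right-hand side, and the others cancel against the second term. -/
theorem ann_crs_add (i : ι) (β : ι → K) (f : Finset ι → W) (I : Finset ι) :
    ann r K i (crs r β f) I + crs r β (ann r K i f) I = β i • f I := by
  by_cases hi : i ∈ I
  · rw [ann, if_pos hi, zero_add, crs, sum_eq_single i, ann, if_neg (notMem_erase _ _),
      insert_erase hi, smul_smul, sgn_erase_self, mul_assoc, sgn_mul_self, mul_one]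
    · intro j hj hji
      rw [ann, if_pos (mem_erase.2 ⟨hji.symm, hi⟩), smul_zero]
    · exact fun h => absurd hi h
  · rw [ann, if_neg hi, crs, sum_insert hi, erase_insert hi, smul_add, smul_smul, sgn_insert_self,
      mul_left_comm, sgn_mul_self, mul_one, add_assoc]
    convert add_zero (β i • f I)
    rw [crs, smul_sum, ← sum_add_distrib]
    refine sum_eq_zero fun j hj => ?_
    have hij : i ≠ j := fun h => hi (h ▸ hj)
    rw [ann, if_neg (fun h => hi (mem_of_mem_erase h)), smul_smul, smul_smul, erase_insert_of_ne hij,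
      ← add_smul]
    convert zero_smul K _ using 2
    rw [sgn_insert _ _ hi, sgn_erase _ _ hj, sgn_ite r hij]; ring

theorem crs_smul (c : K) (β : ι → K) (f : Finset ι → W) (I : Finset ι) :
    crs r (c • β) f I = c • crs r β f I := by
  simp only [crs, Pi.smul_apply, smul_eq_mul, mul_assoc, mul_smul, smul_sum]

theorem crs_sum {κ : Type*} (s : Finset κ) (β : κ → ι → K) (f : Finset ι → W) (I : Finset ι) :
    crs r (∑ a ∈ s, β a) f I = ∑ a ∈ s, crs r (β a) f I := by
  simp only [crs, Finset.sum_apply, sum_mul, sum_smul]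
  exact sum_comm

theorem map_crs {W' : Type*} [AddCommGroup W'] [Module K W'] (L : W →ₗ[K] W') (β : ι → K)
    (f : Finset ι → W) (I : Finset ι) : L (crs r β f I) = crs r β (fun J => L (f J)) I := by
  simp only [crs, map_sum, map_smul]

theorem map_ann {W' : Type*} [AddCommGroup W'] [Module K W'] (L : W →ₗ[K] W') (i : ι)
    (f : Finset ι → W) (I : Finset ι) : L (ann r K i f I) = ann r K i (fun J => L (f J)) I := by
  unfold ann; split_ifs <;> simp

theorem crs_congr (β : ι → K) {f g : Finset ι → W} {I : Finset ι}
    (h : ∀ j ∈ I, f (I.erase j) = g (I.erase j)) : crs r β f I = crs r β g I :=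
  sum_congr rfl fun j hj => by rw [h j hj]

theorem crs_add_right (β : ι → K) (f g : Finset ι → W) (I : Finset ι) :
    crs r β (f + g) I = crs r β f I + crs r β g I := by
  simp only [crs, Pi.add_apply, smul_add, sum_add_distrib]

theorem crs_smul_right (β : ι → K) (c : K) (f : Finset ι → W) (I : Finset ι) :
    crs r β (c • f) I = c • crs r β f I := by
  simp only [crs, Pi.smul_apply, smul_sum, smul_comm c]

theorem ann_add_right (i : ι) (f g : Finset ι → W) (I : Finset ι) :
    ann r K i (f + g) I = ann r K i f I + ann r K i g I := by
  unfold ann; split_ifs <;> simp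

theorem ann_smul_right (i : ι) (c : K) (f : Finset ι → W) (I : Finset ι) :
    ann r K i (c • f) I = c • ann r K i f I := by
  unfold ann; split_ifs <;> simp [smul_comm c]

/-- `crs` as a linear map. -/
def crsHom (β : ι → K) : (Finset ι → W) →ₗ[K] (Finset ι → W) where
  toFun := crs r β
  map_add' f g := funext fun I => crs_add_right r β f g I
  map_smul' c f := funext fun I => crs_smul_right r β c f I

/-- `ann` as a linear map. -/
def annHom (K : Type*) [CommRing K] {W : Type*} [AddCommGroup W] [Module K W] (i : ι) :
    (Finset ι → W) →ₗ[K] (Finset ι → W) where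
  toFun := ann r K i
  map_add' f g := funext fun I => ann_add_right r i f g I
  map_smul' c f := funext fun I => ann_smul_right r i c f I

theorem crs_crs {K : Type*} [Field K] [CharZero K] [Module K W] (α : ι → K) (f : Finset ι → W)
    (I : Finset ι) : crs r α (crs r α f) I = 0 := by
  have h := crs_crs_add r α α f I
  rw [← two_smul K, smul_eq_zero] at h
  exact h.resolve_left two_ne_zero

end CAR

/-! ### Gaussian families -/

section Gaussian

variable {ι K W : Type*} [LinearOrder ι] [Field K] [CharZero K] [AddCommGroup W] [Module K W]

/-- A family of vectors labelled by finite sets which satisfies the expansion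
`f(I ∪ p) = Φ_p f(I) + ∑_j ± g(p, j) f(I \ j)` whenever `p` is smaller than all elements of `I`. -/
def IsGaussian (Φ : ι → W →ₗ[K] W) (g : ι → ι → K) (f : Finset ι → W) : Prop :=
  ∀ (p : ι) (I : Finset ι), (∀ k ∈ I, p < k) →
    f (insert p I) = Φ p (f I) + crs (· < ·) (g p) f I

theorem ann_of_lt {p : ι} {I : Finset ι} (h : ∀ k ∈ I, p < k) (f : Finset ι → W) :
    ann (· < ·) K p f I = f (insert p I) := by
  have hp : p ∉ I := fun hp => lt_irrefl _ (h p hp)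
  rw [ann, if_neg hp, sgn, filter_eq_empty_iff.2 fun k hk => not_lt.2 (h k hk).le, card_empty, pow_zero,
    one_smul]

/-- Think of f(I) as an ordered product of fermions ψ_k applied to a vector, with ψ_p = Φ_p +
contractions. The Gaussian property describes multiplication by ψ_i from the far left. Since g is
skew, the ψ's anticommute, so the description persists when i has to be moved to its place, and
gives 0 when i already occurs. -/
theorem IsGaussian.ann_eq {Φ : ι → W →ₗ[K] W} {g : ι → ι → K} {f : Finset ι → W}
    (hf : IsGaussian Φ g f) (hΦ : ∀ i j w, Φ i (Φ j w) + Φ j (Φ i w) = 0)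
    (hg : ∀ i j, g i j + g j i = 0) (i : ι) (I : Finset ι) :
    ann (· < ·) K i f I = Φ i (f I) + crs (· < ·) (g i) f I := by
  have hexp : ∀ (p : ι) (I : Finset ι), (∀ k ∈ I, p < k) →
      ann (· < ·) K p f I = Φ p (f I) + crs (· < ·) (g p) f I := fun p I h => by
    rw [ann_of_lt h, hf p I h]
  have hΦ2 : ∀ i w, Φ i (Φ i w) = 0 := fun i w => by
    have h := hΦ i i w
    rw [← two_smul K, smul_eq_zero] at h
    exact h.resolve_left two_ne_zero
  induction hn : I.card using Nat.strong_induction_on generalizing I i with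
  | _ n ih =>
  by_cases hI : ∀ k ∈ I, i < k
  · exact hexp i I hI
  obtain ⟨k₀, hk₀, -⟩ := not_forall₂.1 hI
  have hne : I.Nonempty := ⟨k₀, hk₀⟩
  obtain ⟨p, J, hpJ, rfl⟩ : ∃ p J, (∀ k ∈ J, p < k) ∧ I = insert p J := by
    refine ⟨I.min' hne, I.erase (I.min' hne), fun k hk => ?_, (insert_erase (I.min'_mem hne)).symm⟩
    exact lt_of_le_of_ne (I.min'_le k (mem_of_mem_erase hk)) (ne_of_mem_erase hk).symm
  have hpJ' : p ∉ J := fun h => lt_irrefl _ (hpJ p h)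
  rw [card_insert_of_notMem hpJ'] at hn
  have hcrs_erase : ∀ j, ∀ k ∈ J.erase j, p < k := fun j k hk => hpJ k (mem_of_mem_erase hk)
  -- the left-hand side and the right-hand side as values at `J` of operators applied to `f`
  have hL : ann (· < ·) K i f (insert p J) = ann (· < ·) K p (ann (· < ·) K i f) J :=
    (ann_of_lt hpJ _).symm
  -- The anticommutator of `ann p` and `crs (g i)` moves the right-hand side from `insert p J` down
  -- to J, where the induction hypothesis applies.
  have hR : Φ i (f (insert p J)) + crs (· < ·) (g i) f (insert p J) =
      Φ i (ann (· < ·) K p f J) + (g i p • f J - crs (· < ·) (g i) (ann (· < ·) K p f) J) := by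
    rw [← ann_crs_add (· < ·) p (g i) f J, add_sub_cancel_right, ann_of_lt hpJ, ann_of_lt hpJ]
  have hcp : ∀ β : ι → K, crs (· < ·) β (ann (· < ·) K p f) J =
      Φ p (crs (· < ·) β f J) + crs (· < ·) β (crs (· < ·) (g p) f) J := by
    intro β
    rw [map_crs, ← crs_add_right]
    exact crs_congr _ _ fun j _ => hexp p _ (hcrs_erase j)
  rw [hL, hR]
  rcases lt_trichotomy i p with hip | hip | hip
  · exact absurd (by simpa [hip] using fun k hk => hip.trans (hpJ k hk)) hI
  -- Here i is already present: both sides vanish, since all the squares are zero and g i i = 0.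
  · subst hip
    rw [hcp, hexp i J hpJ, map_add, hΦ2, crs_crs]
    have h1 := ann_ann_add (K := K) (· < ·) i i f J
    rw [← two_smul K, smul_eq_zero] at h1
    have h2 := hg i i
    rw [← two_mul, mul_eq_zero] at h2
    rw [h1.resolve_left two_ne_zero, h2.resolve_left two_ne_zero]
    simp
  -- For i > p the two are interchanged. The expansion of p stays valid on sets with i inserted
  -- because p is still the smallest element.
  · have h1 := ann_ann_add (K := K) (· < ·) p i f J
    have h2 := ann_crs_add (· < ·) i (g p) f J
    have h3 : ann (· < ·) K i (ann (· < ·) K p f) J =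
        Φ p (ann (· < ·) K i f J) + ann (· < ·) K i (crs (· < ·) (g p) f) J := by
      rw [map_ann, ← ann_add_right]
      by_cases hiJ : i ∈ J
      · simp only [ann, if_pos hiJ]
      · unfold ann
        rw [if_neg hiJ, if_neg hiJ]
        congr 1
        refine hexp p _ fun k hk => ?_
        rcases mem_insert.1 hk with rfl | hk
        · exact hip
        · exact hpJ k hk
    have h4 := ih J.card (by omega) i J rfl
    have h5 : crs (· < ·) (g p) (ann (· < ·) K i f) J =
        Φ i (crs (· < ·) (g p) f J) + crs (· < ·) (g p) (crs (· < ·) (g i) f) J := by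
      rw [map_crs, ← crs_add_right]
      refine crs_congr _ _ fun j hj => ih (J.erase j).card ?_ i _ rfl
      rw [card_erase_of_mem hj]; omega
    have h6 := crs_crs_add (· < ·) (g i) (g p) f J
    rw [h3, h4, map_add] at h1
    rw [h5] at h2
    rw [hcp, hexp p J hpJ, map_add]
    have h7 := hΦ i p (f J)
    have h8 : g i p • f J = - (g p i • f J) := by
      rw [eq_neg_iff_add_eq_zero, ← add_smul, hg, zero_smul]
    rw [h8, ← h2]
    rw [add_eq_zero_iff_eq_neg] at h1 h6 h7
    rw [h1, h6, h7]
    abel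

/-- An operator which anticommutes with the `Φ_i` up to scalars and kills `f(∅)` acts on a
Gaussian family by contractions. -/
theorem IsGaussian.map_eq_crs {Φ : ι → W →ₗ[K] W} {g : ι → ι → K} {f : Finset ι → W}
    (hf : IsGaussian Φ g f) (a : W →ₗ[K] W) (β : ι → K)
    (ha : ∀ i w, a (Φ i w) + Φ i (a w) = β i • w) (h0 : a (f ∅) = 0) (I : Finset ι) :
    a (f I) = crs (· < ·) β f I := by
  induction hn : I.card using Nat.strong_induction_on generalizing I with
  | _ n ih =>
  rcases I.eq_empty_or_nonempty with rfl | hne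
  · simp [h0, crs]
  obtain ⟨p, J, hpJ, rfl⟩ : ∃ p J, (∀ k ∈ J, p < k) ∧ I = insert p J := by
    refine ⟨I.min' hne, I.erase (I.min' hne), fun k hk => ?_, (insert_erase (I.min'_mem hne)).symm⟩
    exact lt_of_le_of_ne (I.min'_le k (mem_of_mem_erase hk)) (ne_of_mem_erase hk).symm
  have hpJ' : p ∉ J := fun h => lt_irrefl _ (hpJ p h)
  rw [card_insert_of_notMem hpJ'] at hn
  have h1 := ih J.card (by omega) J rfl
  have h2 : a (crs (· < ·) (g p) f J) = crs (· < ·) (g p) (crs (· < ·) β f) J := by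
    rw [map_crs]
    refine crs_congr _ _ fun j hj => ih (J.erase j).card ?_ _ rfl
    rw [card_erase_of_mem hj]; omega
  have h3 := ann_crs_add (· < ·) p β f J
  have h4 : crs (· < ·) β (ann (· < ·) K p f) J =
      Φ p (crs (· < ·) β f J) + crs (· < ·) β (crs (· < ·) (g p) f) J := by
    rw [map_crs, ← crs_add_right]
    refine crs_congr _ _ fun j _ => ?_
    have h : ∀ k ∈ J.erase j, p < k := fun k hk => hpJ k (mem_of_mem_erase hk)
    rw [ann_of_lt h, hf p _ h]; rfl
  have h5 := crs_crs_add (· < ·) β (g p) f J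
  have h6 := ha p (f J)
  rw [ann_of_lt hpJ, h4] at h3
  rw [add_eq_zero_iff_eq_neg] at h5
  rw [hf p J hpJ, map_add, h2, eq_sub_of_add_eq h6, h1, eq_sub_of_add_eq h3, h5]
  abel

end Gaussian

section GaussianFamily

variable {ι K W : Type*} [LinearOrder ι] [Field K] [AddCommGroup W] [Module K W]

/-- The Gaussian family with given value at the empty set. -/
def gaussian (Φ : ι → W →ₗ[K] W) (g : ι → ι → K) (w₀ : W) (I : Finset ι) : W :=
  if h : I.Nonempty then
    Φ (I.min' h) (gaussian Φ g w₀ (I.erase (I.min' h))) +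
      ∑ j ∈ (I.erase (I.min' h)).attach,
        (g (I.min' h) j * sgn (· < ·) K (j : ι) (I.erase (I.min' h))) •
          gaussian Φ g w₀ ((I.erase (I.min' h)).erase j)
  else w₀
termination_by I.card
decreasing_by
  · exact card_erase_lt_of_mem (I.min'_mem h)
  · exact (card_erase_lt_of_mem j.2).trans (card_erase_lt_of_mem (I.min'_mem h))

theorem gaussian_empty (Φ : ι → W →ₗ[K] W) (g : ι → ι → K) (w₀ : W) :
    gaussian Φ g w₀ ∅ = w₀ := by
  rw [gaussian, dif_neg (by simp)]

theorem isGaussian_gaussian (Φ : ι → W →ₗ[K] W) (g : ι → ι → K) (w₀ : W) :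
    IsGaussian Φ g (gaussian Φ g w₀) := by
  intro p I hp
  have hne : (insert p I).Nonempty := insert_nonempty p I
  have hmin : (insert p I).min' hne = p := by
    refine le_antisymm (min'_le _ _ (mem_insert_self p I)) (le_min' _ _ _ fun k hk => ?_)
    rcases mem_insert.1 hk with rfl | hk
    · exact le_rfl
    · exact (hp k hk).le
  have herase : (insert p I).erase p = I := erase_insert fun h => lt_irrefl _ (hp p h)
  rw [gaussian, dif_pos hne, sum_attach ((insert p I).erase ((insert p I).min' hne)) (fun j =>
    (g ((insert p I).min' hne) j * sgn (· < ·) K j ((insert p I).erase ((insert p I).min' hne))) •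
      gaussian Φ g w₀ (((insert p I).erase ((insert p I).min' hne)).erase j))]
  simp only [hmin, herase]
  rfl

/-- The Pfaffian of the restriction of a skew-symmetric function to a finite set, defined by
expansion along the smallest element. -/
def pf (g : ι → ι → K) : Finset ι → K := gaussian (fun _ => (0 : K →ₗ[K] K)) g 1

theorem pf_empty (g : ι → ι → K) : pf g ∅ = 1 := gaussian_empty _ _ _

theorem pf_insert (g : ι → ι → K) {p : ι} {I : Finset ι} (hp : ∀ k ∈ I, p < k) :
    pf g (insert p I) = crs (· < ·) (g p) (pf g) I := by
  have := isGaussian_gaussian (fun _ => (0 : K →ₗ[K] K)) g 1 p I hp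
  rwa [LinearMap.zero_apply, zero_add] at this

end GaussianFamily

/-! ### Row expansion of the Pfaffian -/

section Pfaffian

variable {K : Type*} [Field K]

/-- The summand of a permutation in the definition of the Pfaffian. -/
def pfaffianTerm {n : ℕ} (A : Matrix (Fin (2 * n)) (Fin (2 * n)) K) (σ : Equiv.Perm (Fin (2 * n))) : K :=
  ((Equiv.Perm.sign σ : ℤ) : K) * ∏ i : Fin n, A (σ ⟨2 * i, by omega⟩) (σ ⟨2 * i + 1, by omega⟩)

/-- Exchanging the two members of a pair changes the sign of the permutation and, by skew symmetry,
the sign of one factor. -/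
theorem pfaffianTerm_mul_swap {n : ℕ} {A : Matrix (Fin (2 * n)) (Fin (2 * n)) K}
    (hA : ∀ i j, A i j = -A j i) (i : Fin n) (σ : Equiv.Perm (Fin (2 * n))) :
    pfaffianTerm A (σ * Equiv.swap ⟨2 * i, by omega⟩ ⟨2 * i + 1, by omega⟩) = pfaffianTerm A σ := by
  have hne : (⟨2 * i, by omega⟩ : Fin (2 * n)) ≠ ⟨2 * i + 1, by omega⟩ := by
    simp [Fin.ext_iff]
  unfold pfaffianTerm
  rw [Equiv.Perm.sign_mul, Equiv.Perm.sign_swap hne, ← mul_prod_erase _ _ (mem_univ i),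
    ← mul_prod_erase univ (fun i : Fin n => A (σ ⟨2 * i, by omega⟩) (σ ⟨2 * i + 1, by omega⟩))
      (mem_univ i)]
  have hprod : ∀ k ∈ univ.erase i,
      A ((σ * Equiv.swap (⟨2 * i, by omega⟩ : Fin (2 * n)) ⟨2 * i + 1, by omega⟩) ⟨2 * k, by omega⟩)
        ((σ * Equiv.swap (⟨2 * i, by omega⟩ : Fin (2 * n)) ⟨2 * i + 1, by omega⟩) ⟨2 * k + 1, by omega⟩) =
      A (σ ⟨2 * k, by omega⟩) (σ ⟨2 * k + 1, by omega⟩) := by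
    intro k hk
    have hki : (k : ℕ) ≠ i := fun h => ne_of_mem_erase hk (Fin.ext h)
    rw [Equiv.Perm.mul_apply, Equiv.Perm.mul_apply, Equiv.swap_apply_of_ne_of_ne,
      Equiv.swap_apply_of_ne_of_ne] <;> simp only [ne_eq, Fin.mk.injEq] <;> omega
  rw [prod_congr rfl hprod, Equiv.Perm.mul_apply, Equiv.Perm.mul_apply, Equiv.swap_apply_left,
    Equiv.swap_apply_right, hA]
  push_cast
  ring

/-- Exchanging two whole pairs is an even permutation and only permutes the factors. -/
theorem pfaffianTerm_mul_swap_swap {n : ℕ} (A : Matrix (Fin (2 * n)) (Fin (2 * n)) K)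
    (i j : Fin n) (σ : Equiv.Perm (Fin (2 * n))) :
    pfaffianTerm A (σ * (Equiv.swap ⟨2 * i, by omega⟩ ⟨2 * j, by omega⟩ *
      Equiv.swap ⟨2 * i + 1, by omega⟩ ⟨2 * j + 1, by omega⟩)) = pfaffianTerm A σ := by
  rcases eq_or_ne i j with rfl | hij
  · rw [Equiv.swap_self, Equiv.swap_self]
    exact congrArg _ (by ext; rfl)
  have hij' : (i : ℕ) ≠ j := fun h => hij (Fin.ext h)
  unfold pfaffianTerm
  rw [← Equiv.prod_comp (Equiv.swap i j)
    (fun i : Fin n => A (σ ⟨2 * i, by omega⟩) (σ ⟨2 * i + 1, by omega⟩))]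
  congr 1
  · rw [Equiv.Perm.sign_mul, Equiv.Perm.sign_mul, Equiv.Perm.sign_swap, Equiv.Perm.sign_swap]
    · simp
    · simp only [ne_eq, Fin.mk.injEq]; omega
    · simp only [ne_eq, Fin.mk.injEq]; omega
  · refine prod_congr rfl fun k _ => ?_
    simp only [Equiv.Perm.mul_apply, Equiv.swap_apply_def, Fin.ext_iff]
    congr 2 <;> split_ifs <;> first | rfl | (exfalso; omega) | (simp only [Fin.mk.injEq] at *; omega)

theorem sum_perm_eq_zero_apply {n : ℕ} (j : Fin (n + 1)) (F : Equiv.Perm (Fin (n + 1)) → K) :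
    ∑ σ, (if σ 0 = j then F σ else 0) =
      ∑ e : Equiv.Perm (Fin n), F (j.cycleRange⁻¹ * Equiv.Perm.decomposeFin.symm (0, e)) := by
  rw [← Equiv.sum_comp (Equiv.mulLeft j.cycleRange⁻¹),
    ← Equiv.sum_comp Equiv.Perm.decomposeFin.symm, Fintype.sum_prod_type, sum_eq_single 0]
  · refine sum_congr rfl fun e _ => if_pos ?_
    simp [Equiv.Perm.mul_apply, Equiv.Perm.inv_def]
  · intro p _ hp
    refine sum_eq_zero fun e _ => if_neg ?_
    rw [Equiv.coe_mulLeft, Equiv.Perm.mul_apply, Equiv.Perm.decomposeFin_symm_apply_zero,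
      Equiv.Perm.inv_eq_iff_eq, Fin.cycleRange_self]
    exact hp
  · simp

/-- The index 0 occupies exactly one of the 2(n+1) positions. The symmetries of the summand act
transitively on the positions, so every position contributes as much as position 0. -/
theorem sum_pfaffianTerm {n : ℕ} {A : Matrix (Fin (2 * (n + 1))) (Fin (2 * (n + 1))) K}
    (hA : ∀ i j, A i j = -A j i) :
    ∑ σ, pfaffianTerm A σ =
      (2 * (n + 1) : K) * ∑ σ : Equiv.Perm (Fin (2 * (n + 1))),
        if σ 0 = 0 then pfaffianTerm A σ else 0 := by
  have h1 : ∀ a : Fin (2 * (n + 1)), (∑ σ : Equiv.Perm (Fin (2 * (n + 1))),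
      if σ a = 0 then pfaffianTerm A σ else 0) =
      ∑ σ : Equiv.Perm (Fin (2 * (n + 1))), if σ 0 = 0 then pfaffianTerm A σ else 0 := by
    intro a
    -- Exchanging pair 0 with the pair of a brings position 0 to the even member of that pair; for
    -- odd a one swap inside the pair follows.
    obtain ⟨π, hπ, hf⟩ : ∃ π : Equiv.Perm (Fin (2 * (n + 1))), π 0 = a ∧
        ∀ σ, pfaffianTerm A (σ * π) = pfaffianTerm A σ := by
      have hev : ∀ i : Fin (n + 1), ∃ π : Equiv.Perm (Fin (2 * (n + 1))), π 0 = ⟨2 * i, by omega⟩ ∧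
          ∀ σ, pfaffianTerm A (σ * π) = pfaffianTerm A σ := by
        intro i
        refine ⟨_, ?_, pfaffianTerm_mul_swap_swap A 0 i⟩
        have h0 : (0 : Fin (2 * (n + 1))) = ⟨2 * ((0 : Fin (n + 1)) : ℕ), by omega⟩ := Fin.ext (by simp)
        have h1 : Equiv.swap (⟨2 * ((0 : Fin (n + 1)) : ℕ) + 1, by omega⟩ : Fin (2 * (n + 1)))
            ⟨2 * i + 1, by omega⟩ 0 = 0 := by
          rw [h0, Equiv.swap_apply_of_ne_of_ne] <;> simp only [ne_eq, Fin.mk.injEq] <;> omega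
        rw [Equiv.Perm.mul_apply, h1, h0, Equiv.swap_apply_left]
      rcases Nat.even_or_odd' (a : ℕ) with ⟨b, hb | hb⟩
      · obtain ⟨π, h, h'⟩ := hev ⟨b, by omega⟩
        exact ⟨π, by rw [h, Fin.ext_iff, hb], h'⟩
      · obtain ⟨π, h, h'⟩ := hev ⟨b, by omega⟩
        refine ⟨Equiv.swap ⟨2 * b, by omega⟩ ⟨2 * b + 1, by omega⟩ * π, ?_, fun σ => ?_⟩
        · rw [Equiv.Perm.mul_apply, h, Equiv.swap_apply_left, Fin.ext_iff, hb]
        · rw [← mul_assoc, h', pfaffianTerm_mul_swap hA ⟨b, by omega⟩]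
    rw [← Equiv.sum_comp (Equiv.mulRight π) (fun σ => if σ 0 = 0 then pfaffianTerm A σ else 0)]
    simp [Equiv.Perm.mul_apply, hπ, hf]
  have h2 : ∀ σ : Equiv.Perm (Fin (2 * (n + 1))), pfaffianTerm A σ =
      ∑ a, if σ a = 0 then pfaffianTerm A σ else 0 := by
    intro σ
    rw [sum_eq_single (σ⁻¹ 0)]
    · simp
    · intro b _ hb
      refine if_neg fun h => hb ?_
      rw [← h]; simp
    · simp
  rw [sum_congr rfl fun σ _ => h2 σ, sum_comm, sum_congr rfl fun a _ => h1 a, sum_const, card_univ,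
    Fintype.card_fin, nsmul_eq_mul]
  push_cast
  ring

/-- Expansion of the Pfaffian along the first row. -/
theorem pfaffian_succ [CharZero K] {n : ℕ} {A : Matrix (Fin (2 * (n + 1))) (Fin (2 * (n + 1))) K}
    (hA : ∀ i j, A i j = -A j i) :
    pfaffian A = ∑ j : Fin (2 * n + 1), (-1) ^ (j : ℕ) * A 0 j.succ *
      pfaffian (A.submatrix (fun k : Fin (2 * n) => (j.succAbove k).succ)
        (fun k : Fin (2 * n) => (j.succAbove k).succ)) := by
  have h0 : pfaffian A = (2 ^ (n + 1) * ((n + 1).factorial : K))⁻¹ * ∑ σ, pfaffianTerm A σ := rfl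
  -- After the normalization σ 0 = 0, the remaining permutations are sorted by the partner σ 1 = j +
  -- 1 of the index 0.
  have h1 : (∑ σ : Equiv.Perm (Fin (2 * (n + 1))), if σ 0 = 0 then pfaffianTerm A σ else 0) =
      ∑ e : Equiv.Perm (Fin (2 * n + 1)), pfaffianTerm A ((0 : Fin (2 * n + 2)).cycleRange⁻¹ *
        Equiv.Perm.decomposeFin.symm (0, e)) :=
    sum_perm_eq_zero_apply (n := 2 * n + 1) 0 (pfaffianTerm A)
  have h2 : ∀ F : Equiv.Perm (Fin (2 * n + 1)) → K, ∑ e, F e =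
      ∑ j : Fin (2 * n + 1), ∑ e : Equiv.Perm (Fin (2 * n)), F (j.cycleRange⁻¹ * Equiv.Perm.decomposeFin.symm (0, e)) := by
    intro F
    rw [← sum_congr rfl fun (j : Fin (2 * n + 1)) _ => sum_perm_eq_zero_apply j F, sum_comm]
    simp
  rw [h0, sum_pfaffianTerm hA, h1, h2, mul_sum, mul_sum]
  refine sum_congr rfl fun j _ => ?_
  have h3 : ∀ e : Equiv.Perm (Fin (2 * n)),
      pfaffianTerm A ((0 : Fin (2 * n + 2)).cycleRange⁻¹ * Equiv.Perm.decomposeFin.symm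
        (0, j.cycleRange⁻¹ * Equiv.Perm.decomposeFin.symm (0, e))) =
      (-1) ^ (j : ℕ) * A 0 j.succ * pfaffianTerm (A.submatrix
        (fun k : Fin (2 * n) => (j.succAbove k).succ) (fun k : Fin (2 * n) => (j.succAbove k).succ)) e := by
    intro e
    rw [Fin.cycleRange_zero, inv_one, one_mul]
    have hs : ∀ k : Fin (2 * n), Equiv.Perm.decomposeFin.symm
        ((0 : Fin (2 * n + 2)), j.cycleRange⁻¹ * Equiv.Perm.decomposeFin.symm ((0 : Fin (2 * n + 1)), e))
          k.succ.succ = (j.succAbove (e k)).succ := by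
      intro k
      simp [Equiv.Perm.inv_def]
    have hs0 : Equiv.Perm.decomposeFin.symm
        ((0 : Fin (2 * n + 2)), j.cycleRange⁻¹ * Equiv.Perm.decomposeFin.symm ((0 : Fin (2 * n + 1)), e))
          1 = j.succ := by
      rw [← Fin.succ_zero_eq_one]
      simp [Equiv.Perm.inv_def]
    unfold pfaffianTerm
    rw [Fin.prod_univ_succ]
    have hp : ∀ i : Fin n, A
        (Equiv.Perm.decomposeFin.symm ((0 : Fin (2 * n + 2)), j.cycleRange⁻¹ *
          Equiv.Perm.decomposeFin.symm ((0 : Fin (2 * n + 1)), e)) ⟨2 * (i.succ : ℕ), by omega⟩)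
        (Equiv.Perm.decomposeFin.symm ((0 : Fin (2 * n + 2)), j.cycleRange⁻¹ *
          Equiv.Perm.decomposeFin.symm ((0 : Fin (2 * n + 1)), e)) ⟨2 * (i.succ : ℕ) + 1, by omega⟩) =
        (A.submatrix (fun k : Fin (2 * n) => (j.succAbove k).succ)
          (fun k : Fin (2 * n) => (j.succAbove k).succ)) (e ⟨2 * i, by omega⟩) (e ⟨2 * i + 1, by omega⟩) := by
      intro i
      rw [Matrix.submatrix_apply, ← hs, ← hs]
      rfl
    rw [prod_congr rfl fun i _ => hp i]
    have hA0 : A (Equiv.Perm.decomposeFin.symm ((0 : Fin (2 * n + 2)), j.cycleRange⁻¹ *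
          Equiv.Perm.decomposeFin.symm ((0 : Fin (2 * n + 1)), e)) ⟨2 * ((0 : Fin (n + 1)) : ℕ), by omega⟩)
        (Equiv.Perm.decomposeFin.symm ((0 : Fin (2 * n + 2)), j.cycleRange⁻¹ *
          Equiv.Perm.decomposeFin.symm ((0 : Fin (2 * n + 1)), e)) ⟨2 * ((0 : Fin (n + 1)) : ℕ) + 1, by omega⟩) =
        A 0 j.succ := by
      rw [← hs0]
      congr 1
    rw [hA0]
    -- The sign of the expansion comes from the cycle that brings j to the front, of length j + 1.
    have hsign : Equiv.Perm.sign (Equiv.Perm.decomposeFin.symm ((0 : Fin (2 * n + 2)), j.cycleRange⁻¹ *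
          Equiv.Perm.decomposeFin.symm ((0 : Fin (2 * n + 1)), e))) = (-1) ^ (j : ℕ) * Equiv.Perm.sign e := by
      rw [Equiv.Perm.decomposeFin.symm_sign, if_pos rfl, one_mul, Equiv.Perm.sign_mul,
        Equiv.Perm.decomposeFin.symm_sign, if_pos rfl, one_mul, Equiv.Perm.sign_inv, Fin.sign_cycleRange]
    have hsign' : ((Equiv.Perm.sign (Equiv.Perm.decomposeFin.symm ((0 : Fin (2 * n + 2)), j.cycleRange⁻¹ *
          Equiv.Perm.decomposeFin.symm ((0 : Fin (2 * n + 1)), e))) : ℤ) : K) =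
        (-1) ^ (j : ℕ) * ((Equiv.Perm.sign e : ℤ) : K) := by
      rw [hsign]; push_cast; ring
    refine (congrArg (· * _) hsign').trans ?_
    ring
  have h4 : pfaffian (A.submatrix (fun k : Fin (2 * n) => (j.succAbove k).succ)
        (fun k : Fin (2 * n) => (j.succAbove k).succ)) = (2 ^ n * (n.factorial : K))⁻¹ *
      ∑ e, pfaffianTerm (A.submatrix (fun k : Fin (2 * n) => (j.succAbove k).succ)
        (fun k : Fin (2 * n) => (j.succAbove k).succ)) e := rfl
  rw [sum_congr rfl fun e _ => h3 e, ← mul_sum, h4, Nat.factorial_succ]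
  have hn : (n : K) + 1 ≠ 0 := by exact_mod_cast Nat.succ_ne_zero n
  have hf : (n.factorial : K) ≠ 0 := by exact_mod_cast n.factorial_ne_zero
  push_cast
  field_simp
  ring

/-- The Pfaffian satisfies the expansion which defines `pf`. -/
theorem pf_image_eq_pfaffian [CharZero K] {ι : Type*} [LinearOrder ι] (g : ι → ι → K)
    (hg : ∀ i j, g i j = -g j i) {n : ℕ} (e : Fin (2 * n) → ι) (he : StrictMono e) :
    pf g (univ.image e) = pfaffian (Matrix.of fun a b => g (e a) (e b)) := by
  induction n with
  | zero =>
    have : (univ : Finset (Fin (2 * 0))) = ∅ := rfl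
    rw [this, image_empty, pf_empty]
    simp [pfaffian]
  | succ n ih =>
    have h0 : univ.image e = insert (e 0) (univ.image fun k : Fin (2 * n + 1) => e k.succ) := by
      have : (univ : Finset (Fin (2 * (n + 1)))) = insert 0 (univ.image (Fin.succ : Fin (2 * n + 1) → _)) := by
        ext k
        simp only [mem_univ, mem_insert, mem_image, true_and, true_iff]
        exact (Fin.eq_zero_or_eq_succ k).imp id fun ⟨j, hj⟩ => ⟨j, hj.symm⟩
      rw [this, image_insert, image_image]
      rfl
    have he' : StrictMono fun k : Fin (2 * n + 1) => e k.succ := he.comp (Fin.strictMono_succ)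
    rw [h0, pf_insert, crs, sum_image he'.injective.injOn, pfaffian_succ]
    · refine sum_congr rfl fun j _ => ?_
      have h1 : (univ.image fun k : Fin (2 * n + 1) => e k.succ).erase (e j.succ) =
          univ.image fun k : Fin (2 * n) => e (j.succAbove k).succ := by
        have : (univ.image fun k : Fin (2 * n + 1) => e k.succ).erase (e j.succ) =
            ((univ : Finset (Fin (2 * n + 1))).erase j).image fun k : Fin (2 * n + 1) => e k.succ :=
          (image_erase he'.injective univ j).symm
        rw [this]
        have h2 : (univ : Finset (Fin (2 * n + 1))).erase j = univ.image j.succAbove := by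
          rw [Fin.image_succAbove_univ, compl_singleton]
        rw [h2, image_image]
        rfl
      -- Exactly j elements of the image are smaller than e (j + 1), because e 0 has been removed.
      have h3 : sgn (· < ·) K (e j.succ) (univ.image fun k : Fin (2 * n + 1) => e k.succ) =
          (-1) ^ (j : ℕ) := by
        rw [sgn, filter_image, card_image_of_injective _ he'.injective]
        congr 1
        rw [filter_congr (fun k _ => he'.lt_iff_lt (b := j)), filter_gt_eq_Iio, Fin.card_Iio]
      rw [h1, h3, ih (fun k => e (j.succAbove k).succ) (he'.comp (Fin.strictMono_succAbove j)), smul_eq_mul,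
        mul_comm ((-1) ^ (j : ℕ)) _]
      rfl
    · exact fun i j => hg _ _
    · intro k hk
      obtain ⟨j, -, rfl⟩ := mem_image.1 hk
      exact he (Fin.succ_pos j)

end Pfaffian

/-! ### Partial fractions -/

section PartialFractions

variable {ι K : Type*} [DecidableEq ι] [Field K] [CharZero K]

/-- The residues of `∏ (1 + y_i z)/(1 - y_i z)`. -/
def residue (y : ι → K) (I : Finset ι) (i : ι) : K :=
  2 * ∏ k ∈ I.erase i, (y i + y k) / (y i - y k)

theorem residue_mul_prod {y : ι → K} {I : Finset ι} (hinj : Set.InjOn y I) {i : ι} (hi : i ∈ I) :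
    residue y I i * ∏ k ∈ I.erase i, (y i - y k) = 2 * ∏ k ∈ I.erase i, (y i + y k) := by
  rw [residue, mul_assoc, ← prod_mul_distrib]
  congr 1
  refine prod_congr rfl fun k hk => div_mul_cancel₀ _ (sub_ne_zero.2 fun h => ?_)
  exact ne_of_mem_erase hk (hinj (mem_of_mem_erase hk) hi h.symm)

open Polynomial Classical in
-- Both sides have degree at most |I| and agree at the |I| + 1 points 0 and y_i. The residues are
-- the values that the points y_i force.
theorem partialFractions_poly {y : ι → K} {I : Finset ι} (hinj : Set.InjOn y I)
    (h0 : ∀ i ∈ I, y i ≠ 0) :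
    ∏ i ∈ I, (X + C (y i)) = C ((-1) ^ I.card) * ∏ i ∈ I, (X - C (y i)) +
      ∑ i ∈ I, C (residue y I i) * (X * ∏ k ∈ I.erase i, (X - C (y k))) := by
  have hcard : (insert 0 (I.image y)).card = I.card + 1 := by
    rw [card_insert_of_notMem, card_image_of_injOn hinj]
    simp only [mem_image, not_exists, not_and]
    exact h0
  have hadd : ∀ s : Finset ι, (∏ i ∈ s, (X + C (y i))).natDegree ≤ s.card := by
    intro s
    refine (natDegree_prod_le _ _).trans ?_
    refine (sum_le_card_nsmul s _ 1 fun i _ => ?_).trans (by simp)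
    rw [natDegree_X_add_C]
  have hsub : ∀ s : Finset ι, (∏ i ∈ s, (X - C (y i))).natDegree ≤ s.card := by
    intro s
    refine (natDegree_prod_le _ _).trans ?_
    refine (sum_le_card_nsmul s _ 1 fun i _ => ?_).trans (by simp)
    rw [natDegree_X_sub_C]
  have hlt : ((I.card : ℕ) : WithBot ℕ) < ((I.card + 1 : ℕ) : WithBot ℕ) := by
    exact_mod_cast Nat.lt_succ_self _
  refine eq_of_degrees_lt_of_eval_finset_eq (insert 0 (I.image y)) ?_ ?_ ?_
  · rw [hcard]
    exact (degree_le_of_natDegree_le (hadd I)).trans_lt hlt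
  · rw [hcard]
    refine (degree_le_of_natDegree_le (natDegree_add_le_of_degree_le ?_ ?_)).trans_lt hlt
    · exact (natDegree_C_mul_le _ _).trans (hsub I)
    · refine natDegree_sum_le_of_forall_le _ _ fun i hi => (natDegree_C_mul_le _ _).trans ?_
      refine natDegree_mul_le.trans ?_
      have h1 := hsub (I.erase i)
      rw [card_erase_of_mem hi] at h1
      have h2 := card_pos.2 ⟨i, hi⟩
      rw [natDegree_X]
      omega
  · intro x hx
    simp only [eval_prod, eval_add, eval_mul, eval_sub, eval_finsetSum, eval_X, eval_C]
    rcases mem_insert.1 hx with rfl | hx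
    · simp [prod_neg, ← mul_assoc, ← pow_add, ← two_mul]
    · obtain ⟨i, hi, rfl⟩ := mem_image.1 hx
      have hz : ∏ k ∈ I, (y i - y k) = 0 := prod_eq_zero hi (sub_self _)
      rw [hz, mul_zero, zero_add, sum_eq_single i]
      · rw [mul_left_comm, residue_mul_prod hinj hi, ← mul_prod_erase _ _ hi]
        ring
      · intro j hj hji
        rw [prod_eq_zero (mem_erase.2 ⟨hji.symm, hi⟩) (sub_self _)]
        simp
      · exact fun h => absurd hi h

/-- Evaluation at 1/z, multiplied by z^|I|. In quotient form: ∏ (1 + y_i z)/(1 - y_i z) = (-1)^|I| +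
∑ c_i/(1 - y_i z). -/
theorem partialFractions {y : ι → K} {I : Finset ι} (hinj : Set.InjOn y I)
    (h0 : ∀ i ∈ I, y i ≠ 0) {z : K} (hz : z ≠ 0) :
    ∏ i ∈ I, (1 + y i * z) = (-1) ^ I.card * ∏ i ∈ I, (1 - y i * z) +
      ∑ i ∈ I, residue y I i * ∏ k ∈ I.erase i, (1 - y k * z) := by
  have h := congrArg (fun p => z ^ I.card * p.eval z⁻¹) (partialFractions_poly hinj h0)
  simp only [Polynomial.eval_prod, Polynomial.eval_add, Polynomial.eval_mul, Polynomial.eval_sub,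
    Polynomial.eval_finsetSum, Polynomial.eval_X, Polynomial.eval_C] at h
  have h1 : ∀ s : Finset ι, z ^ s.card * ∏ i ∈ s, (z⁻¹ + y i) = ∏ i ∈ s, (1 + y i * z) := by
    intro s
    rw [← prod_const, ← prod_mul_distrib]
    exact prod_congr rfl fun i _ => by field_simp
  have h2 : ∀ s : Finset ι, z ^ s.card * ∏ i ∈ s, (z⁻¹ - y i) = ∏ i ∈ s, (1 - y i * z) := by
    intro s
    rw [← prod_const, ← prod_mul_distrib]
    exact prod_congr rfl fun i _ => by field_simp
  rw [h1, mul_add, mul_left_comm, h2, mul_sum] at h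
  rw [h]
  congr 1
  refine sum_congr rfl fun i hi => ?_
  rw [← h2, card_erase_of_mem hi, mul_left_comm]
  congr 1
  obtain ⟨n, hn⟩ := Nat.exists_eq_succ_of_ne_zero (card_ne_zero_of_mem hi)
  rw [hn, Nat.succ_sub_one, pow_succ]
  field_simp

open Polynomial in
/-- The partial fraction identity as an identity of polynomials in `z`. -/
theorem partialFractions_poly' {y : ι → K} {I : Finset ι} (hinj : Set.InjOn y I)
    (h0 : ∀ i ∈ I, y i ≠ 0) :
    ∏ i ∈ I, (1 + C (y i) * X) = C ((-1) ^ I.card) * ∏ i ∈ I, (1 - C (y i) * X) +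
      ∑ i ∈ I, C (residue y I i) * ∏ k ∈ I.erase i, (1 - C (y k) * X) := by
  refine eq_of_infinite_eval_eq _ _ (Set.Infinite.mono (s := {(0 : K)}ᶜ) ?_
    (Set.finite_singleton _).infinite_compl)
  intro z hz
  simp only [Set.mem_ofPred_eq, eval_prod, eval_add, eval_mul, eval_sub, eval_finsetSum, eval_X,
    eval_C, eval_one]
  exact partialFractions hinj h0 hz

/-- The value of the partial fraction identity at z = 0. -/
theorem sum_residue {y : ι → K} {I : Finset ι} (hinj : Set.InjOn y I) (h0 : ∀ i ∈ I, y i ≠ 0) :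
    ∑ i ∈ I, residue y I i = 1 - (-1) ^ I.card := by
  have h := congrArg (Polynomial.eval 0) (partialFractions_poly' hinj h0)
  simp only [Polynomial.eval_prod, Polynomial.eval_add, Polynomial.eval_mul, Polynomial.eval_sub,
    Polynomial.eval_finsetSum, Polynomial.eval_X, Polynomial.eval_C, Polynomial.eval_one, mul_zero,
    add_zero, sub_zero, prod_const_one, mul_one] at h
  rw [eq_sub_iff_add_eq, add_comm]
  exact h.symm

/-- The partial fraction identity at z = -1/x. -/
theorem sum_residue_div {y : ι → K} {I : Finset ι} (hinj : Set.InjOn y I) (h0 : ∀ i ∈ I, y i ≠ 0)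
    {x : K} (hx : x ≠ 0) (hxy : ∀ i ∈ I, x + y i ≠ 0) :
    ∑ i ∈ I, residue y I i * (x / (x + y i)) =
      ∏ i ∈ I, (x - y i) / (x + y i) - (-1) ^ I.card := by
  have h := partialFractions hinj h0 (z := -x⁻¹) (by simpa using hx)
  have h1 : ∀ s : Finset ι, ∏ i ∈ s, (1 + y i * -x⁻¹) = (∏ i ∈ s, (x - y i)) / x ^ s.card := by
    intro s
    rw [← prod_const, ← prod_div_distrib]
    exact prod_congr rfl fun i _ => by field_simp; ring
  have h2 : ∀ s : Finset ι, ∏ i ∈ s, (1 - y i * -x⁻¹) = (∏ i ∈ s, (x + y i)) / x ^ s.card := by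
    intro s
    rw [← prod_const, ← prod_div_distrib]
    exact prod_congr rfl fun i _ => by field_simp; ring
  have hP : ∏ i ∈ I, (x + y i) ≠ 0 := prod_ne_zero_iff.2 hxy
  have hxn : x ^ I.card ≠ 0 := pow_ne_zero _ hx
  rw [h1, h2] at h
  have h3 : ∏ i ∈ I, (x - y i) = (-1) ^ I.card * ∏ i ∈ I, (x + y i) +
      (∏ i ∈ I, (x + y i)) * ∑ i ∈ I, residue y I i * (x / (x + y i)) := by
    rw [div_eq_iff hxn] at h
    rw [h, add_mul, mul_assoc, div_mul_cancel₀ _ hxn, sum_mul, mul_sum]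
    congr 1
    refine sum_congr rfl fun i hi => ?_
    rw [h2, card_erase_of_mem hi, ← mul_prod_erase _ _ hi]
    obtain ⟨n, hn⟩ := Nat.exists_eq_succ_of_ne_zero (card_ne_zero_of_mem hi)
    rw [hn, Nat.succ_sub_one, pow_succ]
    have := hxy i hi
    field_simp
  rw [prod_div_distrib, eq_sub_iff_add_eq, eq_div_iff hP, h3]
  ring

open PowerSeries in
-- The recursion is z Q' = Q · (z d/dz of the exponent) for Q = ∑ q_k z^k = exp(∑_{m odd} (2/m) ∑_i
-- (y_i z)^m). The product ∏ (1 + y_i z)/(1 - y_i z) obeys the same recursion, and its coefficients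
-- are read off from the partial fractions. The coefficient of z^0 is exceptional because of the
-- constant (-1)^|I|.
theorem eq_sum_residue {y : ι → K} {I : Finset ι} (hinj : Set.InjOn y I) (h0 : ∀ i ∈ I, y i ≠ 0)
    {q : ℕ → K} (hq0 : q 0 = 1)
    (hq : ∀ k, k * q k = ∑ p ∈ antidiagonal k,
      q p.1 * if Odd p.2 then 2 * ∑ i ∈ I, y i ^ p.2 else 0) {k : ℕ} (hk : k ≠ 0) :
    q k = ∑ i ∈ I, residue y I i * y i ^ k := by
  have hgeom : ∀ a : K, PowerSeries.mk (fun k => a ^ k) * (1 - C a * X) = 1 := by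
    intro a
    ext n
    rw [mul_sub, mul_one, ← mul_assoc, map_sub, mul_comm _ (C a)]
    cases n with
    | zero => simp
    | succ n => rw [coeff_succ_mul_X]; simp [pow_succ', coeff_one]
  have hne : ∀ a : K, (1 - C a * X : K⟦X⟧) ≠ 0 := fun a h => by
    simpa [h] using hgeom a
  have hne' : ∀ a : K, (1 + C a * X : K⟦X⟧) ≠ 0 := fun a h => hne (-a) (by simpa using h)
  -- E(a) = (1 + az)/(1 - az), and O(a) = 2az/(1 - a²z²) is its logarithmic derivative times z.
  let E : K → K⟦X⟧ := fun a => (1 + C a * X) * PowerSeries.mk (fun k => a ^ k)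
  let O : K → K⟦X⟧ := fun a => PowerSeries.mk fun k => if Odd k then 2 * a ^ k else 0
  have hE : ∀ a, E a * (1 - C a * X) = 1 + C a * X := fun a => by
    simp only [E]; rw [mul_assoc, hgeom, mul_one]
  have hO : ∀ a, O a * ((1 - C a * X) * (1 + C a * X)) = 2 * (C a * X) := by
    intro a
    have h1 : O a = PowerSeries.mk (fun k => a ^ k) - PowerSeries.mk (fun k => (-a) ^ k) := by
      ext n
      simp only [O, map_sub, coeff_mk]
      split_ifs with h
      · rw [h.neg_pow]; ring
      · rw [(Nat.not_odd_iff_even.1 h).neg_pow]; ring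
    have h2 := hgeom a
    have h3 := hgeom (-a)
    rw [map_neg] at h3
    rw [h1]
    linear_combination (1 + C a * X) * h2 - (1 - C a * X) * h3
  have hEd : ∀ a, X * d⁄dX K (E a) = E a * O a := by
    intro a
    have hd : d⁄dX K (C a * X : K⟦X⟧) = C a := by
      rw [Derivation.leibniz, derivative_C, derivative_X]; simp
    have hd1 : d⁄dX K (1 : K⟦X⟧) = 0 := Derivation.map_one_eq_zero _
    have h1 := congrArg (d⁄dX K) (hE a)
    rw [Derivation.leibniz, map_sub, map_add, hd, hd1, smul_eq_mul, smul_eq_mul] at h1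
    refine mul_right_cancel₀ (mul_ne_zero (mul_ne_zero (hne a) (hne a)) (hne' a)) ?_
    have h2 := hE a
    have h3 := hO a
    linear_combination (X * (1 - C a * X) * (1 + C a * X)) * h1 + (C a * X * (1 + C a * X)) * h2 - E a * (1 - C a * X) * h3 - (2 * C a * X) * h2
  let Q : K⟦X⟧ := ∏ i ∈ I, E (y i)
  have hQd : X * d⁄dX K Q = Q * ∑ i ∈ I, O (y i) := by
    have : ∀ s : Finset ι, X * d⁄dX K (∏ i ∈ s, E (y i)) =
        (∏ i ∈ s, E (y i)) * ∑ i ∈ s, O (y i) := by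
      intro s
      induction s using Finset.induction_on with
      | empty => simp [Derivation.map_one_eq_zero]
      | insert i s his ih =>
        rw [prod_insert his, sum_insert his, Derivation.leibniz, smul_eq_mul, smul_eq_mul]
        linear_combination E (y i) * ih + (∏ i ∈ s, E (y i)) * hEd (y i)
    exact this I
  have hOsum : ∀ k, coeff k (∑ i ∈ I, O (y i)) = if Odd k then 2 * ∑ i ∈ I, y i ^ k else 0 := by
    intro k
    simp only [O, map_sum, coeff_mk]
    split_ifs <;> simp [mul_sum]
  have hQrec : ∀ k, k * coeff k Q = ∑ p ∈ antidiagonal k,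
      coeff p.1 Q * if Odd p.2 then 2 * ∑ i ∈ I, y i ^ p.2 else 0 := by
    intro k
    have h : coeff k (X * d⁄dX K Q) = ∑ p ∈ antidiagonal k,
        coeff p.1 Q * if Odd p.2 then 2 * ∑ i ∈ I, y i ^ p.2 else 0 := by
      rw [hQd, coeff_mul]
      simp only [hOsum]
    rw [← h]
    cases k with
    | zero => simp
    | succ k => rw [mul_comm X, coeff_succ_mul_X, coeff_derivative]; push_cast; ring
  have hQ0 : coeff 0 Q = 1 := by simp [Q, E, coeff_zero_eq_constantCoeff, map_prod]
  have hqQ : ∀ k, q k = coeff k Q := by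
    intro k
    induction k using Nat.strong_induction_on with
    | _ k ih =>
    rcases Nat.eq_zero_or_pos k with rfl | hk
    · rw [hq0, hQ0]
    · have : (k : K) ≠ 0 := by exact_mod_cast hk.ne'
      refine mul_left_cancel₀ this ?_
      rw [hq, hQrec]
      refine sum_congr rfl fun p hp => ?_
      rw [HasAntidiagonal.mem_antidiagonal] at hp
      by_cases h : p.1 < k
      · rw [ih _ h]
      -- The unknown q_k itself occurs on the right only with p.2 = 0, which is even and contributes
      -- nothing.
      · have : p.2 = 0 := by omega
        simp [this]
  have hQP : Q * ∏ i ∈ I, (1 - C (y i) * X) = ∏ i ∈ I, (1 + C (y i) * X) := by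
    simp only [Q]
    rw [← prod_mul_distrib]
    exact prod_congr rfl fun i _ => hE _
  have hPF := congrArg Polynomial.coeToPowerSeries.ringHom (partialFractions_poly' hinj h0)
  simp only [map_prod, map_add, map_mul, map_sum, map_sub, map_one,
    Polynomial.coeToPowerSeries.ringHom_apply, Polynomial.coe_C, Polynomial.coe_X] at hPF
  have hQ : Q = C ((-1) ^ I.card) + ∑ i ∈ I, C (residue y I i) * PowerSeries.mk (fun k => y i ^ k) := by
    refine mul_right_cancel₀ (prod_ne_zero_iff.2 fun i (_ : i ∈ I) => hne (y i)) ?_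
    rw [hQP, add_mul, sum_mul]
    have hP : ∀ i ∈ I, C (residue y I i) * PowerSeries.mk (fun k => y i ^ k) * ∏ i ∈ I, (1 - C (y i) * X) =
        C (residue y I i) * ∏ k ∈ I.erase i, (1 - C (y k) * X) := by
      intro i hi
      rw [← mul_prod_erase _ _ hi, mul_assoc, ← mul_assoc (PowerSeries.mk _), hgeom, one_mul]
    rw [sum_congr rfl hP]
    exact hPF
  rw [hqQ, hQ, map_add, coeff_C, if_neg hk, zero_add, map_sum]
  simp [coeff_C_mul]

end PartialFractions

/-! ### The vectors `φ(y_1) ⋯ φ(y_N) |0⟩` -/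

section Vectors

variable {ι K : Type*} [LinearOrder ι] [Field K] [CharZero K]

/-- The pair correlation `(y_i - y_j) / (2 (y_i + y_j))`. -/
def corr (y : ι → K) (i j : ι) : K := 1 / 2 * ((y i - y j) / (y i + y j))

theorem corr_add_swap (y : ι → K) (i j : ι) : corr y i j + corr y j i = 0 := by
  unfold corr
  rw [add_comm (y j) (y i), ← neg_sub (y i) (y j), neg_div]; ring

/-- The coefficients of `φ(y_{i_1}) ⋯ φ(y_{i_k}) |0⟩`, `i_1 < ⋯ < i_k`, where
`φ(y) = ∑_{s ∈ ℤ} w_s y^s φ_s` and contractions are expanded as rational functions. -/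
def fermiVec (w : ℕ → K) (y : ι → K) : Finset ι → Finset ℕ → K :=
  gaussian (fun i => crsHom (· > ·) fun s => w s * y i ^ s) (corr y) (Pi.single ∅ 1)

theorem ann_single_empty (s : ℕ) : ann (· > ·) K s (Pi.single ∅ (1 : K)) = 0 := by
  funext S
  unfold ann
  split_ifs
  · rfl
  · rw [Pi.single_eq_of_ne (insert_ne_empty s S), smul_zero]; rfl

theorem fermiVec_empty (w : ℕ → K) (y : ι → K) : fermiVec w y ∅ = Pi.single ∅ 1 :=
  gaussian_empty _ _ _

theorem isGaussian_fermiVec (w : ℕ → K) (y : ι → K) :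
    IsGaussian (fun i => crsHom (W := K) (· > ·) fun s => w s * y i ^ s) (corr y) (fermiVec w y) :=
  isGaussian_gaussian _ _ _

/-- The annihilator of s anticommutes with the creation part of φ(y_i) up to the scalar w_s y_i^s
and kills the vacuum, so it acts by contractions only. -/
theorem ann_fermiVec (w : ℕ → K) (y : ι → K) (s : ℕ) (I : Finset ι) :
    ann (· > ·) K s (fermiVec w y I) = crs (· < ·) (fun i => w s * y i ^ s) (fermiVec w y) I := by
  refine (isGaussian_fermiVec w y).map_eq_crs (annHom (W := K) (· > ·) K s) (fun i => w s * y i ^ s)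
    (fun i f => funext fun S => ?_) ?_ I
  · exact ann_crs_add (· > ·) s _ f S
  · rw [fermiVec_empty]
    exact ann_single_empty s

/-- This is φ(y_i)² = 0: for i ∈ I the product with a second factor φ(y_i) vanishes, so its creation
part is minus its contractions. -/
theorem crs_fermiVec (w : ℕ → K) (y : ι → K) {i : ι} {I : Finset ι} (hi : i ∈ I) :
    crs (· > ·) (fun s => w s * y i ^ s) (fermiVec w y I) =
      -crs (· < ·) (corr y i) (fermiVec w y) I := by
  have h := (isGaussian_fermiVec w y).ann_eq (fun i j f => funext fun S => crs_crs_add (· > ·) _ _ f S)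
    (corr_add_swap y) i I
  rw [ann, if_pos hi] at h
  exact eq_neg_of_add_eq_zero_left h.symm

/-- The bilinear relations `∑_k q_k w_{k-m} φ_{k-m} f = 0`, `m ≥ 1`, where `w_{-n} = 1/w_n`. -/
def Annihilated (q w w' : ℕ → K) (f : Finset ℕ → K) : Prop :=
  ∀ m ≠ 0, ∀ S, ∑ k ∈ range m, q k * (w' (m - k) * (-1) ^ (m - k)) * ann (· > ·) K (m - k) f S +
    1 / 2 * q m * ann (· > ·) K 0 f S + crs (· > ·) (fun s => q (m + s) * w s) f S = 0

/-- The coefficient identity behind the relations for φ(y_1)⋯φ(y_N)|0⟩. Without the last summand on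
the left it is proved by induction on m; the step is multiplication by -y_j and a common denominator
y_i + y_j, so all the content is in the first case. -/
theorem sum_mul_neg_pow {y : ι → K} {I : Finset ι} (hinj : Set.InjOn y I)
    (hy : ∀ i ∈ I, ∀ j ∈ I, y i + y j ≠ 0) {q : ℕ → K} (hq0 : q 0 = 1)
    (hq : ∀ k ≠ 0, q k = ∑ i ∈ I, residue y I i * y i ^ k) {j : ι} (hj : j ∈ I) {m : ℕ} (hm : m ≠ 0) :
    ∑ k ∈ range m, q k * (-y j) ^ (m - k) + 1 / 2 * q m =
      ∑ i ∈ I, residue y I i * y i ^ m * corr y i j := by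
  have h0 : ∀ i ∈ I, y i ≠ 0 := fun i hi h => hy i hi i hi (by rw [h, add_zero])
  -- At x = y_j the product in `sum_residue_div` has a zero factor. What is left combines with
  -- `sum_residue` to (1 - (-1)^|I|) + (-1)^|I| = 1, which is the value q_0 not covered by the
  -- residue formula.
  have hprod : ∏ i ∈ I, (y j - y i) / (y j + y i) = 0 := prod_eq_zero hj (by simp)
  have hdiv := sum_residue_div hinj h0 (h0 j hj) (fun i hi => hy j hj i hi)
  have hsum := sum_residue hinj h0
  rw [hprod, zero_sub] at hdiv
  have hB : ∀ m, ∑ k ∈ range (m + 1), q k * (-y j) ^ (m + 1 - k) =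
      ∑ i ∈ I, residue y I i * y i ^ (m + 1) * (-(y j / (y j + y i))) := by
    intro m
    induction m with
    | zero =>
      rw [sum_range_one, hq0]
      have : ∀ i ∈ I, residue y I i * y i ^ (0 + 1) * (-(y j / (y j + y i))) =
          (-y j) * (residue y I i - residue y I i * (y j / (y j + y i))) := by
        intro i hi
        have := hy j hj i hi
        field_simp
        ring
      rw [sum_congr rfl this, ← mul_sum, sum_sub_distrib, hdiv, hsum]
      ring
    | succ m ih =>
      have h1 : ∑ k ∈ range (m + 1), q k * (-y j) ^ (m + 1 + 1 - k) =
          (-y j) * ∑ k ∈ range (m + 1), q k * (-y j) ^ (m + 1 - k) := by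
        rw [mul_sum]
        refine sum_congr rfl fun k hk => ?_
        have := mem_range.1 hk
        rw [show m + 1 + 1 - k = (m + 1 - k) + 1 by omega, pow_succ]
        ring
      rw [sum_range_succ, h1, ih, hq (m + 1) (by omega), show m + 1 + 1 - (m + 1) = 1 by omega, pow_one,
        mul_comm _ (-y j), ← mul_add, ← sum_add_distrib, mul_sum]
      refine sum_congr rfl fun i hi => ?_
      have := hy j hj i hi
      field_simp
      ring
  obtain ⟨n, rfl⟩ := Nat.exists_eq_succ_of_ne_zero hm
  rw [Nat.succ_eq_add_one, hB, hq _ hm, mul_sum, ← sum_add_distrib]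
  refine sum_congr rfl fun i hi => ?_
  have := hy j hj i hi
  rw [corr, add_comm (y i) (y j)]
  field_simp
  ring

/-- The residue formula turns ∑_s q_{m+s} w_s φ_s into ∑_i c_i y_i^m times the creation part of
φ(y_i). By `crs_fermiVec` and `ann_fermiVec` every term is then a combination of the vectors with
one factor j omitted, and the coefficients for each j cancel by `sum_mul_neg_pow`. -/
theorem annihilated_fermiVec {y : ι → K} {I : Finset ι} (hinj : Set.InjOn y I)
    (hy : ∀ i ∈ I, ∀ j ∈ I, y i + y j ≠ 0) {q w w' : ℕ → K} (hq0 : q 0 = 1)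
    (hq : ∀ k ≠ 0, q k = ∑ i ∈ I, residue y I i * y i ^ k) (hw : ∀ s, w' s * w s = 1)
    (hw0 : w 0 = 1) : Annihilated q w w' (fermiVec w y I) := by
  intro m hm S
  have hcre : (fun s => q (m + s) * w s) =
      ∑ i ∈ I, (residue y I i * y i ^ m) • fun s => w s * y i ^ s := by
    funext s
    rw [hq _ (by omega), Finset.sum_apply, sum_mul]
    refine sum_congr rfl fun i _ => ?_
    simp only [Pi.smul_apply, smul_eq_mul, pow_add]
    ring
  have hann : ∀ s, ann (· > ·) K s (fermiVec w y I) S =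
      ∑ j ∈ I, (w s * y j ^ s * sgn (· < ·) K j I) * fermiVec w y (I.erase j) S := by
    intro s
    rw [ann_fermiVec, crs, Finset.sum_apply]
    rfl
  rw [hcre, crs_sum]
  have hcre' : ∀ i ∈ I, crs (· > ·) ((residue y I i * y i ^ m) • fun s => w s * y i ^ s)
      (fermiVec w y I) S = -∑ j ∈ I, (residue y I i * y i ^ m * corr y i j) *
        (sgn (· < ·) K j I * fermiVec w y (I.erase j) S) := by
    intro i hi
    rw [crs_smul, crs_fermiVec w y hi, Pi.neg_apply, crs, Finset.sum_apply, smul_neg, smul_sum]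
    congr 1
    refine sum_congr rfl fun j _ => ?_
    simp only [Pi.smul_apply, smul_eq_mul]
    ring
  rw [sum_congr rfl hcre', sum_neg_distrib, sum_comm]
  simp only [hann, ← sum_mul]
  rw [← sub_eq_add_neg, sub_eq_zero]
  simp only [mul_sum]
  rw [sum_comm, ← sum_add_distrib]
  refine sum_congr rfl fun j hj => ?_
  rw [← sum_mul_neg_pow hinj hy hq0 hq hj hm, add_mul, sum_mul]
  congr 1
  · refine sum_congr rfl fun k _ => ?_
    rw [neg_pow]
    linear_combination (q k * (-1) ^ (m - k) * y j ^ (m - k) * sgn (· < ·) K j I *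
      fermiVec w y (I.erase j) S) * hw (m - k)
  · rw [hw0, pow_zero]; ring

/-- A solution of the bilinear relations is determined by two coefficients. -/
theorem Annihilated.eq_zero {q w w' : ℕ → K} {f : Finset ℕ → K} (hf : Annihilated q w w' f)
    (hq0 : q 0 = 1) (hw : ∀ s, w' s * w s = 1) (h0 : f ∅ = 0) (h1 : f {0} = 0) (S : Finset ℕ) :
    f S = 0 := by
  induction hn : ∑ s ∈ S, s using Nat.strong_induction_on generalizing S with
  | _ n ih =>
  by_cases hS : S ⊆ {0}
  · rcases subset_singleton_iff.1 hS with rfl | rfl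
    · exact h0
    · exact h1
  -- The relation of index m is used at S \ {m} for some nonzero m ∈ S. Its term k = 0 is a nonzero
  -- multiple of f(S); all the others involve sets of smaller energy ∑ s. The sets ∅ and {0} are the
  -- only ones without such an m.
  obtain ⟨m, hmS, hm⟩ := not_subset.1 hS
  rw [mem_singleton] at hm
  obtain ⟨m, rfl⟩ : ∃ n, m = n + 1 := Nat.exists_eq_succ_of_ne_zero hm
  have hsum := add_sum_erase S (fun s => s) hmS
  have hins : ∀ s < m + 1, f (insert s (S.erase (m + 1))) = 0 := by
    intro s hs
    refine ih _ ?_ _ rfl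
    by_cases hs' : s ∈ S.erase (m + 1)
    · rw [insert_eq_of_mem hs']; omega
    · rw [sum_insert hs']; omega
  have hann : ∀ s < m + 1, ann (· > ·) K s f (S.erase (m + 1)) = 0 := by
    intro s hs
    unfold ann
    split_ifs
    · rfl
    · rw [hins s hs, smul_zero]
  have hcre : crs (· > ·) (fun s => q (m + 1 + s) * w s) f (S.erase (m + 1)) = 0 := by
    refine sum_eq_zero fun s hs => ?_
    have h2 := add_sum_erase (S.erase (m + 1)) (fun s => s) hs
    rw [ih _ _ ((S.erase (m + 1)).erase s) rfl, smul_zero]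
    omega
  have h := hf (m + 1) (by omega) (S.erase (m + 1))
  rw [sum_range_succ', hcre, hann 0 (by omega), sum_eq_zero, hq0] at h
  · simp only [ann, Nat.sub_zero, notMem_erase, if_false, insert_erase hmS, sgn_erase_self, mul_zero,
      add_zero, zero_add, one_mul, smul_eq_mul, ← mul_assoc] at h
    refine (mul_eq_zero.1 h).resolve_left (mul_ne_zero (mul_ne_zero ?_ ?_) ?_)
    · exact left_ne_zero_of_mul_eq_one (hw (m + 1))
    · exact pow_ne_zero _ (neg_ne_zero.2 one_ne_zero)
    · exact left_ne_zero_of_mul_eq_one (sgn_mul_self (K := K) (· > ·) (m + 1) S)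
  · intro k hk
    rw [hann _ (by omega), mul_zero]

theorem Annihilated.sub_smul {q w w' : ℕ → K} {f g : Finset ℕ → K} (hf : Annihilated q w w' f)
    (hg : Annihilated q w w' g) (c : K) : Annihilated q w w' (f + c • g) := by
  intro m hm S
  have h1 := hf m hm S
  have h2 := hg m hm S
  simp only [ann_add_right, ann_smul_right, crs_add_right, crs_smul_right, smul_eq_mul, mul_add,
    sum_add_distrib]
  have h3 : ∀ k, q k * (w' (m - k) * (-1) ^ (m - k)) * (c * ann (· > ·) K (m - k) g S) =
      c * (q k * (w' (m - k) * (-1) ^ (m - k)) * ann (· > ·) K (m - k) g S) := fun k => by ring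
  simp only [h3, ← mul_sum]
  linear_combination h1 + c * h2

theorem Annihilated.ext {q w w' : ℕ → K} {f g : Finset ℕ → K} (hf : Annihilated q w w' f)
    (hg : Annihilated q w w' g) (hq0 : q 0 = 1) (hw : ∀ s, w' s * w s = 1) (h0 : f ∅ = g ∅)
    (h1 : f {0} = g {0}) : f = g := by
  funext S
  have h := (hf.sub_smul hg (-1)).eq_zero hq0 hw (by simp [h0]) (by simp [h1]) S
  simpa [add_neg_eq_zero] using h

/-- Right multiplication by `φ_0`. -/
def toggle (f : Finset ℕ → K) (S : Finset ℕ) : K :=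
  if 0 ∈ S then f (S.erase 0) else 1 / 2 * f (insert 0 S)

theorem sgn_insert_zero (s : ℕ) {S : Finset ℕ} (h : 0 ∉ S) :
    sgn (· > ·) K s (insert 0 S) = sgn (· > ·) K s S := by
  rw [sgn_insert _ _ h, if_neg (Nat.not_lt_zero s), one_mul]

theorem sgn_erase_zero (s : ℕ) (S : Finset ℕ) :
    sgn (· > ·) K s (S.erase 0) = sgn (· > ·) K s S := by
  by_cases h : 0 ∈ S
  · rw [sgn_erase _ _ h, if_neg (Nat.not_lt_zero s), one_mul]
  · rw [erase_eq_of_notMem h]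

theorem ann_toggle {s : ℕ} (hs : s ≠ 0) (f : Finset ℕ → K) (S : Finset ℕ) :
    ann (· > ·) K s (toggle f) S = toggle (ann (· > ·) K s f) S := by
  by_cases hS : s ∈ S
  · simp [ann, toggle, hS, hs]
  · by_cases h : 0 ∈ S
    · simp [ann, toggle, hS, h, hs, sgn_erase_zero, erase_insert_of_ne hs]
    · simp [ann, toggle, hS, h, hs, hs.symm, sgn_insert_zero, insert_comm s 0]
      ring

/-- The operator on both sides is left multiplication by ∑_{s ≥ 0} a_s φ_s, where φ_0 consists of
creation and half of annihilation. Left and right multiplications commute. -/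
theorem phi_zero_toggle (a : ℕ → K) (f : Finset ℕ → K) (S : Finset ℕ) :
    1 / 2 * a 0 * ann (· > ·) K 0 (toggle f) S + crs (· > ·) a (toggle f) S =
      toggle (fun S => 1 / 2 * a 0 * ann (· > ·) K 0 f S + crs (· > ·) a f S) S := by
  by_cases h : 0 ∈ S
  · have h1 : crs (· > ·) a (toggle f) S = a 0 * sgn (· > ·) K 0 S * (1 / 2 * f S) +
        crs (· > ·) a f (S.erase 0) := by
      rw [crs, ← add_sum_erase _ _ h]
      congr 1
      · simp [toggle, h, insert_erase h]
      · refine sum_congr rfl fun s hs => ?_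
        have hs0 := ne_of_mem_erase hs
        rw [toggle, if_pos (mem_erase.2 ⟨hs0.symm, h⟩), sgn_erase_zero, erase_right_comm]
    simp only [toggle, if_pos h]
    rw [h1, ann, if_pos h, ann, if_neg (notMem_erase 0 S), insert_erase h, sgn_erase_self, smul_eq_mul]
    ring
  · have h1 : crs (· > ·) a f (insert 0 S) = a 0 * sgn (· > ·) K 0 S * f S +
        2 * crs (· > ·) a (toggle f) S := by
      rw [crs, sum_insert h, erase_insert h, sgn_insert_self, crs, mul_sum]
      congr 1
      refine sum_congr rfl fun s hs => ?_
      have hs0 : s ≠ 0 := fun e => h (e ▸ hs)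
      rw [toggle, if_neg (fun e => h (mem_of_mem_erase e)), sgn_insert_zero s h,
        erase_insert_of_ne hs0.symm]
      simp only [smul_eq_mul]
      ring
    have h2 : ann (· > ·) K 0 (toggle f) S = sgn (· > ·) K 0 S * f S := by
      rw [ann, if_neg h, toggle, if_pos (mem_insert_self 0 S), erase_insert h, smul_eq_mul]
    have h3 : ann (· > ·) K 0 f (insert 0 S) = 0 := by rw [ann, if_pos (mem_insert_self 0 S)]
    rw [h2]
    conv_rhs => rw [toggle, if_neg h]
    rw [h3, h1]
    ring

/-- The relations are left multiplications by fermions, so they survive right multiplication by φ_0.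
This interchanges the two free parameters f(∅) and f({0}) up to a factor. -/
theorem Annihilated.toggle {q w w' : ℕ → K} {f : Finset ℕ → K} (hf : Annihilated q w w' f)
    (hw0 : w 0 = 1) : Annihilated q w w' (toggle f) := by
  intro m hm S
  have h1 := phi_zero_toggle (fun s => q (m + s) * w s) f S
  simp only [add_zero, hw0, mul_one] at h1
  rw [add_assoc, h1]
  have h2 : ∀ k ∈ range m, q k * (w' (m - k) * (-1) ^ (m - k)) * ann (· > ·) K (m - k) (BKP.toggle f) S =
      q k * (w' (m - k) * (-1) ^ (m - k)) * BKP.toggle (ann (· > ·) K (m - k) f) S := by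
    intro k hk
    have := mem_range.1 hk
    rw [ann_toggle (by omega)]
  rw [sum_congr rfl h2]
  unfold BKP.toggle
  split_ifs with h
  · rw [← add_assoc]; exact hf m hm _
  · have h3 := hf m hm (insert 0 S)
    have h4 : ∀ k, q k * (w' (m - k) * (-1) ^ (m - k)) * (1 / 2 * ann (· > ·) K (m - k) f (insert 0 S)) =
        1 / 2 * (q k * (w' (m - k) * (-1) ^ (m - k)) * ann (· > ·) K (m - k) f (insert 0 S)) :=
      fun k => by ring
    simp only [h4, ← mul_sum]
    linear_combination (1 / 2) * h3

end Vectors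

/-! ### Normalization: the Schur Pfaffian -/

section Schur

variable {ι K : Type*} [LinearOrder ι] [Field K] [CharZero K]

theorem induction_on_min_insert {P : Finset ι → Prop} (h0 : P ∅)
    (h : ∀ p I, (∀ k ∈ I, p < k) → (∀ J, J.card ≤ I.card → P J) → P (insert p I)) (I : Finset ι) :
    P I := by
  induction hn : I.card using Nat.strong_induction_on generalizing I with
  | _ n ih =>
  rcases I.eq_empty_or_nonempty with rfl | hne
  · exact h0
  rw [← insert_erase (I.min'_mem hne)]
  refine h _ _ (fun k hk => lt_of_le_of_ne (I.min'_le k (mem_of_mem_erase hk))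
    (ne_of_mem_erase hk).symm) fun J hJ => ih J.card ?_ J rfl
  have := card_erase_lt_of_mem (I.min'_mem hne)
  omega

/-- The product of `(y_i - y_j)/(y_i + y_j)` over the pairs `i < j` of elements of `I`. -/
def deltaOn (y : ι → K) (I : Finset ι) : K :=
  ∏ i ∈ I, ∏ j ∈ I.filter (i < ·), (y i - y j) / (y i + y j)

theorem deltaOn_insert (y : ι → K) {p : ι} {I : Finset ι} (hp : ∀ k ∈ I, p < k) :
    deltaOn y (insert p I) = (∏ j ∈ I, (y p - y j) / (y p + y j)) * deltaOn y I := by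
  have hpI : p ∉ I := fun h => lt_irrefl _ (hp p h)
  rw [deltaOn, prod_insert hpI, filter_insert, if_neg (lt_irrefl p), filter_true_of_mem hp]
  congr 1
  refine prod_congr rfl fun i hi => ?_
  rw [filter_insert, if_neg (not_lt.2 (hp i hi).le)]

/-- Bringing j to the front turns around the factor of every pair k < j, each turn giving a sign. -/
theorem deltaOn_eq_mul_erase (y : ι → K) {j : ι} {I : Finset ι} (hj : j ∈ I) :
    deltaOn y I = sgn (· < ·) K j I * deltaOn y (I.erase j) *
      ∏ k ∈ I.erase j, (y j - y k) / (y j + y k) := by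
  induction I using induction_on_min_insert with
  | h0 => simp at hj
  | h p I hp ih =>
    have hpI : p ∉ I := fun h => lt_irrefl _ (hp p h)
    by_cases hjp : j = p
    · subst hjp
      have h1 : sgn (· < ·) K j (insert j I) = 1 := by
        rw [sgn_insert_self, sgn, filter_eq_empty_iff.2 fun k hk => not_lt.2 (hp k hk).le, card_empty,
          pow_zero]
      rw [erase_insert hpI, deltaOn_insert y hp, h1]
      ring
    · have hjI : j ∈ I := (mem_insert.1 hj).resolve_left hjp
      have hp' : ∀ k ∈ I.erase j, p < k := fun k hk => hp k (mem_of_mem_erase hk)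
      have hpI' : p ∉ I.erase j := fun h => hpI (mem_of_mem_erase h)
      rw [erase_insert_of_ne (Ne.symm hjp), deltaOn_insert y hp, deltaOn_insert y hp', ih I le_rfl hjI,
        sgn_insert _ _ hpI, if_pos (hp j hjI), prod_insert hpI', ← mul_prod_erase _ _ hjI,
        ← neg_sub (y j) (y p), add_comm (y p) (y j), neg_div]
      ring

/-- Half the residue at j is the inverse of the product of the factors of Δ that contain j. This
turns row expansions into sums of residues. -/
theorem sgn_mul_deltaOn_erase {y : ι → K} (hinj : Function.Injective y)
    (hy : ∀ i j, y i + y j ≠ 0) {j : ι} {I : Finset ι} (hj : j ∈ I) :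
    sgn (· < ·) K j I * deltaOn y (I.erase j) = 1 / 2 * residue y I j * deltaOn y I := by
  have h : (∏ k ∈ I.erase j, (y j + y k) / (y j - y k)) *
      (∏ k ∈ I.erase j, (y j - y k) / (y j + y k)) = 1 := by
    rw [← prod_mul_distrib]
    refine prod_eq_one fun k hk => ?_
    have h1 : y j - y k ≠ 0 := sub_ne_zero.2 fun h => ne_of_mem_erase hk (hinj h).symm
    have h2 := hy j k
    field_simp
  rw [deltaOn_eq_mul_erase y hj, residue]
  linear_combination -(sgn (· < ·) K j I * deltaOn y (I.erase j)) * h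

/-- Since (a - b)/(2(a + b)) = a/(a + b) - 1/2, this is `sum_residue_div` minus half of
`sum_residue`; for odd |I| the constants cancel. -/
theorem sum_residue_mul_corr {y : ι → K} (hinj : Function.Injective y) (hy : ∀ i j, y i + y j ≠ 0)
    (p : ι) {I : Finset ι} (hI : Odd I.card) :
    ∑ j ∈ I, residue y I j * corr y p j = ∏ j ∈ I, (y p - y j) / (y p + y j) := by
  have h0 : ∀ i, y i ≠ 0 := fun i h => hy i i (by rw [h, add_zero])
  have h1 := sum_residue_div (I := I) hinj.injOn (fun i _ => h0 i) (h0 p) (fun i _ => hy p i)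
  have h2 := sum_residue (I := I) hinj.injOn (fun i _ => h0 i)
  have h3 : ∀ j ∈ I, residue y I j * corr y p j =
      residue y I j * (y p / (y p + y j)) - 1 / 2 * residue y I j := by
    intro j _
    have := hy p j
    rw [corr]
    field_simp
    ring
  rw [sum_congr rfl h3, sum_sub_distrib, ← mul_sum, h1, h2, hI.neg_one_pow]
  ring

/-- The Schur Pfaffian. -/
theorem pf_corr {y : ι → K} (hinj : Function.Injective y) (hy : ∀ i j, y i + y j ≠ 0)
    (I : Finset ι) :
    pf (corr y) I = if Even I.card then (1 / 2) ^ (I.card / 2) * deltaOn y I else 0 := by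
  induction I using induction_on_min_insert with
  | h0 => simp [pf_empty, deltaOn]
  | h p I hp ih =>
    have hpI : p ∉ I := fun h => lt_irrefl _ (hp p h)
    have hcard : ∀ j ∈ I, (I.erase j).card + 1 = I.card := fun j hj => card_erase_add_one hj
    rw [pf_insert _ hp, crs, card_insert_of_notMem hpI]
    rcases Nat.even_or_odd I.card with hI | hI
    · rw [if_neg (Nat.not_even_iff_odd.2 hI.add_one)]
      refine sum_eq_zero fun j hj => ?_
      have h1 := hcard j hj
      rw [ih _ (by omega), if_neg, smul_zero]
      intro h2
      rw [← h1] at hI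
      exact (Nat.not_even_iff_odd.2 h2.add_one) hI
    · rw [if_pos hI.add_one]
      -- The sign and the smaller Δ combine to half a residue; this 1/2 accounts for the extra power
      -- of 1/2 in (1/2)^((|I|+1)/2).
      have h1 : ∀ j ∈ I, (corr y p j * sgn (· < ·) K j I) • pf (corr y) (I.erase j) =
          (1 / 2) ^ ((I.card + 1) / 2) * deltaOn y I * (residue y I j * corr y p j) := by
        intro j hj
        have h2 := hcard j hj
        have h3 : Even (I.erase j).card := by
          by_contra h
          rw [← h2] at hI
          exact (Nat.not_odd_iff_even.2 (Nat.not_even_iff_odd.1 h).add_one) hI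
        rw [ih _ (by omega), if_pos h3, show (I.card + 1) / 2 = (I.erase j).card / 2 + 1 by omega,
          pow_succ, smul_eq_mul]
        linear_combination corr y p j * (1 / 2) ^ ((I.erase j).card / 2) *
          sgn_mul_deltaOn_erase hinj hy hj
      rw [sum_congr rfl h1, ← mul_sum, sum_residue_mul_corr hinj hy p hI, deltaOn_insert y hp]
      ring

/-- Creation parts do not contribute to the vacuum coefficient, so only the contractions remain, and
these are the recursion of `pf`. -/
theorem fermiVec_apply_empty (w : ℕ → K) (y : ι → K) (I : Finset ι) :
    fermiVec w y I ∅ = pf (corr y) I := by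
  induction I using induction_on_min_insert with
  | h0 => rw [fermiVec_empty, pf_empty, Pi.single_eq_same]
  | h p I hp ih =>
    rw [isGaussian_fermiVec w y p I hp, pf_insert _ hp, crs, crs, Pi.add_apply, Finset.sum_apply]
    have h1 : crsHom (· > ·) (fun s => w s * y p ^ s) (fermiVec w y I) ∅ = 0 := by
      simp [crsHom, crs]
    rw [h1, zero_add]
    refine sum_congr rfl fun j hj => ?_
    rw [Pi.smul_apply, ih _ (card_le_card (erase_subset j I))]

/-- Annihilating the mode 0 omits one factor at a time with weight w_0 = 1. For odd |I| the
resulting Schur Pfaffians add up to Δ times half the sum of the residues, and that sum is 2. -/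
theorem fermiVec_apply_zero {w : ℕ → K} (hw0 : w 0 = 1) {y : ι → K} (hinj : Function.Injective y)
    (hy : ∀ i j, y i + y j ≠ 0) (I : Finset ι) :
    fermiVec w y I {0} = if Odd I.card then (1 / 2) ^ (I.card / 2) * deltaOn y I else 0 := by
  have h0 : ∀ i, y i ≠ 0 := fun i h => hy i i (by rw [h, add_zero])
  have h := congrFun (ann_fermiVec w y 0 I) ∅
  rw [ann, if_neg (notMem_empty 0), insert_empty, crs, Finset.sum_apply] at h
  have hs : sgn (· > ·) K 0 (∅ : Finset ℕ) = 1 := by simp [sgn]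
  rw [hs, one_smul] at h
  rw [h]
  have hcard : ∀ j ∈ I, (I.erase j).card + 1 = I.card := fun j hj => card_erase_add_one hj
  have h1 : ∀ j ∈ I, ((w 0 * y j ^ 0 * sgn (· < ·) K j I) • fermiVec w y (I.erase j)) ∅ =
      if Odd I.card then (1 / 2) ^ (I.card / 2) * deltaOn y I * (1 / 2 * residue y I j) else 0 := by
    intro j hj
    have h2 := hcard j hj
    rw [Pi.smul_apply, fermiVec_apply_empty, pf_corr hinj hy, hw0, pow_zero, smul_eq_mul]
    by_cases hI : Odd I.card
    · have h3 : Even (I.erase j).card := by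
        by_contra h
        rw [← h2] at hI
        exact (Nat.not_odd_iff_even.2 (Nat.not_even_iff_odd.1 h).add_one) hI
      have h4 : I.card / 2 = (I.erase j).card / 2 := by
        obtain ⟨a, ha⟩ := h3
        omega
      rw [if_pos hI, if_pos h3, h4]
      linear_combination (1 / 2) ^ ((I.erase j).card / 2) * sgn_mul_deltaOn_erase hinj hy hj
    · rw [if_neg hI, if_neg, mul_zero]
      intro h3
      rw [← h2] at hI
      exact hI h3.add_one
  rw [sum_congr rfl h1]
  split_ifs with hI
  · rw [← mul_sum, ← mul_sum, sum_residue hinj.injOn fun i _ => h0 i, hI.neg_one_pow]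
    ring
  · simp

/-- A normalized solution of the bilinear relations is proportional to `φ(y_1) ⋯ φ(y_N) |0⟩`
or, for odd `N`, becomes proportional to it after multiplication by `φ_0`. -/
theorem fermiVec_eq_smul {w w' q : ℕ → K} (hw : ∀ s, w' s * w s = 1) (hw0 : w 0 = 1)
    {y : ι → K} (hinj : Function.Injective y) (hy : ∀ i j, y i + y j ≠ 0) {I : Finset ι}
    (hq0 : q 0 = 1) (hq : ∀ k ≠ 0, q k = ∑ i ∈ I, residue y I i * y i ^ k)
    {v : Finset ℕ → K} (hv : Annihilated q w w' v) (hv0 : v ∅ = 1) (hv1 : v {0} = 0) :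
    fermiVec w y I = ((1 / 2) ^ (I.card / 2) * deltaOn y I) •
      if Even I.card then v else toggle v := by
  have hV : Annihilated q w w' (fermiVec w y I) :=
    annihilated_fermiVec hinj.injOn (fun i _ j _ => hy i j) hq0 hq hw hw0
  have hz : Annihilated q w w' (0 : Finset ℕ → K) := by
    intro m hm S
    simp [ann, crs]
  have hs : ∀ {f : Finset ℕ → K} (c : K), Annihilated q w w' f → Annihilated q w w' (c • f) := by
    intro f c hf
    simpa using hz.sub_smul hf c
  -- Both sides solve the relations, so the coefficients at ∅ and {0} suffice. For even |I| the
  -- second vanishes on both sides; for odd |I| the first does.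
  split_ifs with hI
  · refine hV.ext (hs _ hv) hq0 hw ?_ ?_
    · rw [fermiVec_apply_empty, pf_corr hinj hy, if_pos hI, Pi.smul_apply, hv0, smul_eq_mul, mul_one]
    · rw [fermiVec_apply_zero hw0 hinj hy, if_neg (Nat.not_odd_iff_even.2 hI), Pi.smul_apply, hv1,
        smul_zero]
  · refine hV.ext (hs _ (hv.toggle hw0)) hq0 hw ?_ ?_
    · rw [fermiVec_apply_empty, pf_corr hinj hy, if_neg hI, Pi.smul_apply, toggle,
        if_neg (notMem_empty 0), insert_empty, hv1, mul_zero, smul_zero]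
    · rw [fermiVec_apply_zero hw0 hinj hy, if_pos (Nat.not_even_iff_odd.1 hI), Pi.smul_apply, toggle,
        if_pos (mem_singleton_self 0), erase_singleton, hv0, smul_eq_mul, mul_one]

end Schur

/-! ### Pairings of vectors -/

section Pairing

variable {ι K : Type*} [LinearOrder ι] [Field K] [CharZero K]

/-- The norm of the basis vector labelled by `S`. -/
def zeroWeight (K : Type*) [Field K] (S : Finset ℕ) : K := if 0 ∈ S then 1 / 2 else 1

/-- The pairing of two vectors, restricted to the modes below `M`. -/
def pairing (M : ℕ) (f g : Finset ℕ → K) : K :=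
  ∑ S ∈ (range M).powerset, zeroWeight K S * f S * g S

/-- Multiplication of both vectors by φ_0 multiplies the pairing by φ_0² = 1/2. The bound M ≠ 0
guarantees that the mode 0 is among those kept. -/
theorem pairing_toggle {M : ℕ} (hM : M ≠ 0) (f g : Finset ℕ → K) :
    pairing M (toggle f) (toggle g) = 1 / 2 * pairing M f g := by
  unfold pairing
  rw [mul_sum]
  let τ : Finset ℕ → Finset ℕ := fun S => if 0 ∈ S then S.erase 0 else insert 0 S
  have hmem : ∀ S ∈ (range M).powerset, τ S ∈ (range M).powerset := by
    intro S hS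
    rw [mem_powerset] at hS ⊢
    simp only [τ]
    split_ifs
    · exact (erase_subset _ _).trans hS
    · exact insert_subset (mem_range.2 (Nat.pos_of_ne_zero hM)) hS
  have hinv : ∀ S ∈ (range M).powerset, τ (τ S) = S := by
    intro S _
    by_cases h : 0 ∈ S
    · simp [τ, h, insert_erase h]
    · simp [τ, h, erase_insert h]
  refine sum_bij' (fun S _ => τ S) (fun S _ => τ S) hmem hmem hinv hinv fun S _ => ?_
  by_cases h : 0 ∈ S
  · simp [τ, toggle, zeroWeight, h]; ring
  · simp [τ, toggle, zeroWeight, h]; ring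

theorem zeroWeight_insert {s : ℕ} {S : Finset ℕ} (hs : s ∉ S) :
    zeroWeight K (insert s S) = (if s = 0 then 1 / 2 else 1) * zeroWeight K S := by
  unfold zeroWeight
  by_cases h : s = 0
  · subst h; simp [hs]
  · simp [h, Ne.symm h]

/-- Creation is adjoint to annihilation; the factor 1/2 at s = 0 is the norm ⟨0|φ_0 φ_0|0⟩. The
identity is exact for the truncated pairing, since modes s ≥ M never enter it. -/
theorem pairing_crs (M : ℕ) (α : ℕ → K) (f g : Finset ℕ → K) :
    pairing M (crs (· > ·) α f) g = ∑ s ∈ range M,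
      α s * (if s = 0 then 1 / 2 else 1) * pairing M f (ann (· > ·) K s g) := by
  unfold pairing crs ann
  simp only [mul_sum, sum_mul]
  rw [sum_comm' (t' := range M) (s' := fun s => (range M).powerset.filter (s ∈ ·))]
  · refine sum_congr rfl fun s hs => ?_
    have h1 : ∀ S ∈ (range M).powerset, α s * (if s = 0 then 1 / 2 else 1) *
        (zeroWeight K S * f S * if s ∈ S then 0 else sgn (· > ·) K s S • g (insert s S)) =
        if s ∉ S then α s * (zeroWeight K (insert s S) * f S * (sgn (· > ·) K s S • g (insert s S)))
          else 0 := by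
      intro S _
      by_cases h : s ∈ S
      · simp [h]
      · rw [if_neg h, if_pos h, zeroWeight_insert h]; ring
    rw [sum_congr rfl h1, ← sum_filter]
    refine sum_bij' (fun S _ => S.erase s) (fun S _ => insert s S) ?_ ?_ ?_ ?_ ?_
    · intro S hS
      rw [mem_filter, mem_powerset] at hS ⊢
      exact ⟨(erase_subset _ _).trans hS.1, notMem_erase _ _⟩
    · intro S hS
      rw [mem_filter, mem_powerset] at hS ⊢
      exact ⟨insert_subset hs hS.1, mem_insert_self _ _⟩
    · intro S hS
      exact insert_erase (mem_filter.1 hS).2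
    · intro S hS
      exact erase_insert (mem_filter.1 hS).2
    · intro S hS
      rw [insert_erase (mem_filter.1 hS).2, sgn_erase_self, smul_eq_mul, smul_eq_mul]
      ring
  · intro S s
    simp only [mem_powerset, mem_filter, mem_range]
    constructor
    · rintro ⟨h1, h2⟩
      exact ⟨⟨h1, h2⟩, mem_range.1 (h1 h2)⟩
    · rintro ⟨⟨h1, h2⟩, -⟩
      exact ⟨h1, h2⟩

theorem pairing_sum_left {κ : Type*} (M : ℕ) (s : Finset κ) (a : κ → K) (f : κ → Finset ℕ → K)
    (g : Finset ℕ → K) :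
    pairing M (∑ i ∈ s, a i • f i) g = ∑ i ∈ s, a i * pairing M (f i) g := by
  simp only [pairing, Finset.sum_apply, Pi.smul_apply, smul_eq_mul, mul_sum, sum_mul]
  rw [sum_comm]
  exact sum_congr rfl fun i _ => sum_congr rfl fun S _ => by ring

theorem pairing_sum_right {κ : Type*} (M : ℕ) (s : Finset κ) (a : κ → K) (f : Finset ℕ → K)
    (g : κ → Finset ℕ → K) :
    pairing M f (∑ i ∈ s, a i • g i) = ∑ i ∈ s, a i * pairing M f (g i) := by
  simp only [pairing, Finset.sum_apply, Pi.smul_apply, smul_eq_mul, mul_sum]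
  rw [sum_comm]
  exact sum_congr rfl fun i _ => sum_congr rfl fun S _ => by ring

theorem pairing_smul_smul (M : ℕ) (a b : K) (f g : Finset ℕ → K) :
    pairing M (a • f) (b • g) = a * b * pairing M f g := by
  simp only [pairing, Pi.smul_apply, smul_eq_mul, mul_sum]
  exact sum_congr rfl fun S _ => by ring

/-- The truncation to `n < M` of `1/2 + ∑_{n ≥ 1} w_n x_i^n y_j^n`. -/
def mixedCorr (M : ℕ) (w : ℕ → K) (x y : ι → K) (i j : ι) : K :=
  ∑ s ∈ range M, (if s = 0 then 1 / 2 else 1) * w s * x i ^ s * y j ^ s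

theorem sgn_of_gt {p : ι} {I : Finset ι} (hp : ∀ k ∈ I, k < p) :
    sgn (· < ·) K p I = (-1) ^ I.card := by
  rw [sgn, filter_true_of_mem hp]

/-- The last factor φ(x_p) is moved to the front at the cost of (-1)^|I| and split into its creation
part and contractions with the other x's. The creation part is transposed onto the second vector,
where annihilators contract with the y's and produce the mixed correlations. -/
theorem pairing_fermiVec_insert (M : ℕ) (w : ℕ → K) (x y : ι → K) {p : ι} {I : Finset ι}
    (hp : ∀ k ∈ I, k < p) (J : Finset ι) :
    (-1) ^ I.card * pairing M (fermiVec 1 x (insert p I)) (fermiVec w y J) =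
      ∑ k ∈ J, mixedCorr M w x y p k * sgn (· < ·) K k J *
        pairing M (fermiVec 1 x I) (fermiVec w y (J.erase k)) +
      ∑ j ∈ I, corr x p j * sgn (· < ·) K j I *
        pairing M (fermiVec 1 x (I.erase j)) (fermiVec w y J) := by
  have hpI : p ∉ I := fun h => lt_irrefl _ (hp p h)
  have h := (isGaussian_fermiVec 1 x).ann_eq (fun i j f => funext fun S => crs_crs_add (· > ·) _ _ f S)
    (corr_add_swap x) p I
  rw [ann, if_neg hpI, sgn_of_gt hp] at h
  have h1 := pairing_smul_smul M ((-1) ^ I.card) 1 (fermiVec 1 x (insert p I)) (fermiVec w y J)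
  rw [one_smul, mul_one] at h1
  rw [← h1, h]
  have h2 : pairing M (crsHom (· > ·) (fun s => (1 : ℕ → K) s * x p ^ s) (fermiVec 1 x I) +
      crs (· < ·) (corr x p) (fermiVec 1 x) I) (fermiVec w y J) =
      pairing M (crs (· > ·) (fun s => (1 : ℕ → K) s * x p ^ s) (fermiVec 1 x I)) (fermiVec w y J) +
      pairing M (crs (· < ·) (corr x p) (fermiVec 1 x) I) (fermiVec w y J) := by
    simp only [pairing, Pi.add_apply, mul_add, add_mul, sum_add_distrib]
    rfl
  rw [h2]
  congr 1
  · rw [pairing_crs]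
    simp only [ann_fermiVec, crs, pairing_sum_right, mixedCorr]
    simp only [mul_sum, sum_mul]
    rw [sum_comm]
    refine sum_congr rfl fun k _ => sum_congr rfl fun s _ => ?_
    simp only [Pi.one_apply]
    ring
  · exact pairing_sum_left M I _ _ _

theorem pf_image {κ : Type*} [LinearOrder κ] {e : ι → κ} (he : StrictMono e) (g : κ → κ → K)
    (I : Finset ι) : pf g (I.image e) = pf (fun i j => g (e i) (e j)) I := by
  induction I using induction_on_min_insert with
  | h0 => rw [image_empty, pf_empty, pf_empty]
  | h p I hp ih =>
    rw [image_insert, pf_insert, pf_insert _ hp, crs, crs, sum_image he.injective.injOn]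
    · refine sum_congr rfl fun j hj => ?_
      rw [← image_erase he.injective, ih _ (card_le_card (erase_subset j I)), sgn, sgn, filter_image,
        card_image_of_injective _ he.injective, filter_congr (fun k _ => he.lt_iff_lt (b := j))]
    · intro k hk
      obtain ⟨i, hi, rfl⟩ := mem_image.1 hk
      exact he (hp i hi)

/-- Each of the |I| - 1 elements other than j is counted in exactly one of the two signs. -/
theorem sgn_lt_mul_sgn_gt {j : ι} {I : Finset ι} (hj : j ∈ I) :
    sgn (· < ·) K j I * sgn (· > ·) K j I = -(-1) ^ I.card := by
  have h1 : sgn (· < ·) K j I * sgn (· > ·) K j I = (-1) ^ (I.erase j).card := by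
    rw [sgn, sgn, ← pow_add]
    congr 1
    rw [← card_union_of_disjoint]
    · congr 1
      ext k
      simp only [mem_union, mem_filter, mem_erase]
      constructor
      · rintro (h | h)
        · exact ⟨h.2.ne, h.1⟩
        · exact ⟨(gt_iff_lt.1 h.2).ne', h.1⟩
      · rintro ⟨h1, h2⟩
        rcases lt_or_gt_of_ne h1 with h | h
        · exact Or.inl ⟨h2, h⟩
        · exact Or.inr ⟨h2, h⟩
    · rw [disjoint_filter]
      exact fun k _ h1 h2 => lt_asymm h1 h2
  rw [h1, ← card_erase_add_one hj, pow_succ]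
  ring

/-- The pairing of two fermionic vectors is a Pfaffian of pair correlations. -/
theorem pf_eq_pairing {κ : Type*} [LinearOrder κ] (M : ℕ) (w : ℕ → K) (x y : ι → K)
    {ex ey : ι → κ} (hex : StrictAnti ex) (hey : StrictMono ey) (hxy : ∀ i j, ex i < ey j)
    {g : κ → κ → K} (hgx : ∀ i j, g (ex i) (ex j) = corr x j i)
    (hgxy : ∀ i j, g (ex i) (ey j) = mixedCorr M w x y i j)
    (hgy : ∀ i j, g (ey i) (ey j) = corr y i j) (I J : Finset ι) :
    pf g (I.image ex ∪ J.image ey) = pairing M (fermiVec 1 x I) (fermiVec w y J) := by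
  induction hn : I.card using Nat.strong_induction_on generalizing I J with
  | _ n ih =>
  rcases I.eq_empty_or_nonempty with rfl | hne
  · rw [image_empty, empty_union, pf_image hey, fermiVec_empty, pairing, sum_eq_single ∅]
    · simp only [hgy]
      rw [Pi.single_eq_same, fermiVec_apply_empty, zeroWeight, if_neg (notMem_empty 0), mul_one, one_mul]
    · intro S _ hS
      rw [Pi.single_eq_of_ne hS, mul_zero, zero_mul]
    · exact fun h => absurd (mem_powerset.2 (empty_subset _)) h
  -- The transposition hidden in the pairing reverses the order of the x's: the largest p has the
  -- smallest label `ex p`, which is the row along which `pf` expands.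
  obtain ⟨p, I, hp, rfl⟩ : ∃ p I', (∀ k ∈ I', k < p) ∧ I = insert p I' := by
    refine ⟨I.max' hne, I.erase (I.max' hne), fun k hk => ?_, (insert_erase (I.max'_mem hne)).symm⟩
    exact lt_of_le_of_ne (I.le_max' k (mem_of_mem_erase hk)) (ne_of_mem_erase hk)
  have hpI : p ∉ I := fun h => lt_irrefl _ (hp p h)
  rw [card_insert_of_notMem hpI] at hn
  have hdisj : ∀ I : Finset ι, Disjoint (I.image ex) (J.image ey) := by
    intro I
    rw [disjoint_left]
    intro k h1 h2
    obtain ⟨i, -, rfl⟩ := mem_image.1 h1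
    obtain ⟨j, -, h⟩ := mem_image.1 h2
    exact (hxy i j).ne h.symm
  have hsx : ∀ j, sgn (· < ·) K (ex j) (I.image ex ∪ J.image ey) = sgn (· > ·) K j I := by
    intro j
    rw [sgn, sgn, filter_union, filter_image, filter_image,
      filter_eq_empty_iff.2 (fun k _ => not_lt.2 (hxy j k).le : ∀ k ∈ J, ¬ ey k < ex j), image_empty,
      union_empty, card_image_of_injective _ hex.injective]
    congr 2
    exact filter_congr fun k _ => hex.lt_iff_gt
  have hsy : ∀ j, sgn (· < ·) K (ey j) (I.image ex ∪ J.image ey) =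
      (-1) ^ I.card * sgn (· < ·) K j J := by
    intro j
    rw [sgn, sgn, filter_union, card_union_of_disjoint ((hdisj I).mono (filter_subset _ _) (filter_subset _ _)),
      filter_image, filter_image, filter_true_of_mem (fun k _ => hxy k j : ∀ k ∈ I, ex k < ey j),
      card_image_of_injective _ hex.injective, card_image_of_injective _ hey.injective, pow_add]
    congr 3
    exact filter_congr fun k _ => hey.lt_iff_lt
  have hsq : ((-1 : K) ^ I.card) * (-1) ^ I.card = 1 := by rw [← mul_pow]; simp
  have hmain := pairing_fermiVec_insert M w x y hp J
  have hmain' : pairing M (fermiVec 1 x (insert p I)) (fermiVec w y J) = (-1) ^ I.card *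
      ((-1) ^ I.card * pairing M (fermiVec 1 x (insert p I)) (fermiVec w y J)) := by
    rw [← mul_assoc, hsq, one_mul]
  rw [hmain', hmain, image_insert, insert_union, pf_insert, crs, sum_union (hdisj I),
    sum_image hex.injective.injOn, sum_image hey.injective.injOn, mul_add, add_comm, mul_sum, mul_sum]
  · congr 1
    · refine sum_congr rfl fun k hk => ?_
      have h1 : (I.image ex ∪ J.image ey).erase (ey k) = I.image ex ∪ (J.erase k).image ey := by
        rw [erase_union_distrib, image_erase hey.injective, erase_eq_of_notMem]
        exact fun h => disjoint_left.1 (hdisj I) h (mem_image_of_mem _ hk)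
      rw [h1, ih I.card (by omega) I (J.erase k) rfl, hsy, hgxy, smul_eq_mul]
      ring
    · refine sum_congr rfl fun j hj => ?_
      have h1 : (I.image ex ∪ J.image ey).erase (ex j) = (I.erase j).image ex ∪ J.image ey := by
        rw [erase_union_distrib, image_erase hex.injective, erase_eq_of_notMem (a := ex j) (s := J.image ey)]
        exact fun h => disjoint_left.1 (hdisj I) (mem_image_of_mem _ hj) h
      have h2 := sgn_lt_mul_sgn_gt (K := K) hj
      have h3 := sgn_mul_self (K := K) (· < ·) j I
      have h4 := corr_add_swap x p j
      have h5 : (I.erase j).card < n := by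
        have := card_erase_lt_of_mem hj
        omega
      rw [h1, ih _ h5 (I.erase j) J rfl, hsx, hgx, smul_eq_mul, eq_neg_of_add_eq_zero_right h4]
      -- The sign in the reversed order compensates the factor (-1)^|I| and the minus sign from
      -- turning around the correlation of x_p and x_j.
      have h6 : sgn (· > ·) K j I = -(-1) ^ I.card * sgn (· < ·) K j I := by
        linear_combination sgn (· < ·) K j I * h2 - sgn (· > ·) K j I * h3
      rw [h6]
      ring
  · intro k hk
    rcases mem_union.1 hk with h | h
    · obtain ⟨i, hi, rfl⟩ := mem_image.1 h
      exact hex (hp i hi)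
    · obtain ⟨j, -, rfl⟩ := mem_image.1 h
      exact hxy p j

end Pairing

/-! ### Exponentials of linear forms -/

section FormalExp

variable {σ E : Type*} [DecidableEq σ] [Ring E] [Algebra ℂ E]

open MvPowerSeries

theorem coeff_linearForm_eq_sum {d p : σ →₀ ℕ} (a : σ → E) (hp : p ≤ d) :
    coeff p (linearForm a) = ∑ i ∈ d.support, if p = Finsupp.single i 1 then a i else 0 := by
  change ∑ i ∈ p.support, (if p = Finsupp.single i 1 then a i else 0) = _
  refine sum_subset (Finsupp.support_mono hp) fun i _ hi => if_neg ?_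
  rintro rfl
  simp at hi

theorem single_le_of_mem_support {d : σ →₀ ℕ} {i : σ} (hi : i ∈ d.support) :
    Finsupp.single i 1 ≤ d := by
  rw [Finsupp.single_le_iff]
  exact Nat.one_le_iff_ne_zero.2 (Finsupp.mem_support_iff.1 hi)

theorem coeff_linearForm_mul (a : σ → E) (F : MvPowerSeries σ E) (d : σ →₀ ℕ) :
    coeff d (linearForm a * F) =
      ∑ i ∈ d.support, a i * coeff (d - Finsupp.single i 1) F := by
  rw [coeff_mul]
  have h1 : ∀ p ∈ antidiagonal d, coeff p.1 (linearForm a) * coeff p.2 F =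
      ∑ i ∈ d.support, if p.1 = Finsupp.single i 1 then a i * coeff p.2 F else 0 := by
    intro p hp
    have hle : p.1 ≤ d := by
      rw [← HasAntidiagonal.mem_antidiagonal.1 hp]; exact le_self_add
    rw [coeff_linearForm_eq_sum a hle, sum_mul]
    simp only [ite_mul, zero_mul]
  rw [sum_congr rfl h1, sum_comm]
  refine sum_congr rfl fun i hi => ?_
  have hle := single_le_of_mem_support hi
  rw [sum_eq_single (Finsupp.single i 1, d - Finsupp.single i 1)]
  · simp
  · rintro ⟨p, q⟩ hp hne
    refine if_neg fun h => hne ?_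
    rw [HasAntidiagonal.mem_antidiagonal] at hp
    simp only at h hp
    rw [← hp, h, add_tsub_cancel_left]
  · intro h
    exact absurd (HasAntidiagonal.mem_antidiagonal.2 (add_tsub_cancel_of_le hle)) h

theorem coeff_mul_linearForm (a : σ → E) (F : MvPowerSeries σ E) (d : σ →₀ ℕ) :
    coeff d (F * linearForm a) =
      ∑ i ∈ d.support, coeff (d - Finsupp.single i 1) F * a i := by
  rw [coeff_mul]
  have h1 : ∀ p ∈ antidiagonal d, coeff p.1 F * coeff p.2 (linearForm a) =
      ∑ i ∈ d.support, if p.2 = Finsupp.single i 1 then coeff p.1 F * a i else 0 := by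
    intro p hp
    have hle : p.2 ≤ d := by
      rw [← HasAntidiagonal.mem_antidiagonal.1 hp]; exact le_add_self
    rw [coeff_linearForm_eq_sum a hle, mul_sum]
    simp only [mul_ite, mul_zero]
  rw [sum_congr rfl h1, sum_comm]
  refine sum_congr rfl fun i hi => ?_
  have hle := single_le_of_mem_support hi
  rw [sum_eq_single (d - Finsupp.single i 1, Finsupp.single i 1)]
  · simp
  · rintro ⟨p, q⟩ hp hne
    refine if_neg fun h => hne ?_
    rw [HasAntidiagonal.mem_antidiagonal] at hp
    simp only at h hp
    rw [← hp, h, add_tsub_cancel_right]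
  · intro h
    exact absurd (HasAntidiagonal.mem_antidiagonal.2 (tsub_add_cancel_of_le hle)) h

theorem degree_sub_single {d : σ →₀ ℕ} {i : σ} (hi : i ∈ d.support) :
    (d - Finsupp.single i 1).degree + 1 = d.degree := by
  conv_rhs => rw [← tsub_add_cancel_of_le (single_le_of_mem_support hi)]
  simp

/-- A^k is homogeneous of degree k. Hence only one power contributes to each coefficient of e^A. -/
theorem coeff_linearForm_pow (a : σ → E) (k : ℕ) {d : σ →₀ ℕ} (hd : d.degree ≠ k) :
    coeff d (linearForm a ^ k) = 0 := by
  induction k generalizing d with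
  | zero =>
    rw [pow_zero, coeff_one, if_neg]
    rintro rfl
    exact hd (by simp)
  | succ k ih =>
    rw [pow_succ', coeff_linearForm_mul]
    refine sum_eq_zero fun i hi => ?_
    have := degree_sub_single hi
    rw [ih (by omega), mul_zero]

theorem coeff_formalExp (a : σ → E) (d : σ →₀ ℕ) :
    coeff d (formalExp (linearForm a)) =
      ((d.degree.factorial : ℂ)⁻¹) • coeff d (linearForm a ^ d.degree) := by
  change ∑ k ∈ range (d.degree + 1), ((k.factorial : ℂ)⁻¹) • coeff d (linearForm a ^ k) = _
  rw [sum_eq_single d.degree]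
  · intro k _ hk
    rw [coeff_linearForm_pow a k hk.symm, smul_zero]
  · simp

/-- The Euler operator, which multiplies the monomials by their degrees. -/
def euler (F : MvPowerSeries σ E) : MvPowerSeries σ E := fun d => d.degree • coeff d F

theorem coeff_euler (F : MvPowerSeries σ E) (d : σ →₀ ℕ) :
    coeff d (euler F) = d.degree • coeff d F := rfl

theorem euler_mul (F G : MvPowerSeries σ E) : euler (F * G) = euler F * G + F * euler G := by
  ext d
  rw [coeff_euler, map_add, coeff_mul, coeff_mul, coeff_mul, smul_sum, ← sum_add_distrib]
  refine sum_congr rfl fun p hp => ?_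
  rw [coeff_euler, coeff_euler, ← HasAntidiagonal.mem_antidiagonal.1 hp, map_add, add_smul, smul_mul_assoc,
    mul_smul_comm]

theorem coeff_formalExp_zero (a : σ → E) : coeff 0 (formalExp (linearForm a)) = 1 := by
  rw [coeff_formalExp]
  simp

theorem smul_coeff_formalExp (a : σ → E) {d : σ →₀ ℕ} {k : ℕ} (hd : d.degree = k + 1) :
    d.degree • coeff d (formalExp (linearForm a)) =
      ((k.factorial : ℂ)⁻¹) • coeff d (linearForm a ^ (k + 1)) := by
  rw [coeff_formalExp, hd, ← Nat.cast_smul_eq_nsmul ℂ, smul_smul, Nat.factorial_succ]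
  congr 1
  have h1 : ((k + 1 : ℕ) : ℂ) ≠ 0 := by exact_mod_cast Nat.succ_ne_zero k
  have h2 : (k.factorial : ℂ) ≠ 0 := by exact_mod_cast k.factorial_ne_zero
  push_cast at h1 ⊢
  field_simp

/-- The Euler operator multiplies the homogeneous A^k by k. Unlike partial derivatives, it gives a
clean equation without any commutativity of the a_i, so commutation of the flows is never needed. -/
theorem euler_formalExp (a : σ → E) :
    euler (formalExp (linearForm a)) = linearForm a * formalExp (linearForm a) := by
  ext d
  rw [coeff_euler, coeff_linearForm_mul]
  rcases hk : d.degree with _ | k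
  · rw [(Finsupp.degree_eq_zero_iff d).1 hk]
    simp
  · rw [← hk, smul_coeff_formalExp a hk, pow_succ', coeff_linearForm_mul, smul_sum]
    refine sum_congr rfl fun i hi => ?_
    have := degree_sub_single hi
    have h : (d - Finsupp.single i 1).degree = k := by omega
    rw [coeff_formalExp, h, mul_smul_comm]

theorem euler_formalExp' (a : σ → E) :
    euler (formalExp (linearForm a)) = formalExp (linearForm a) * linearForm a := by
  ext d
  rw [coeff_euler, coeff_mul_linearForm]
  rcases hk : d.degree with _ | k
  · rw [(Finsupp.degree_eq_zero_iff d).1 hk]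
    simp
  · rw [← hk, smul_coeff_formalExp a hk, pow_succ, coeff_mul_linearForm, smul_sum]
    refine sum_congr rfl fun i hi => ?_
    have := degree_sub_single hi
    have h : (d - Finsupp.single i 1).degree = k := by omega
    rw [coeff_formalExp, h, smul_mul_assoc]

theorem euler_sub (F G : MvPowerSeries σ E) : euler (F - G) = euler F - euler G := by
  ext d
  simp only [coeff_euler, map_sub, smul_sub]

theorem euler_C (b : E) : euler (C b : MvPowerSeries σ E) = 0 := by
  ext d
  rw [coeff_euler, coeff_C]
  split_ifs with h
  · simp [h]
  · simp

theorem nsmul_eq_zero_of_algebra {n : ℕ} (hn : n ≠ 0) {b : E} (h : n • b = 0) : b = 0 := by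
  rw [← Nat.cast_smul_eq_nsmul ℂ] at h
  have h1 := congrArg ((n : ℂ)⁻¹ • ·) h
  simpa [smul_smul, hn] using h1

/-- Uniqueness for a linear differential equation: in positive degree every coefficient is
determined by coefficients of lower degree. -/
theorem eq_zero_of_euler_eq_mul {a : σ → E} {F : MvPowerSeries σ E} (h : euler F = linearForm a * F)
    (h0 : coeff 0 F = 0) : F = 0 := by
  ext d
  induction hn : d.degree generalizing d with
  | zero => rw [(Finsupp.degree_eq_zero_iff d).1 hn, h0, map_zero]
  | succ n ih =>
    have h1 := congrArg (coeff d) h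
    rw [coeff_euler, coeff_linearForm_mul, sum_eq_zero] at h1
    · exact nsmul_eq_zero_of_algebra (by omega) h1
    · intro i hi
      have := degree_sub_single hi
      rw [ih _ (by omega), map_zero, mul_zero]

theorem eq_zero_of_euler_eq_mul' {a : σ → E} {F : MvPowerSeries σ E} (h : euler F = F * linearForm a)
    (h0 : coeff 0 F = 0) : F = 0 := by
  ext d
  induction hn : d.degree generalizing d with
  | zero => rw [(Finsupp.degree_eq_zero_iff d).1 hn, h0, map_zero]
  | succ n ih =>
    have h1 := congrArg (coeff d) h
    rw [coeff_euler, coeff_mul_linearForm, sum_eq_zero] at h1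
    · exact nsmul_eq_zero_of_algebra (by omega) h1
    · intro i hi
      have := degree_sub_single hi
      rw [ih _ (by omega), map_zero, zero_mul]

/-- If `Ψ` evolves by the commutator with `A`, then `Ψ e^A = e^A Ψ(0)`. -/
theorem mul_formalExp {a : σ → E} {Ψ : MvPowerSeries σ E}
    (h : euler Ψ = linearForm a * Ψ - Ψ * linearForm a) :
    Ψ * formalExp (linearForm a) = formalExp (linearForm a) * C (coeff 0 Ψ) := by
  rw [← sub_eq_zero]
  refine eq_zero_of_euler_eq_mul (a := a) ?_ ?_
  -- Both Ψ e^A and e^A Ψ(0) solve the equation E(F) = A F, E being the Euler operator, with the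
  -- same constant term.
  · rw [euler_sub, euler_mul, euler_mul, h, euler_formalExp, euler_C]
    noncomm_ring
  · simp only [coeff_zero_eq_constantCoeff, map_sub, map_mul, constantCoeff_C]
    rw [← coeff_zero_eq_constantCoeff_apply (formalExp _), coeff_formalExp_zero, one_mul, mul_one, sub_self]

theorem formalExp_mul {a : σ → E} {Ψ : MvPowerSeries σ E}
    (h : euler Ψ = Ψ * linearForm a - linearForm a * Ψ) :
    formalExp (linearForm a) * Ψ = C (coeff 0 Ψ) * formalExp (linearForm a) := by
  rw [← sub_eq_zero]
  refine eq_zero_of_euler_eq_mul' (a := a) ?_ ?_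
  · rw [euler_sub, euler_mul, euler_mul, h, euler_formalExp', euler_C]
    noncomm_ring
  · simp only [coeff_zero_eq_constantCoeff, map_sub, map_mul, constantCoeff_C]
    rw [← coeff_zero_eq_constantCoeff_apply (formalExp _), coeff_formalExp_zero, one_mul, mul_one, sub_self]

/-- The coefficient of a monomial in `exp (∑ λ_i t_i)`. -/
def expCoeff (l : σ → ℂ) (d : σ →₀ ℕ) : ℂ := d.prod fun i k => l i ^ k / k.factorial

theorem expCoeff_zero (l : σ → ℂ) : expCoeff l 0 = 1 := Finsupp.prod_zero_index

theorem mul_expCoeff_sub_single (l : σ → ℂ) {d : σ →₀ ℕ} {i : σ} (hi : i ∈ d.support) :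
    l i * expCoeff l (d - Finsupp.single i 1) = d i * expCoeff l d := by
  have h1 : expCoeff l (d - Finsupp.single i 1) = ∏ j ∈ d.support,
      l j ^ ((d - Finsupp.single i 1 : σ →₀ ℕ) j) /
        (((d - Finsupp.single i 1 : σ →₀ ℕ) j).factorial : ℂ) :=
    Finsupp.prod_of_support_subset (d - Finsupp.single i 1) (Finsupp.support_mono tsub_le_self) _
      (by simp)
  rw [h1, expCoeff, Finsupp.prod, ← mul_prod_erase _ _ hi, ← mul_prod_erase d.support _ hi]
  have h2 : ∀ j ∈ d.support.erase i,
      l j ^ ((d - Finsupp.single i 1 : σ →₀ ℕ) j) /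
        (((d - Finsupp.single i 1 : σ →₀ ℕ) j).factorial : ℂ) =
        l j ^ d j / ((d j).factorial : ℂ) := by
    intro j hj
    have : (d - Finsupp.single i 1 : σ →₀ ℕ) j = d j := by
      simp [(ne_of_mem_erase hj).symm]
    rw [this]
  rw [prod_congr rfl h2, ← mul_assoc, ← mul_assoc]
  congr 1
  obtain ⟨k, hk⟩ := Nat.exists_eq_succ_of_ne_zero (Finsupp.mem_support_iff.1 hi)
  have h3 : (d - Finsupp.single i 1 : σ →₀ ℕ) i = k := by simp [hk]
  rw [h3, hk, Nat.factorial_succ, pow_succ]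
  have h4 : ((k : ℂ) + 1) ≠ 0 := by exact_mod_cast Nat.succ_ne_zero k
  have h5 : (k.factorial : ℂ) ≠ 0 := by exact_mod_cast k.factorial_ne_zero
  push_cast
  field_simp

/-- A derivation acting on exp(∑ λ_i t_i): the variable t_i is scaled with weight c_i. With c = 1 it
is the Euler operator; with the weights of the times it yields the recursion of the q_k. -/
theorem sum_mul_expCoeff_sub_single (l c : σ → ℂ) (d : σ →₀ ℕ) :
    ∑ i ∈ d.support, c i * (l i * expCoeff l (d - Finsupp.single i 1)) =
      (d.sum fun i k => k * c i) * expCoeff l d := by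
  rw [Finsupp.sum, sum_mul]
  refine sum_congr rfl fun i hi => ?_
  rw [mul_expCoeff_sub_single l hi]
  ring

theorem expCoeff_neg (l : σ → ℂ) (d : σ →₀ ℕ) : expCoeff (-l) d = (-1) ^ d.degree * expCoeff l d := by
  rw [Finsupp.degree_apply, expCoeff, expCoeff, Finsupp.prod, Finsupp.prod, ← prod_pow_eq_pow_sum,
    ← prod_mul_distrib]
  refine prod_congr rfl fun i _ => ?_
  rw [Pi.neg_apply, neg_pow]
  ring

/-- The weight of a monomial. -/
def monWeight {Z : Type*} [AddCommMonoid Z] (wt : σ → Z) (d : σ →₀ ℕ) : Z := d.sum fun i k => k • wt i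

theorem monWeight_add {Z : Type*} [AddCommMonoid Z] (wt : σ → Z) (d d' : σ →₀ ℕ) :
    monWeight wt (d + d') = monWeight wt d + monWeight wt d' :=
  Finsupp.sum_add_index' (by simp) (by simp [add_smul])

theorem monWeight_sub_single {Z : Type*} [AddCommMonoid Z] (wt : σ → Z) {d : σ →₀ ℕ} {i : σ}
    (hi : i ∈ d.support) : monWeight wt (d - Finsupp.single i 1) + wt i = monWeight wt d := by
  conv_rhs => rw [← tsub_add_cancel_of_le (single_le_of_mem_support hi), monWeight_add]
  simp [monWeight]

/-- The series `∑_d (λ^d / d!) χ_{n + |d|} t^d`, where `|d|` is the weight. -/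
def shiftSeries (l : σ → ℂ) (wt : σ → ℤ) (χ : ℤ → E) (n : ℤ) : MvPowerSeries σ E :=
  fun d => expCoeff l d • χ (n + monWeight wt d)

theorem coeff_shiftSeries (l : σ → ℂ) (wt : σ → ℤ) (χ : ℤ → E) (n : ℤ) (d : σ →₀ ℕ) :
    coeff d (shiftSeries l wt χ n) = expCoeff l d • χ (n + monWeight wt d) := rfl

theorem coeff_zero_shiftSeries (l : σ → ℂ) (wt : σ → ℤ) (χ : ℤ → E) (n : ℤ) :
    coeff 0 (shiftSeries l wt χ n) = χ n := by
  rw [coeff_shiftSeries, expCoeff_zero, one_smul]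
  simp [monWeight]

/-- The series is e^A χ_n e^{-A}: each bracket with a_i shifts the index by the weight of i, so the
iterated brackets sum to an exponential of scalars. -/
theorem euler_shiftSeries {a : σ → E} {l : σ → ℂ} {wt : σ → ℤ} {χ : ℤ → E}
    (h : ∀ i n, a i * χ n - χ n * a i = l i • χ (n + wt i)) (n : ℤ) :
    euler (shiftSeries l wt χ n) =
      linearForm a * shiftSeries l wt χ n - shiftSeries l wt χ n * linearForm a := by
  ext d
  rw [coeff_euler, map_sub, coeff_linearForm_mul, coeff_mul_linearForm, ← sum_sub_distrib]
  have h1 : ∀ i ∈ d.support, a i * coeff (d - Finsupp.single i 1) (shiftSeries l wt χ n) -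
      coeff (d - Finsupp.single i 1) (shiftSeries l wt χ n) * a i =
      ((1 : ℂ) * (l i * expCoeff l (d - Finsupp.single i 1))) • χ (n + monWeight wt d) := by
    intro i hi
    rw [coeff_shiftSeries, mul_smul_comm, smul_mul_assoc, ← smul_sub, h, smul_smul, add_assoc,
      monWeight_sub_single wt hi, one_mul, mul_comm]
  rw [sum_congr rfl h1, ← sum_smul, sum_mul_expCoeff_sub_single l (fun _ => 1), coeff_shiftSeries,
    mul_smul, ← Nat.cast_smul_eq_nsmul ℂ]
  congr 1
  rw [Finsupp.degree_apply, Finsupp.sum]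
  push_cast
  simp

/-- Conjugation of `χ_n` by `e^A`, if `[a_i, χ_n] = λ_i χ_{n + |i|}`. -/
theorem shiftSeries_mul_formalExp {a : σ → E} {l : σ → ℂ} {wt : σ → ℤ} {χ : ℤ → E}
    (h : ∀ i n, a i * χ n - χ n * a i = l i • χ (n + wt i)) (n : ℤ) :
    shiftSeries l wt χ n * formalExp (linearForm a) = formalExp (linearForm a) * C (χ n) := by
  rw [mul_formalExp (euler_shiftSeries h n), coeff_zero_shiftSeries]

theorem linearForm_neg (a : σ → E) : linearForm (-a) = -linearForm a := by
  ext d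
  change ∑ i ∈ d.support, _ = -∑ i ∈ d.support, _
  rw [← sum_neg_distrib]
  exact sum_congr rfl fun i _ => by split_ifs <;> simp

theorem formalExp_mul_shiftSeries {a : σ → E} {l : σ → ℂ} {wt : σ → ℤ} {χ : ℤ → E}
    (h : ∀ i n, a i * χ n - χ n * a i = l i • χ (n + wt i)) (n : ℤ) :
    formalExp (linearForm a) * shiftSeries (-l) wt χ n = C (χ n) * formalExp (linearForm a) := by
  have h1 := euler_shiftSeries (a := -a) (l := -l) (wt := wt) (χ := χ) (fun i n => by
    rw [Pi.neg_apply, Pi.neg_apply, neg_smul, ← h]; noncomm_ring) n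
  rw [formalExp_mul, coeff_zero_shiftSeries]
  rw [h1, linearForm_neg]
  noncomm_ring

/-- The coefficients of `exp (∑ a_i t_i)`. -/
def expOp (a : σ → E) (d : σ →₀ ℕ) : E := coeff d (formalExp (linearForm a))

theorem expOp_zero (a : σ → E) : expOp a 0 = 1 := coeff_formalExp_zero a

theorem degree_smul_expOp (a : σ → E) (d : σ →₀ ℕ) :
    d.degree • expOp a d = ∑ i ∈ d.support, a i * expOp a (d - Finsupp.single i 1) := by
  have h := congrArg (coeff d) (euler_formalExp a)
  rwa [coeff_euler, coeff_linearForm_mul] at h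

theorem sum_shift_mul_expOp {a : σ → E} {l : σ → ℂ} {wt : σ → ℤ} {χ : ℤ → E}
    (h : ∀ i n, a i * χ n - χ n * a i = l i • χ (n + wt i)) (n : ℤ) (d : σ →₀ ℕ) :
    ∑ p ∈ antidiagonal d, expCoeff l p.1 • (χ (n + monWeight wt p.1) * expOp a p.2) =
      expOp a d * χ n := by
  have h1 := congrArg (coeff d) (shiftSeries_mul_formalExp h n)
  rw [coeff_mul, coeff_mul_C] at h1
  rw [expOp, ← h1]
  exact sum_congr rfl fun p _ => (smul_mul_assoc _ _ _).symm

theorem sum_expOp_mul_shift {a : σ → E} {l : σ → ℂ} {wt : σ → ℤ} {χ : ℤ → E}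
    (h : ∀ i n, a i * χ n - χ n * a i = l i • χ (n + wt i)) (n : ℤ) (d : σ →₀ ℕ) :
    ∑ p ∈ antidiagonal d, expCoeff (-l) p.1 • (expOp a p.2 * χ (n + monWeight wt p.1)) =
      χ n * expOp a d := by
  have h1 := congrArg (coeff d) (formalExp_mul_shiftSeries h n)
  rw [coeff_mul, coeff_C_mul, ← HasAntidiagonal.map_swap_antidiagonal, sum_map] at h1
  rw [expOp, ← h1]
  exact sum_congr rfl fun p _ => (mul_smul_comm _ _ _).symm

end FormalExp

/-! ### Coordinates of fermions and commutators of bilinear operators -/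

theorem create_apply (m : ℕ) (v : Fock) (S : Finset ℕ) :
    create m v S = if m ∈ S then sgn (· > ·) ℂ m S * v (S.erase m) else 0 := by
  induction v using Finsupp.induction_linear with
  | zero => simp
  | add f g hf hg => rw [map_add, Finsupp.add_apply, hf, hg]; split_ifs <;> simp [mul_add]
  | single I a =>
    simp only [create, Finsupp.linearCombination_single, Finsupp.smul_apply, smul_eq_mul]
    by_cases hI : m ∈ I
    · rw [if_pos hI, Finsupp.zero_apply, mul_zero]
      split_ifs
      · rw [Finsupp.single_apply, if_neg, mul_zero]
        rintro rfl
        exact notMem_erase m S hI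
      · rfl
    · rw [if_neg hI]
      by_cases h : insert m I = S
      · subst h
        rw [Finsupp.single_eq_same, if_pos (mem_insert_self m I), erase_insert hI, Finsupp.single_eq_same,
          sgn_insert_self, mul_comm]
        rfl
      · rw [Finsupp.single_apply, if_neg h, mul_zero]
        split_ifs with hS
        · rw [Finsupp.single_apply, if_neg, mul_zero]
          rintro rfl
          exact h (insert_erase hS)
        · rfl

theorem annihilate_apply (m : ℕ) (v : Fock) (S : Finset ℕ) :
    annihilate m v S = ann (· > ·) ℂ m v S := by
  unfold ann
  induction v using Finsupp.induction_linear with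
  | zero => simp
  | add f g hf hg => rw [map_add, Finsupp.add_apply, hf, hg]; split_ifs <;> simp [mul_add]
  | single I a =>
    simp only [annihilate, Finsupp.linearCombination_single, Finsupp.smul_apply, smul_eq_mul]
    by_cases hI : m ∈ I
    · rw [if_pos hI]
      by_cases h : I.erase m = S
      · subst h
        rw [Finsupp.single_eq_same, if_neg (notMem_erase m I), insert_erase hI, Finsupp.single_eq_same,
          sgn_erase_self, mul_comm]
        rfl
      · rw [Finsupp.single_apply, if_neg h, mul_zero]
        split_ifs with hS
        · rfl
        · rw [Finsupp.single_apply, if_neg, mul_zero]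
          rintro rfl
          exact h (erase_insert hS)
    · rw [if_neg hI, Finsupp.zero_apply, mul_zero]
      split_ifs with hS
      · rfl
      · rw [Finsupp.single_apply, if_neg, mul_zero]
        rintro rfl
        exact hI (mem_insert_self m S)

/-- The action of `w_n φ_n` on coefficients, with `w_{-n} = w'_n`. -/
def phi (w w' : ℕ → ℂ) (n : ℤ) (f : Finset ℕ → ℂ) (S : Finset ℕ) : ℂ :=
  if n < 0 then w' n.natAbs * (-1) ^ n.natAbs * ann (· > ·) ℂ n.natAbs f S
  else (if n = 0 then 1 / 2 * ann (· > ·) ℂ 0 f S else 0) +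
    if n.natAbs ∈ S then w n.natAbs * sgn (· > ·) ℂ n.natAbs S * f (S.erase n.natAbs) else 0

theorem neg_one_zpow_natAbs (n : ℤ) : (-1 : ℂ) ^ n = (-1) ^ n.natAbs := by
  rcases Int.natAbs_eq n with h | h
  · conv_lhs => rw [h, zpow_natCast]
  · conv_lhs => rw [h, zpow_neg, zpow_natCast, ← inv_pow, inv_neg_one]

theorem fermion_apply (n : ℤ) (v : Fock) (S : Finset ℕ) : fermion n v S = phi 1 1 n v S := by
  unfold fermion phi
  rcases lt_trichotomy n 0 with h | h | h
  · rw [if_neg (not_lt.2 h.le), if_pos h, if_pos h, LinearMap.smul_apply, Finsupp.smul_apply,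
      annihilate_apply, neg_one_zpow_natAbs]
    simp
  · subst h
    simp only [lt_irrefl, if_false, if_true, LinearMap.add_apply, LinearMap.smul_apply, Finsupp.add_apply,
      Finsupp.smul_apply, create_apply, annihilate_apply, smul_eq_mul, Int.natAbs_zero, Pi.one_apply, one_mul]
    ring
  · rw [if_pos h, if_neg (not_lt.2 h.le), if_neg h.ne', create_apply]
    simp

/-- The annihilation half of `phi` at n = 0 carries no weight, which is why the scalar must be 1
there. -/
theorem smul_phi {c : ℂ} {w w' : ℕ → ℂ} {n : ℤ} (h : ∀ s : ℕ, n = s → c = w s)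
    (h' : ∀ s : ℕ, n = -s → c = w' s) (h0 : n = 0 → c = 1) (f : Finset ℕ → ℂ) (S : Finset ℕ) :
    c * phi 1 1 n f S = phi w w' n f S := by
  unfold phi
  rcases lt_trichotomy n 0 with hn | hn | hn
  · rw [if_pos hn, if_pos hn, h' n.natAbs (by omega)]
    simp [mul_assoc]
  · subst hn
    have h1 := h 0 rfl
    rw [h0 rfl] at h1
    rw [h0 rfl]
    simp [← h1]
  · rw [if_neg (not_lt.2 hn.le), if_neg (not_lt.2 hn.le), if_neg hn.ne', h n.natAbs (by omega)]
    simp [mul_assoc]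

theorem bilinear_support_finite (m : ℤ) (hm : m ≠ 0) (c : ℤ → ℂ) (v : Fock) :
    (Function.support fun n : ℤ => c n • fermion n (fermion (m - n) v)).Finite := by
  induction v using Finsupp.induction_linear with
  | zero => simp
  | add f g hf hg =>
    refine (hf.union hg).subset fun n hn => ?_
    by_contra h
    rw [Set.mem_union, not_or, Function.notMem_support, Function.notMem_support] at h
    refine hn ?_
    simp only [map_add, smul_add, h.1, h.2, add_zero]
  | single S a =>
    refine (bilinear_finite m hm c S).subset fun n hn h => hn ?_
    have : (Finsupp.single S a : Fock) = a • Finsupp.single S 1 := by simp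
    simp only [this, map_smul]
    rw [smul_comm]
    exact (congrArg (a • ·) h).trans (smul_zero a)

theorem bilinear_apply (m : ℤ) (hm : m ≠ 0) (c : ℤ → ℂ) (v : Fock) :
    bilinear m c v = ∑ᶠ n : ℤ, c n • fermion n (fermion (m - n) v) := by
  induction v using Finsupp.induction_linear with
  | zero => simp
  | add f g hf hg =>
    rw [map_add, hf, hg, ← finsum_add_distrib (bilinear_support_finite m hm c f)
      (bilinear_support_finite m hm c g)]
    simp only [map_add, smul_add]
  | single S a =>
    rw [bilinear, Finsupp.linearCombination_single, smul_finsum]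
    refine finsum_congr fun n => ?_
    have : (Finsupp.single S a : Fock) = a • Finsupp.single S 1 := by simp
    simp only [this, map_smul]
    rw [smul_comm]

/-- Anticommuting φ_n through φ_a φ_{m-a} leaves two scalars, one supported at a = m + n and one at
a = -n; each picks a single coefficient from the sum. -/
theorem bilinear_commutator (m : ℤ) (hm : m ≠ 0) (c : ℤ → ℂ) (n : ℤ) :
    bilinear m c * fermion n - fermion n * bilinear m c =
      ((-1 : ℂ) ^ n * (c (m + n) - c (-n))) • fermion (m + n) := by
  ext1 S
  ext1
  simp only [LinearMap.comp_apply, LinearMap.sub_apply, Module.End.mul_apply, LinearMap.smul_apply]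
  generalize (Finsupp.lsingle S : ℂ →ₗ[ℂ] Fock) 1 = v
  have hcomm : ∀ a : ℤ, fermion a (fermion (m - a) (fermion n v)) - fermion n (fermion a (fermion (m - a) v)) =
      (if a = m + n then (-1 : ℂ) ^ n else 0) • fermion (m + n) v -
        (if a = -n then (-1 : ℂ) ^ n else 0) • fermion (m + n) v := by
    intro a
    have h1 := congrArg (fun A : Module.End ℂ Fock => fermion a (A v)) (fermion_anticomm (m - a) n)
    have h2 := congrArg (fun A : Module.End ℂ Fock => A (fermion (m - a) v)) (fermion_anticomm a n)
    simp only [LinearMap.add_apply, Module.End.mul_apply, map_add] at h1 h2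
    have h3 : fermion a (fermion (m - a) (fermion n v)) - fermion n (fermion a (fermion (m - a) v)) =
        (fermion a (fermion (m - a) (fermion n v)) + fermion a (fermion n (fermion (m - a) v))) -
        (fermion a (fermion n (fermion (m - a) v)) + fermion n (fermion a (fermion (m - a) v))) := by abel
    rw [h3, h1, h2]
    congr 1
    · by_cases h : a = m + n
      · subst h
        rw [if_pos (by ring), if_pos rfl, Module.algebraMap_end_apply, map_smul,
          show m - (m + n) = -n by ring, neg_one_zpow_natAbs, neg_one_zpow_natAbs, Int.natAbs_neg]
      · rw [if_neg (by omega), if_neg h, LinearMap.zero_apply, map_zero, zero_smul]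
    · by_cases h : a = -n
      · subst h
        rw [if_pos rfl, if_pos rfl, Module.algebraMap_end_apply,
          show m - -n = m + n by ring, neg_one_zpow_natAbs, neg_one_zpow_natAbs, Int.natAbs_neg]
      · rw [if_neg h, if_neg h, LinearMap.zero_apply, zero_smul]
  have hf1 := bilinear_support_finite m hm c (fermion n v)
  have hf2 := bilinear_support_finite m hm c v
  rw [bilinear_apply m hm, bilinear_apply m hm, ← LinearMap.toAddMonoidHom_coe,
    AddMonoidHom.map_finsum _ hf2]
  refine (finsum_sub_distrib hf1 ?_).symm.trans ?_
  · refine hf2.subset fun a ha h => ha ?_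
    simp only [h, map_zero]
  · have h4 : ∀ a : ℤ, c a • fermion a (fermion (m - a) (fermion n v)) -
        (fermion n).toAddMonoidHom (c a • fermion a (fermion (m - a) v)) =
        (if a = m + n then c a * (-1 : ℂ) ^ n else 0) • fermion (m + n) v -
        (if a = -n then c a * (-1 : ℂ) ^ n else 0) • fermion (m + n) v := by
      intro a
      rw [LinearMap.toAddMonoidHom_coe, map_smul, ← smul_sub, hcomm, smul_sub, smul_smul, smul_smul]
      simp only [mul_ite, mul_zero]
    rw [finsum_congr h4, finsum_sub_distrib, finsum_eq_single _ (m + n), finsum_eq_single _ (-n),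
      if_pos rfl, if_pos rfl, ← sub_smul]
    · congr 1; ring
    · intro a ha; rw [if_neg ha, zero_smul]
    · intro a ha; rw [if_neg ha, zero_smul]
    · refine (Set.finite_singleton (m + n)).subset fun a ha => ?_
      by_contra h
      exact ha (by simp only [Set.mem_singleton_iff] at h; simp only [if_neg h, zero_smul])
    · refine (Set.finite_singleton (-n)).subset fun a ha => ?_
      by_contra h
      exact ha (by simp only [Set.mem_singleton_iff] at h; simp only [if_neg h, zero_smul])

theorem hamiltonian_commutator {k : ℤ} (hk : Odd k) (n : ℤ) :
    hamiltonian k * fermion n - fermion n * hamiltonian k = fermion (n - k) := by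
  have hk0 : -k ≠ 0 := by
    rintro h
    rw [neg_eq_zero.1 h] at hk
    exact absurd hk (by decide)
  rw [hamiltonian, bilinear_commutator _ hk0, show -k + n = n - k by ring]
  convert one_smul ℂ (fermion (n - k)) using 2
  have h1 : (-1 : ℂ) ^ (n - k + 1) = (-1) ^ n := by
    rw [show n - k + 1 = n + (1 - k) by ring, zpow_add₀ (by norm_num),
      (show Even (1 - k) from (odd_one.sub_odd hk)).neg_one_zpow, mul_one]
  have h2 : (-1 : ℂ) ^ (-n + 1) = -(-1) ^ n := by
    rw [zpow_add₀ (by norm_num), zpow_neg, ← inv_zpow, inv_neg_one, zpow_one]; ring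
  have h3 : (-1 : ℂ) ^ n * (-1) ^ n = 1 := by
    rw [← mul_zpow]; simp
  rw [h1, h2]
  linear_combination h3

/-- The two coefficients in the general commutator involve products of k values of r. Both telescope
to e^{T_n - T_{n+k}}, the second one after the symmetry r(n) = r(1 - n), and oddness of k makes them
add up instead of cancelling. -/
theorem flow_commutator {r : ℤ → ℂ} {T : ℤ → ℂ} (hr : ∀ n, r n = r (1 - n))
    (hT : ∀ n, Complex.exp (T (n - 1) - T n) = r n) {k : ℕ} (hk : Odd k) (n : ℤ) :
    flow r k * fermion n - fermion n * flow r k =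
      (-Complex.exp (T n - T (n + k))) • fermion (n + k) := by
  have hk0 : (k : ℤ) ≠ 0 := by
    rintro h
    rw [Int.natCast_eq_zero.1 h] at hk
    exact absurd hk (by decide)
  have hprod : ∀ (n : ℤ) (k : ℕ), ∏ i ∈ range k, r (n + k - i) = Complex.exp (T n - T (n + k)) := by
    intro n k
    induction k with
    | zero => simp
    | succ k ih =>
      rw [prod_range_succ', prod_congr rfl fun (i : ℕ) _ => show r (n + (k + 1 : ℕ) - (i + 1 : ℕ)) = r (n + k - i) by
        congr 1; push_cast; ring, ih, Nat.cast_zero, sub_zero, ← hT, ← Complex.exp_add]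
      congr 1
      rw [show n + ((k + 1 : ℕ) : ℤ) - 1 = n + k by push_cast; ring]
      ring
  have h1 : ∏ i ∈ range k, r (k + n - i) = Complex.exp (T n - T (n + k)) := by
    rw [← hprod, add_comm n]
  have h2 : ∏ i ∈ range k, r (-n - i) = Complex.exp (T n - T (n + k)) := by
    rw [← hprod, ← prod_range_reflect]
    refine prod_congr rfl fun i hi => ?_
    have := mem_range.1 hi
    rw [hr]
    congr 1
    omega
  rw [flow, bilinear_commutator _ hk0, add_comm (k : ℤ) n, h2]
  rw [add_comm (k : ℤ) n] at h1
  rw [h1]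
  congr 1
  have h3 : (-1 : ℂ) ^ (n + k) = -(-1) ^ n := by
    rw [zpow_add₀ (by norm_num), zpow_natCast, hk.neg_one_pow]; ring
  have h4 : (-1 : ℂ) ^ (-n) = (-1) ^ n := by
    rw [zpow_neg, ← inv_zpow, inv_neg_one]
  have h5 : (-1 : ℂ) ^ n * (-1) ^ n = 1 := by
    rw [← mul_zpow]; simp
  rw [h3, h4]
  linear_combination -Complex.exp (T n - T (n + k)) * h5

/-! ### The grading of the Fock space -/

/-- The subspace spanned by the basis vectors of energy `e`. -/
def energySpace (e : ℤ) : Submodule ℂ Fock where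
  carrier := {v | ∀ S : Finset ℕ, v S ≠ 0 → ((∑ s ∈ S, s : ℕ) : ℤ) = e}
  add_mem' {a b} ha hb S hS := by
    by_cases h : a S = 0
    · refine hb S fun h' => hS ?_
      rw [Finsupp.add_apply, h, h', add_zero]
    · exact ha S h
  zero_mem' S hS := absurd rfl hS
  smul_mem' c v hv S hS := hv S fun h => hS (by rw [Finsupp.smul_apply, h, smul_zero])

theorem fermion_mem_energySpace {e : ℤ} {v : Fock} (hv : v ∈ energySpace e) (n : ℤ) :
    fermion n v ∈ energySpace (e + n) := by
  intro S hS
  rw [fermion_apply] at hS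
  have hann : ∀ k : ℕ, ann (· > ·) ℂ k v S ≠ 0 → ((∑ s ∈ S, s : ℕ) : ℤ) = e - k := by
    intro k hk
    unfold ann at hk
    split_ifs at hk with h
    · exact absurd rfl hk
    · have := hv _ (right_ne_zero_of_mul hk)
      rw [sum_insert h] at this
      push_cast at this ⊢
      linarith
  have hcre : ∀ k : ℕ, (if k ∈ S then (1 : ℕ → ℂ) k * sgn (· > ·) ℂ k S * v (S.erase k) else 0) ≠ 0 →
      ((∑ s ∈ S, s : ℕ) : ℤ) = e + k := by
    intro k hk
    split_ifs at hk with h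
    · have := hv _ (right_ne_zero_of_mul hk)
      rw [← add_sum_erase S (fun s => s) h]
      push_cast at this ⊢
      linarith
    · exact absurd rfl hk
  unfold phi at hS
  split_ifs at hS with h1 h2 h3
  · rw [hann n.natAbs (right_ne_zero_of_mul hS)]; omega
  · subst h2
    rcases ne_or_eq (ann (· > ·) ℂ 0 v S) 0 with h | h
    · rw [hann 0 h]; simp
    · rw [h, mul_zero, zero_add] at hS
      rw [hcre 0]
      · simp
      · rw [if_pos (show 0 ∈ S from h3)]; exact hS
  · subst h2
    rw [add_zero] at hS
    rw [hann 0 (right_ne_zero_of_mul hS)]; simp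
  · rw [zero_add] at hS
    rw [hcre n.natAbs]
    · omega
    · rw [if_pos (by assumption)]; exact hS
  · exact absurd (add_zero _) hS

theorem bilinear_mem_energySpace {m : ℤ} (hm : m ≠ 0) (c : ℤ → ℂ) {e : ℤ} {v : Fock}
    (hv : v ∈ energySpace e) : bilinear m c v ∈ energySpace (e + m) := by
  rw [bilinear_apply m hm, finsum_eq_sum _ (bilinear_support_finite m hm c v)]
  refine Submodule.sum_mem _ fun n _ => Submodule.smul_mem _ _ ?_
  have h := fermion_mem_energySpace (fermion_mem_energySpace hv (m - n)) n
  rwa [add_assoc, sub_add_cancel] at h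

/-- Induction on the degree: `degree_smul_expOp` expresses a positive multiple of the operator
through operators of lower degree followed by some a_i. -/
theorem expOp_mem_energySpace {σ : Type*} [DecidableEq σ] {a : σ → Module.End ℂ Fock}
    {wt : σ → ℤ} (ha : ∀ i e v, v ∈ energySpace e → a i v ∈ energySpace (e + wt i)) {e : ℤ} {v : Fock}
    (hv : v ∈ energySpace e) (d : σ →₀ ℕ) :
    expOp a d v ∈ energySpace (e + monWeight wt d) := by
  induction hn : d.degree generalizing d with
  | zero =>
    rw [(Finsupp.degree_eq_zero_iff d).1 hn, expOp_zero]
    simpa [monWeight] using hv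
  | succ n ih =>
    have h1 : d.degree • expOp a d v ∈ energySpace (e + monWeight wt d) := by
      rw [← LinearMap.smul_apply, degree_smul_expOp, LinearMap.sum_apply]
      refine Submodule.sum_mem _ fun i hi => ?_
      have hd := degree_sub_single hi
      have h2 := ha i _ _ (ih (d - Finsupp.single i 1) (by omega))
      rwa [add_assoc, monWeight_sub_single wt hi] at h2
    rw [← Nat.cast_smul_eq_nsmul ℂ] at h1
    have h2 : (d.degree : ℂ) ≠ 0 := by rw [hn]; exact_mod_cast Nat.succ_ne_zero n
    exact (Submodule.smul_mem_iff _ h2).1 h1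

theorem single_mem_energySpace (S : Finset ℕ) (c : ℂ) :
    Finsupp.single S c ∈ energySpace ((∑ s ∈ S, s : ℕ) : ℤ) := by
  intro I hI
  by_cases h : S = I
  · rw [h]
  · exact absurd (by rw [Finsupp.single_apply, if_neg h]) hI

/-! ### Coefficients of `e^{-B} |0⟩` and of `⟨0| e^H` -/

/-- The weights of the times. -/
def timeWeight : ℕ ⊕ ℕ → ℕ := Sum.elim (fun j => 2 * j + 1) (fun j => 2 * j + 1)

theorem degree_le_monWeight (d : ℕ ⊕ ℕ →₀ ℕ) : d.degree ≤ monWeight timeWeight d := by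
  rw [Finsupp.degree_apply, monWeight, Finsupp.sum]
  refine sum_le_sum fun i _ => ?_
  rw [smul_eq_mul]
  refine Nat.le_mul_of_pos_right _ ?_
  rcases i with j | j <;> simp [timeWeight]

theorem cast_monWeight {σ : Type*} (wt : σ → ℕ) (d : σ →₀ ℕ) :
    ((monWeight wt d : ℕ) : ℤ) = monWeight (fun i => (wt i : ℤ)) d := by
  simp [monWeight, Finsupp.sum]

theorem monWeight_neg {σ : Type*} (wt : σ → ℤ) (d : σ →₀ ℕ) :
    monWeight (fun i => -wt i) d = -monWeight wt d := by
  simp [monWeight, Finsupp.sum]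

/-- Only odd times occur, so weight and degree have the same parity. -/
theorem neg_one_pow_monWeight (d : ℕ ⊕ ℕ →₀ ℕ) :
    (-1 : ℂ) ^ monWeight timeWeight d = (-1) ^ d.degree := by
  rw [Finsupp.degree_apply, monWeight, Finsupp.sum, ← prod_pow_eq_pow_sum, ← prod_pow_eq_pow_sum]
  refine prod_congr rfl fun i _ => ?_
  have h : Odd (timeWeight i) := by rcases i with j | j <;> exact ⟨j, rfl⟩
  rw [smul_eq_mul, mul_comm, pow_mul, h.neg_one_pow]

/-- The operators in the exponent `-B(t*)`. -/
def flowOps (r : ℤ → ℂ) : ℕ ⊕ ℕ → Module.End ℂ Fock :=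
  Sum.elim (fun _ => 0) fun j => -flow r (2 * j + 1)

/-- The operators in the exponent `H(t)`. -/
def hamiltonianOps : ℕ ⊕ ℕ → Module.End ℂ Fock :=
  Sum.elim (fun j => hamiltonian (2 * j + 1)) fun _ => 0

/-- The coordinates of `e^{-B(t*)} |0⟩`. -/
def flowCoeff (r : ℤ → ℂ) (d : ℕ ⊕ ℕ →₀ ℕ) (S : Finset ℕ) : ℂ := expOp (flowOps r) d vacuum S

/-- The normalized coordinates of `⟨0| e^{H(t)}`. -/
def hamiltonianCoeff (d : ℕ ⊕ ℕ →₀ ℕ) (S : Finset ℕ) : ℂ :=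
  (zeroWeight ℂ S)⁻¹ * expOp hamiltonianOps d (Finsupp.single S 1) ∅

theorem zeroWeight_ne_zero (S : Finset ℕ) : zeroWeight ℂ S ≠ 0 := by
  unfold zeroWeight; split_ifs <;> norm_num

theorem commutator_neg_smul {E : Type*} [Ring E] [Algebra ℂ E] (a b b' : E) (c e : ℂ)
    (h : a * b - b * a = -e • b') : -a * (c • b) - (c • b) * -a = (c * e) • b' := by
  have h1 : -a * (c • b) - (c • b) * -a = -(c • (a * b - b * a)) := by
    rw [smul_sub, mul_smul_comm, mul_neg, smul_mul_assoc, neg_mul, smul_neg]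
    abel
  rw [h1, h, smul_smul, mul_neg, neg_smul, neg_neg]

theorem flowOps_commutator {r T : ℤ → ℂ} (hr : ∀ n, r n = r (1 - n))
    (hT : ∀ n, Complex.exp (T (n - 1) - T n) = r n) (i : ℕ ⊕ ℕ) (n : ℤ) :
    flowOps r i * (Complex.exp (-T n) • fermion n) - (Complex.exp (-T n) • fermion n) * flowOps r i =
      (Sum.elim 0 1 i : ℂ) • (Complex.exp (-T (n + (timeWeight i : ℤ))) •
        fermion (n + (timeWeight i : ℤ))) := by
  rcases i with j | j
  · simp [flowOps]
    exact sub_self (0 : Module.End ℂ Fock)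
  · have h := flow_commutator hr hT (k := 2 * j + 1) ⟨j, rfl⟩ n
    simp only [flowOps, Sum.elim_inr, timeWeight, Pi.one_apply, one_smul]
    refine (commutator_neg_smul (E := Module.End ℂ Fock) _ _ _ _ _ h).trans ?_
    rw [← Complex.exp_add]
    congr 2
    push_cast
    ring

theorem hamiltonianOps_commutator (i : ℕ ⊕ ℕ) (n : ℤ) :
    hamiltonianOps i * fermion n - fermion n * hamiltonianOps i =
      (Sum.elim 1 0 i : ℂ) • fermion (n + -(timeWeight i : ℤ)) := by
  rcases i with j | j
  · have h := hamiltonian_commutator (k := 2 * j + 1) ⟨j, rfl⟩ n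
    simp only [hamiltonianOps, Sum.elim_inl, timeWeight, Pi.one_apply, one_smul]
    rw [h]
    congr 1
  · simp [hamiltonianOps]
    exact sub_self (0 : Module.End ℂ Fock)

/-- The equation φ_{-m}|0⟩ = 0 conjugated by e^{-B}. Skewness of T makes the weights of opposite
modes inverse to each other, in particular T_0 = 0. -/
theorem sum_phi_flowCoeff {r T : ℤ → ℂ} (hr : ∀ n, r n = r (1 - n)) (hTneg : ∀ n, T (-n) = -T n)
    (hT : ∀ n, Complex.exp (T (n - 1) - T n) = r n) (d : ℕ ⊕ ℕ →₀ ℕ) {m : ℕ} (hm : m ≠ 0)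
    (S : Finset ℕ) :
    ∑ p ∈ antidiagonal d, expCoeff (Sum.elim 0 1) p.1 *
      phi (fun s => Complex.exp (-T s)) (fun s => Complex.exp (T s))
        ((monWeight timeWeight p.1 : ℕ) - m : ℤ) (flowCoeff r p.2) S = 0 := by
  have h := sum_shift_mul_expOp (E := Module.End ℂ Fock) (a := flowOps r) (l := Sum.elim 0 1)
    (wt := fun i => (timeWeight i : ℤ)) (χ := fun n => Complex.exp (-T n) • fermion n)
    (fun i n => flowOps_commutator hr hT i n) (-(m : ℤ)) d
  have h1 := congrArg (fun A : Module.End ℂ Fock => A vacuum S) h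
  simp only [LinearMap.sum_apply, LinearMap.smul_apply, Module.End.mul_apply, Finsupp.finsetSum_apply,
    Finsupp.smul_apply, smul_eq_mul] at h1
  rw [fermion_vacuum _ (by omega), smul_zero, map_zero, Finsupp.zero_apply] at h1
  rw [← h1]
  refine sum_congr rfl fun p _ => ?_
  rw [cast_monWeight, sub_eq_neg_add, fermion_apply]
  congr 1
  symm
  refine smul_phi ?_ ?_ ?_ _ _
  · rintro s hs
    rw [hs]
  · rintro s hs
    rw [hs, hTneg, neg_neg]
  · rintro hs
    have h0 : T 0 = 0 := by
      have := hTneg 0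
      rw [neg_zero] at this
      exact self_eq_neg.1 this
    rw [hs, h0, neg_zero, Complex.exp_zero]

/-- With respect to the form in which the basis is orthogonal with norms `zeroWeight`, the transpose
of φ_n is (-1)^n φ_{-n}. Covectors in normalized coordinates can thus be treated like vectors. -/
theorem phi_transpose (L : Fock →ₗ[ℂ] ℂ) (n : ℤ) (S : Finset ℕ) :
    L (fermion n (Finsupp.single S 1)) = (-1) ^ n.natAbs * zeroWeight ℂ S *
      phi 1 1 (-n) (fun S => (zeroWeight ℂ S)⁻¹ * L (Finsupp.single S 1)) S := by
  have hcre : ∀ k : ℕ, L (create k (Finsupp.single S 1)) =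
      if k ∈ S then 0 else sgn (· > ·) ℂ k S * L (Finsupp.single (insert k S) 1) := by
    intro k
    rw [create, Finsupp.linearCombination_single, one_smul]
    split_ifs
    · rw [map_zero]
    · have : (Finsupp.single (insert k S) (modeSign k S) : Fock) =
          modeSign k S • Finsupp.single (insert k S) 1 := by simp
      rw [this, map_smul]
      rfl
  have hann : ∀ k : ℕ, L (annihilate k (Finsupp.single S 1)) =
      if k ∈ S then sgn (· > ·) ℂ k S * L (Finsupp.single (S.erase k) 1) else 0 := by
    intro k
    rw [annihilate, Finsupp.linearCombination_single, one_smul]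
    split_ifs
    · have : (Finsupp.single (S.erase k) (modeSign k S) : Fock) =
          modeSign k S • Finsupp.single (S.erase k) 1 := by simp
      rw [this, map_smul]
      rfl
    · rw [map_zero]
  have hz := zeroWeight_ne_zero S
  unfold phi fermion ann
  rcases lt_trichotomy n 0 with h | h | h
  · rw [if_neg (not_lt.2 h.le), if_pos h, if_neg (by omega), if_neg (by omega), LinearMap.smul_apply, map_smul,
      hann, neg_one_zpow_natAbs, Int.natAbs_neg, smul_eq_mul]
    by_cases hS : n.natAbs ∈ S
    · have h1 : zeroWeight ℂ (S.erase n.natAbs) = zeroWeight ℂ S := by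
        have h0 : n.natAbs ≠ 0 := by omega
        simp [zeroWeight, h0.symm]
      simp only [if_pos hS, h1, Pi.one_apply]
      field_simp
      ring
    · simp only [if_neg hS]
      ring
  · subst h
    simp only [lt_irrefl, if_false, if_true, LinearMap.add_apply, LinearMap.smul_apply, map_add, map_smul,
      hcre, hann, neg_zero, Int.natAbs_zero, pow_zero, one_mul, Pi.one_apply, smul_eq_mul]
    by_cases hS : 0 ∈ S
    · simp [hS, zeroWeight]
    · simp [hS, zeroWeight]
      ring
  · rw [if_pos h, if_pos (by omega), hcre, Int.natAbs_neg]
    by_cases hS : n.natAbs ∈ S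
    · simp [hS]
    · have h1 : zeroWeight ℂ (insert n.natAbs S) = zeroWeight ℂ S := by
        rw [zeroWeight_insert hS, if_neg (by omega), one_mul]
      have h2 : ((-1 : ℂ) ^ n.natAbs) * (-1) ^ n.natAbs = 1 := by rw [← mul_pow]; simp
      simp only [if_neg hS, h1, Pi.one_apply, smul_eq_mul]
      field_simp
      linear_combination -(sgn (· > ·) ℂ n.natAbs S * L (Finsupp.single (insert n.natAbs S) 1)) * h2

/-- The equation ⟨0|φ_m = 0 conjugated by e^H and transposed. Conjugation from this side contributes
(-1) to the degree and transposition (-1) to the weight; these signs cancel because the times are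
odd. -/
theorem sum_phi_hamiltonianCoeff (d : ℕ ⊕ ℕ →₀ ℕ) {m : ℕ} (hm : m ≠ 0) (S : Finset ℕ) :
    ∑ p ∈ antidiagonal d, expCoeff (Sum.elim 1 0) p.1 *
      phi 1 1 ((monWeight timeWeight p.1 : ℕ) - m : ℤ) (hamiltonianCoeff p.2) S = 0 := by
  have h := sum_expOp_mul_shift (E := Module.End ℂ Fock) (a := hamiltonianOps) (l := Sum.elim 1 0)
    (wt := fun i => -(timeWeight i : ℤ)) (χ := fermion) (fun i n => hamiltonianOps_commutator i n) (m : ℤ) d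
  have h1 := congrArg (fun A : Module.End ℂ Fock => A (Finsupp.single S 1) ∅) h
  simp only [LinearMap.sum_apply, LinearMap.smul_apply, Module.End.mul_apply, Finsupp.finsetSum_apply,
    Finsupp.smul_apply, smul_eq_mul] at h1
  rw [vacuum_fermion _ (by omega)] at h1
  have h2 : ∀ p ∈ antidiagonal d, expCoeff (-Sum.elim (1 : ℕ → ℂ) (0 : ℕ → ℂ)) p.1 *
      (expOp hamiltonianOps p.2 (fermion ((m : ℤ) + monWeight (fun i => -(timeWeight i : ℤ)) p.1)
        (Finsupp.single S 1))) ∅ = (-1) ^ m * zeroWeight ℂ S * (expCoeff (Sum.elim 1 0) p.1 *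
      phi 1 1 ((monWeight timeWeight p.1 : ℕ) - m : ℤ) (hamiltonianCoeff p.2) S) := by
    intro p _
    have h3 := phi_transpose ((Finsupp.lapply ∅ : Fock →ₗ[ℂ] ℂ) ∘ₗ expOp hamiltonianOps p.2)
      ((m : ℤ) + monWeight (fun i => -(timeWeight i : ℤ)) p.1) S
    simp only [LinearMap.comp_apply, Finsupp.lapply_apply] at h3
    rw [h3, expCoeff_neg, ← neg_one_zpow_natAbs, monWeight_neg, ← cast_monWeight, zpow_add₀ (by norm_num),
      zpow_neg, zpow_natCast, zpow_natCast, neg_one_pow_monWeight]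
    have h4 : ((-1 : ℂ) ^ p.1.degree) * ((-1) ^ p.1.degree)⁻¹ = 1 := mul_inv_cancel₀ (by simp)
    rw [show -((m : ℤ) + -((monWeight timeWeight p.1 : ℕ) : ℤ)) = (monWeight timeWeight p.1 : ℕ) - m by ring]
    change _ = (-1) ^ m * zeroWeight ℂ S * (expCoeff (Sum.elim 1 0) p.1 *
      phi 1 1 ((monWeight timeWeight p.1 : ℕ) - m : ℤ)
        (fun S => (zeroWeight ℂ S)⁻¹ * expOp hamiltonianOps p.2 (Finsupp.single S 1) ∅) S)
    generalize phi 1 1 ((monWeight timeWeight p.1 : ℕ) - m : ℤ)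
        (fun S => (zeroWeight ℂ S)⁻¹ * expOp hamiltonianOps p.2 (Finsupp.single S 1) ∅) S = z
    linear_combination (-1) ^ m * zeroWeight ℂ S * expCoeff (Sum.elim 1 0) p.1 * z * h4
  rw [sum_congr rfl h2, ← mul_sum] at h1
  refine (mul_eq_zero.1 h1).resolve_left (mul_ne_zero ?_ (zeroWeight_ne_zero S))
  simp

/-- B_k raises the energy by k, so the coefficient of a monomial lies in one energy level. This
makes the sums over the Fock basis finite below any weight. -/
theorem flowCoeff_weight {r : ℤ → ℂ} {d : ℕ ⊕ ℕ →₀ ℕ} {S : Finset ℕ} (h : flowCoeff r d S ≠ 0) :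
    ∑ s ∈ S, s = monWeight timeWeight d := by
  have h1 := expOp_mem_energySpace (a := flowOps r) (wt := fun i => (timeWeight i : ℤ)) (fun i e v hv => by
    rcases i with j | j
    · exact Submodule.zero_mem _
    · exact Submodule.neg_mem _ (bilinear_mem_energySpace (m := ((2 * j + 1 : ℕ) : ℤ)) (by omega) _ hv))
    (single_mem_energySpace ∅ 1) d S h
  rw [sum_empty, ← cast_monWeight] at h1
  omega

theorem hamiltonianCoeff_weight {d : ℕ ⊕ ℕ →₀ ℕ} {S : Finset ℕ} (h : hamiltonianCoeff d S ≠ 0) :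
    ∑ s ∈ S, s = monWeight timeWeight d := by
  have h1 := expOp_mem_energySpace (a := hamiltonianOps) (wt := fun i => -(timeWeight i : ℤ))
    (fun i e v hv => by
      rcases i with j | j
      · exact bilinear_mem_energySpace (m := -(2 * j + 1)) (by omega) _ hv
      · exact Submodule.zero_mem _)
    (single_mem_energySpace S 1) d ∅ (right_ne_zero_of_mul h)
  rw [sum_empty, monWeight_neg, ← cast_monWeight] at h1
  omega

theorem flowCoeff_zero (r : ℤ → ℂ) (S : Finset ℕ) :
    flowCoeff r 0 S = if S = ∅ then 1 else 0 := by
  rw [flowCoeff, expOp_zero, Module.End.one_apply, vacuum, Finsupp.single_apply]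
  simp only [eq_comm]

theorem hamiltonianCoeff_zero (S : Finset ℕ) :
    hamiltonianCoeff 0 S = if S = ∅ then 1 else 0 := by
  rw [hamiltonianCoeff, expOp_zero, Module.End.one_apply, Finsupp.single_apply]
  by_cases h : S = ∅
  · subst h; simp [zeroWeight]
  · simp [h]

theorem eq_zero_of_monWeight_eq_zero {d : ℕ ⊕ ℕ →₀ ℕ} (h : monWeight timeWeight d = 0) : d = 0 := by
  have := degree_le_monWeight d
  exact (Finsupp.degree_eq_zero_iff d).1 (by omega)

/-- Below the weight `M`, the tau function is a finite sum over the basis of the Fock space. -/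
theorem coeff_tau (r : ℤ → ℂ) {M : ℕ} {d : ℕ ⊕ ℕ →₀ ℕ} (hd : monWeight timeWeight d < M) :
    MvPowerSeries.coeff d (tau r) = ∑ S ∈ (range M).powerset, ∑ p ∈ antidiagonal d,
      zeroWeight ℂ S * (hamiltonianCoeff p.1 S * flowCoeff r p.2 S) := by
  have hflow : -flowSeries r = linearForm (flowOps r) := by
    refine (linearForm_neg (E := Module.End ℂ Fock) _).symm.trans ?_
    congr 1
    ext1 i
    rcases i with j | j
    · exact neg_zero (G := Module.End ℂ Fock)
    · rfl
  have h1 : MvPowerSeries.coeff d (tau r) = ∑ p ∈ antidiagonal d,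
      vev (expOp hamiltonianOps p.1 * expOp (flowOps r) p.2) := by
    change vev (MvPowerSeries.coeff d (formalExp hamiltonianSeries * formalExp (-flowSeries r))) = _
    rw [hflow, MvPowerSeries.coeff_mul]
    change (∑ p ∈ antidiagonal d, expOp hamiltonianOps p.1 * expOp (flowOps r) p.2) vacuum ∅ = _
    rw [LinearMap.sum_apply, Finsupp.finsetSum_apply]
    rfl
  rw [h1, sum_comm]
  refine sum_congr rfl fun p hp => ?_
  have hle : monWeight timeWeight p.2 < M := by
    rw [← HasAntidiagonal.mem_antidiagonal.1 hp, monWeight_add] at hd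
    omega
  -- Every basis vector that occurs has energy less than M, so all of its modes lie below M.
  have hv : expOp (flowOps r) p.2 vacuum = ∑ S ∈ (range M).powerset,
      flowCoeff r p.2 S • (Finsupp.single S 1 : Fock) := by
    ext I
    rw [Finsupp.finsetSum_apply]
    change flowCoeff r p.2 I = _
    by_cases hI : flowCoeff r p.2 I = 0
    · rw [hI, sum_eq_zero]
      intro S _
      by_cases h : S = I
      · rw [h, hI, zero_smul, Finsupp.zero_apply]
      · rw [Finsupp.smul_apply, Finsupp.single_apply, if_neg h, smul_zero]
    · rw [sum_eq_single I]
      · simp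
      · intro S _ h
        rw [Finsupp.smul_apply, Finsupp.single_apply, if_neg h, smul_zero]
      · intro h
        refine absurd (mem_powerset.2 fun s hs => mem_range.2 ?_) h
        have h2 := flowCoeff_weight hI
        have h3 := single_le_sum (f := fun s : ℕ => s) (fun _ _ => Nat.zero_le _) hs
        omega
  rw [vev, Module.End.mul_apply, hv, map_sum, Finsupp.finsetSum_apply]
  refine sum_congr rfl fun S _ => ?_
  rw [map_smul, Finsupp.smul_apply, smul_eq_mul, hamiltonianCoeff, mul_assoc,
    mul_inv_cancel_left₀ (zeroWeight_ne_zero S), mul_comm]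

/-! ### The bilinear relations after a specialization of the times -/

/-- The component of weight `k` of `exp (∑ λ_i t_i)`. -/
def qSeries (l : ℕ ⊕ ℕ → ℂ) (k : ℕ) : MvPowerSeries (ℕ ⊕ ℕ) ℂ := fun d =>
  if monWeight timeWeight d = k then expCoeff l d else 0

theorem coeff_qSeries (l : ℕ ⊕ ℕ → ℂ) (k : ℕ) (d : ℕ ⊕ ℕ →₀ ℕ) :
    MvPowerSeries.coeff d (qSeries l k) = if monWeight timeWeight d = k then expCoeff l d else 0 := rfl

theorem qSeries_zero (l : ℕ ⊕ ℕ → ℂ) : qSeries l 0 = 1 := by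
  ext d
  rw [coeff_qSeries, MvPowerSeries.coeff_one]
  by_cases h : d = 0
  · subst h
    rw [if_pos rfl, expCoeff_zero]
    simp [monWeight]
  · rw [if_neg h, if_neg fun h' => h (eq_zero_of_monWeight_eq_zero h')]

/-- The logarithmic derivative of exp(∑ λ_i t_i z^{|i|}) in z, where |i| is the weight of t_i,
compared at z^k. -/
theorem natCast_mul_qSeries (l : ℕ ⊕ ℕ → ℂ) (k : ℕ) :
    (k : MvPowerSeries (ℕ ⊕ ℕ) ℂ) * qSeries l k = ∑ p ∈ antidiagonal k,
      qSeries l p.1 * linearForm fun i => if timeWeight i = p.2 then (p.2 : ℂ) * l i else 0 := by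
  ext d
  rw [← nsmul_eq_mul, map_nsmul, map_sum, coeff_qSeries]
  simp only [coeff_mul_linearForm, coeff_qSeries]
  rw [sum_comm]
  have h1 : ∀ i ∈ d.support, ∑ p ∈ antidiagonal k,
      (if monWeight timeWeight (d - Finsupp.single i 1) = p.1 then
        expCoeff l (d - Finsupp.single i 1) else 0) *
        (if timeWeight i = p.2 then (p.2 : ℂ) * l i else 0) =
      if monWeight timeWeight d = k then
        (timeWeight i : ℂ) * (l i * expCoeff l (d - Finsupp.single i 1)) else 0 := by
    intro i hi
    have hw := monWeight_sub_single timeWeight hi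
    by_cases h : monWeight timeWeight d = k
    · rw [if_pos h, sum_eq_single (monWeight timeWeight (d - Finsupp.single i 1), timeWeight i)]
      · simp only [if_true]
        ring
      · rintro ⟨a, b⟩ _ hne
        by_cases ha : monWeight timeWeight (d - Finsupp.single i 1) = a
        · rw [if_neg (show timeWeight i ≠ b from fun hb => hne (by rw [ha, hb])), mul_zero]
        · rw [if_neg ha, zero_mul]
      · intro hn
        exact absurd (HasAntidiagonal.mem_antidiagonal.2 (hw.trans h)) hn
    · rw [if_neg h]
      refine sum_eq_zero fun p hp => ?_
      have hp' := HasAntidiagonal.mem_antidiagonal.1 hp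
      by_cases ha : monWeight timeWeight (d - Finsupp.single i 1) = p.1
      · rw [if_neg (show timeWeight i ≠ p.2 by omega), mul_zero]
      · rw [if_neg ha, zero_mul]
  rw [sum_congr rfl h1]
  by_cases h : monWeight timeWeight d = k
  · simp only [if_pos h]
    rw [sum_mul_expCoeff_sub_single l (fun i => (timeWeight i : ℂ)), ← h, nsmul_eq_mul]
    congr 1
    simp [monWeight, Finsupp.sum]
  · simp [h]

theorem linearForm_single (i : ℕ ⊕ ℕ) (b : ℂ) :
    linearForm (Pi.single i b) = b • (MvPowerSeries.X i : MvPowerSeries (ℕ ⊕ ℕ) ℂ) := by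
  ext d
  rw [map_smul, MvPowerSeries.coeff_X, smul_eq_mul, mul_ite, mul_one, mul_zero]
  change (∑ j ∈ d.support, if d = Finsupp.single j 1 then Pi.single i b j else 0) = _
  by_cases h : d = Finsupp.single i 1
  · subst h
    rw [if_pos rfl, Finsupp.support_single _ one_ne_zero]
    simp
  · rw [if_neg h]
    refine sum_eq_zero fun j _ => ?_
    split_ifs with hj
    · rw [Pi.single_eq_of_ne]
      rintro rfl
      exact h hj
    · rfl

/-- Sorting by the sign of k - m matches the three groups of terms in `Annihilated`; for k = m both
halves of φ_0 appear, the second as j = 0. -/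
theorem phi_eq_sum (w w' : ℕ → ℂ) (k m : ℕ) (f : Finset ℕ → ℂ) (S : Finset ℕ) :
    phi w w' ((k : ℕ) - m : ℤ) f S =
      ∑ a ∈ range m, (if k = a then w' (m - a) * (-1) ^ (m - a) * ann (· > ·) ℂ (m - a) f S else 0) +
      (if k = m then 1 / 2 * ann (· > ·) ℂ 0 f S else 0) +
      ∑ j ∈ S, if k = m + j then w j * sgn (· > ·) ℂ j S * f (S.erase j) else 0 := by
  rcases lt_trichotomy k m with h | h | h
  · rw [sum_ite_eq, if_pos (mem_range.2 h), if_neg h.ne, sum_eq_zero fun j _ => if_neg (by omega), phi,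
      if_pos (by omega), show ((k : ℤ) - m).natAbs = m - k by omega, add_zero, add_zero]
  · subst h
    rw [sum_ite_eq, if_neg (by simp), if_pos rfl, sub_self, phi, if_neg (lt_irrefl _), if_pos rfl, zero_add]
    congr 1
    simp only [Int.natAbs_zero, left_eq_add]
    rw [sum_ite_eq']
  · obtain ⟨n, rfl⟩ := Nat.exists_eq_add_of_lt h
    rw [sum_ite_eq, if_neg (by rw [mem_range]; omega), if_neg (by omega), phi, if_neg (by omega), if_neg (by omega),
      zero_add, zero_add, zero_add, show (((m + n + 1 : ℕ) : ℤ) - m).natAbs = n + 1 by omega]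
    simp only [show ∀ j, (m + n + 1 = m + j ↔ n + 1 = j) by omega]
    rw [sum_ite_eq]

/-- The power series with given coefficients. -/
def ofCoeff (a : (ℕ ⊕ ℕ →₀ ℕ) → ℂ) : MvPowerSeries (ℕ ⊕ ℕ) ℂ := a

theorem coeff_ofCoeff (a : (ℕ ⊕ ℕ →₀ ℕ) → ℂ) (d : ℕ ⊕ ℕ →₀ ℕ) :
    MvPowerSeries.coeff d (ofCoeff a) = a d := rfl

section Specialize

variable {K : Type*} [Field K] [Algebra ℂ K] (ρ : MvPowerSeries (ℕ ⊕ ℕ) ℂ →ₐ[ℂ] K)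

theorem map_sgn (n : ℕ) (S : Finset ℕ) :
    algebraMap ℂ K (sgn (· > ·) ℂ n S) = sgn (· > ·) K n S := by
  simp [sgn]

theorem ann_map_series (F : (ℕ ⊕ ℕ →₀ ℕ) → Finset ℕ → ℂ) (n : ℕ) (S : Finset ℕ) :
    ann (· > ·) K n (fun S => ρ (ofCoeff fun d => F d S)) S = ρ (ofCoeff fun d => ann (· > ·) ℂ n (F d) S) := by
  unfold ann
  split_ifs
  · exact (map_zero ρ).symm
  · rw [smul_eq_mul, ← map_sgn, ← Algebra.smul_def]
    exact (map_smul ρ _ _).symm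

theorem coeff_smul_qSeries_mul (c : ℂ) (l : ℕ ⊕ ℕ → ℂ) (k : ℕ) (A : MvPowerSeries (ℕ ⊕ ℕ) ℂ)
    (d : ℕ ⊕ ℕ →₀ ℕ) : MvPowerSeries.coeff d (c • (qSeries l k * A)) = ∑ p ∈ antidiagonal d,
      expCoeff l p.1 * if monWeight timeWeight p.1 = k then c * MvPowerSeries.coeff p.2 A else 0 := by
  rw [map_smul, MvPowerSeries.coeff_mul, smul_eq_mul, mul_sum]
  refine sum_congr rfl fun p _ => ?_
  rw [coeff_qSeries]
  split_ifs
  · ring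
  · ring

/-- The hypothesis is the coefficient at t^d of a relation between power series. Collecting the
monomials of weight k into q_k gives a finite relation, to which the homomorphism ρ can be applied.
-/
theorem annihilated_map {l : ℕ ⊕ ℕ → ℂ} {w w' : ℕ → ℂ} {F : (ℕ ⊕ ℕ →₀ ℕ) → Finset ℕ → ℂ}
    (h : ∀ (d : ℕ ⊕ ℕ →₀ ℕ) (m : ℕ), m ≠ 0 → ∀ S, ∑ p ∈ antidiagonal d, expCoeff l p.1 *
      phi w w' ((monWeight timeWeight p.1 : ℕ) - m : ℤ) (F p.2) S = 0) :
    Annihilated (fun k => ρ (qSeries l k)) (fun s => algebraMap ℂ K (w s))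
      (fun s => algebraMap ℂ K (w' s)) (fun S => ρ (ofCoeff fun d => F d S)) := by
  intro m hm S
  simp only [ann_map_series, crs, smul_eq_mul]
  have h1 : (∑ a ∈ range m, (w' (m - a) * (-1) ^ (m - a)) •
        (qSeries l a * ofCoeff fun d => ann (· > ·) ℂ (m - a) (F d) S) +
      (1 / 2 : ℂ) • (qSeries l m * ofCoeff fun d => ann (· > ·) ℂ 0 (F d) S) +
      ∑ j ∈ S, (w j * sgn (· > ·) ℂ j S) •
        (qSeries l (m + j) * ofCoeff fun d => F d (S.erase j))) = 0 := by
    ext d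
    rw [map_zero, ← h d m hm S, map_add, map_add, map_sum, map_sum]
    simp only [coeff_smul_qSeries_mul]
    rw [sum_comm, sum_comm (s := S), ← sum_add_distrib, ← sum_add_distrib]
    refine sum_congr rfl fun p _ => ?_
    rw [phi_eq_sum, mul_add, mul_add, mul_sum, mul_sum]
    rfl
  have h2 := congrArg ρ h1
  simp only [map_add, map_sum, map_smul, map_zero] at h2
  simp only [Algebra.smul_def, map_mul] at h2
  rw [← h2]
  congr 1
  · congr 1
    · refine sum_congr rfl fun a _ => ?_
      simp only [map_pow, map_neg, map_one]
      ring
    · rw [map_div₀, map_one, map_ofNat]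
      ring
  · refine sum_congr rfl fun j _ => ?_
    rw [map_sgn]
    ring

end Specialize

/-! ### The variables `x_i` and `y_i` -/

theorem algebraMap_injective (N : ℕ) :
    Function.Injective (algebraMap (XYSeries N) (XYField N)) := IsFractionRing.injective _ _

theorem X_add_X_ne_zero {σ : Type*} (i j : σ) :
    (MvPowerSeries.X i + MvPowerSeries.X j : MvPowerSeries σ ℂ) ≠ 0 := by
  classical
  intro h
  have h1 := congrArg (MvPowerSeries.coeff (Finsupp.single i 1)) h
  rw [map_add, MvPowerSeries.coeff_X, MvPowerSeries.coeff_X, if_pos rfl, map_zero] at h1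
  split_ifs at h1 <;> norm_num at h1

theorem X_injective {σ : Type*} :
    Function.Injective (MvPowerSeries.X : σ → MvPowerSeries σ ℂ) := by
  classical
  intro i j h
  by_contra hij
  have h1 := congrArg (MvPowerSeries.coeff (Finsupp.single i 1)) h
  rw [MvPowerSeries.coeff_X, MvPowerSeries.coeff_X, if_pos rfl, if_neg] at h1
  · exact one_ne_zero h1
  · intro h2
    exact hij ((Finsupp.single_left_inj one_ne_zero).1 h2)

theorem xVar_injective (N : ℕ) : Function.Injective (xVar (N := N)) := fun _ _ h =>
  Sum.inl_injective (X_injective (algebraMap_injective N h))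

theorem yVar_injective (N : ℕ) : Function.Injective (yVar (N := N)) := fun _ _ h =>
  Sum.inr_injective (X_injective (algebraMap_injective N h))

theorem xVar_add_ne_zero {N : ℕ} (i j : Fin N) : xVar i + xVar j ≠ 0 := by
  rw [xVar, xVar, ← map_add]
  exact (map_ne_zero_iff _ (algebraMap_injective N)).2 (X_add_X_ne_zero _ _)

theorem yVar_add_ne_zero {N : ℕ} (i j : Fin N) : yVar i + yVar j ≠ 0 := by
  rw [yVar, yVar, ← map_add]
  exact (map_ne_zero_iff _ (algebraMap_injective N)).2 (X_add_X_ne_zero _ _)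

instance (N : ℕ) : CharZero (XYField N) := algebraRat.charZero _

theorem delta_eq_deltaOn {N : ℕ} {K : Type*} [Field K] (z : Fin N → K) :
    delta z = deltaOn z univ := by
  unfold delta deltaOn
  refine prod_congr rfl fun i _ => ?_
  congr 1
  ext j
  simp

/-! ### The specialization of the times -/

/-- The specialization of the times, with values in the field of fractions. -/
def specialize (N : ℕ) : MvPowerSeries (ℕ ⊕ ℕ) ℂ →ₐ[ℂ] XYField N :=
  (IsScalarTower.toAlgHom ℂ (XYSeries N) (XYField N)).comp
    (MvPowerSeries.substAlgHom (hasSubst_xyTimes N))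

theorem specialize_apply (N : ℕ) (f : MvPowerSeries (ℕ ⊕ ℕ) ℂ) :
    specialize N f = algebraMap (XYSeries N) (XYField N) (MvPowerSeries.subst (xyTimes N) f) := by
  rw [← MvPowerSeries.coe_substAlgHom (hasSubst_xyTimes N)]
  rfl

theorem smul_powerTime {N : ℕ} (z : Fin N → XYSeries N) (j : ℕ) :
    ((2 * j + 1 : ℕ) : ℂ) • powerTime z j = 2 * ∑ k, z k ^ (2 * j + 1) := by
  have h : (2 * (j : ℂ) + 1) ≠ 0 := by exact_mod_cast Nat.succ_ne_zero (2 * j)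
  have hodd : Odd (2 * j + 1) := ⟨j, rfl⟩
  rw [powerTime, smul_smul]
  push_cast
  rw [mul_one_div_cancel h, one_smul, mul_sum]
  refine sum_congr rfl fun k _ => ?_
  rw [hodd.neg_pow]
  ring

theorem specialize_X_inl (N j : ℕ) :
    specialize N (((2 * j + 1 : ℕ) : ℂ) • MvPowerSeries.X (Sum.inl j)) =
      2 * ∑ k, xVar k ^ (2 * j + 1) := by
  rw [map_smul, specialize_apply, MvPowerSeries.subst_X (hasSubst_xyTimes N), ← algebraMap.coe_smul,
    xyTimes, Sum.elim_inl]
  refine (congrArg _ (smul_powerTime _ _)).trans ?_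
  change algebraMap (XYSeries N) (XYField N) _ = _
  rw [map_mul, map_ofNat, map_sum]
  simp [xVar]

theorem specialize_X_inr (N j : ℕ) :
    specialize N (((2 * j + 1 : ℕ) : ℂ) • MvPowerSeries.X (Sum.inr j)) =
      2 * ∑ k, yVar k ^ (2 * j + 1) := by
  rw [map_smul, specialize_apply, MvPowerSeries.subst_X (hasSubst_xyTimes N), ← algebraMap.coe_smul,
    xyTimes, Sum.elim_inr]
  refine (congrArg _ (smul_powerTime _ _)).trans ?_
  change algebraMap (XYSeries N) (XYField N) _ = _
  rw [map_mul, map_ofNat, map_sum]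
  simp [yVar]

theorem specialize_linearForm_inl (N b : ℕ) :
    specialize N (linearForm fun i => if timeWeight i = b then (b : ℂ) * (Sum.elim 1 0 i : ℂ) else 0) =
      if Odd b then 2 * ∑ k, xVar k ^ b else 0 := by
  split_ifs with hb
  · obtain ⟨j, rfl⟩ := hb
    rw [← specialize_X_inl, ← linearForm_single]
    congr 2
    funext i
    rcases i with a | a
    · by_cases h : a = j
      · subst h; simp [timeWeight]
      · rw [Pi.single_eq_of_ne (by simpa using h), if_neg (by simpa [timeWeight] using h)]
    · simp
  · convert map_zero (specialize N)
    ext1 d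
    refine sum_eq_zero fun i _ => ?_
    have : timeWeight i ≠ b := by
      rintro rfl
      exact hb (by rcases i with j | j <;> exact ⟨j, rfl⟩)
    simp [this]

theorem specialize_linearForm_inr (N b : ℕ) :
    specialize N (linearForm fun i => if timeWeight i = b then (b : ℂ) * (Sum.elim 0 1 i : ℂ) else 0) =
      if Odd b then 2 * ∑ k, yVar k ^ b else 0 := by
  split_ifs with hb
  · obtain ⟨j, rfl⟩ := hb
    rw [← specialize_X_inr, ← linearForm_single]
    congr 2
    funext i
    rcases i with a | a
    · simp
    · by_cases h : a = j
      · subst h; simp [timeWeight]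
      · rw [Pi.single_eq_of_ne (by simpa using h), if_neg (by simpa [timeWeight] using h)]
  · convert map_zero (specialize N)
    ext1 d
    refine sum_eq_zero fun i _ => ?_
    have : timeWeight i ≠ b := by
      rintro rfl
      exact hb (by rcases i with j | j <;> exact ⟨j, rfl⟩)
    simp [this]

/-- At the special times b t_b is twice the power sum of exponent b, so the recursion of the q_k is
that of ∏ (1 + z_i u)/(1 - z_i u) in the auxiliary variable u. -/
theorem specialize_qSeries_eq_sum {N : ℕ} {l : ℕ ⊕ ℕ → ℂ} {z : Fin N → XYField N}
    (hinj : Function.Injective z) (hz : ∀ i j, z i + z j ≠ 0)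
    (hl : ∀ b : ℕ, specialize N (linearForm fun i => if timeWeight i = b then (b : ℂ) * l i else 0) =
      if Odd b then 2 * ∑ k, z k ^ b else 0) {k : ℕ} (hk : k ≠ 0) :
    specialize N (qSeries l k) = ∑ i, residue z univ i * z i ^ k := by
  refine eq_sum_residue (q := fun k => specialize N (qSeries l k)) hinj.injOn ?_ ?_ ?_ hk
  · intro i _ h
    exact hz i i (by rw [h, add_zero])
  · rw [qSeries_zero, map_one]
  · intro k
    have h := congrArg (specialize N) (natCast_mul_qSeries l k)
    rw [map_mul, map_natCast, map_sum] at h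
    rw [h]
    refine sum_congr rfl fun p _ => ?_
    rw [map_mul, hl]

/-- The coordinates of `e^{-B(t*)} |0⟩` after the specialization of the times. -/
def flowVec (N : ℕ) (r : ℤ → ℂ) (S : Finset ℕ) : XYField N :=
  specialize N (ofCoeff fun d => flowCoeff r d S)

/-- The normalized coordinates of `⟨0| e^{H(t)}` after the specialization of the times. -/
def hamiltonianVec (N : ℕ) (S : Finset ℕ) : XYField N :=
  specialize N (ofCoeff fun d => hamiltonianCoeff d S)

theorem ofCoeff_eq_C {a : (ℕ ⊕ ℕ →₀ ℕ) → ℂ} (h : ∀ d, a d ≠ 0 → d = 0) :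
    ofCoeff a = MvPowerSeries.C (a 0) := by
  ext d
  rw [coeff_ofCoeff, MvPowerSeries.coeff_C]
  split_ifs with hd
  · rw [hd]
  · by_contra h'
    exact hd (h d h')

/-- Energy zero forces the coordinate to be a constant series. It is applied to ∅ and {0}, the two
sets that determine a solution. -/
theorem flowVec_eq {N : ℕ} (r : ℤ → ℂ) {S : Finset ℕ} (hS : ∑ s ∈ S, s = 0) :
    flowVec N r S = if S = ∅ then 1 else 0 := by
  rw [flowVec, ofCoeff_eq_C, flowCoeff_zero]
  · split_ifs <;> simp
  · intro d hd
    exact eq_zero_of_monWeight_eq_zero ((flowCoeff_weight hd).symm.trans hS)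

theorem hamiltonianVec_eq {N : ℕ} {S : Finset ℕ} (hS : ∑ s ∈ S, s = 0) :
    hamiltonianVec N S = if S = ∅ then 1 else 0 := by
  rw [hamiltonianVec, ofCoeff_eq_C, hamiltonianCoeff_zero]
  · split_ifs <;> simp
  · intro d hd
    exact eq_zero_of_monWeight_eq_zero ((hamiltonianCoeff_weight hd).symm.trans hS)

theorem fermiVec_xVar (N : ℕ) :
    fermiVec 1 (xVar (N := N)) univ = ((1 / 2) ^ (N / 2) * delta (xVar (N := N))) •
      if Even N then hamiltonianVec N else toggle (hamiltonianVec N) := by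
  have h1 := annihilated_map (specialize N) fun d m hm S => sum_phi_hamiltonianCoeff d hm S
  have h2 : (fun s => algebraMap ℂ (XYField N) ((1 : ℕ → ℂ) s)) = 1 := by
    funext s
    simp
  rw [h2] at h1
  have h3 := fermiVec_eq_smul (I := univ) (fun s => by simp) rfl (xVar_injective N) xVar_add_ne_zero
    (by rw [qSeries_zero, map_one])
    (fun k hk => specialize_qSeries_eq_sum (xVar_injective N) xVar_add_ne_zero
      (specialize_linearForm_inl N) hk) h1 (hamiltonianVec_eq (by simp)) ((hamiltonianVec_eq (by simp)).trans (by simp))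
  rw [card_univ, Fintype.card_fin] at h3
  rw [delta_eq_deltaOn]
  exact h3

theorem fermiVec_yVar (N : ℕ) {r T : ℤ → ℂ} (hr : ∀ n, r n = r (1 - n)) (hTneg : ∀ n, T (-n) = -T n)
    (hT : ∀ n, Complex.exp (T (n - 1) - T n) = r n) :
    fermiVec (fun s => algebraMap ℂ (XYField N) (Complex.exp (-T s))) (yVar (N := N)) univ =
      ((1 / 2) ^ (N / 2) * delta (yVar (N := N))) •
        if Even N then flowVec N r else toggle (flowVec N r) := by
  have h1 := annihilated_map (specialize N) fun d m hm S => sum_phi_flowCoeff hr hTneg hT d hm S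
  have h3 := fermiVec_eq_smul (I := univ) (fun s => by rw [← map_mul, ← Complex.exp_add]; simp)
    (by
      have h0 : T 0 = 0 := by
        have := hTneg 0
        rw [neg_zero] at this
        exact self_eq_neg.1 this
      simp [h0]) (yVar_injective N) yVar_add_ne_zero
    (by rw [qSeries_zero, map_one])
    (fun k hk => specialize_qSeries_eq_sum (yVar_injective N) yVar_add_ne_zero
      (specialize_linearForm_inr N) hk) h1 (flowVec_eq r (by simp)) ((flowVec_eq r (by simp)).trans (by simp))
  rw [card_univ, Fintype.card_fin] at h3
  rw [delta_eq_deltaOn]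
  exact h3

/-- The two normalizations contribute 2^{-2⌊N/2⌋}; for odd N the factor φ_0² = 1/2 completes this to
2^{-N}. -/
theorem pairing_fermiVec {M : ℕ} (hM : M ≠ 0) (N : ℕ) {r T : ℤ → ℂ} (hr : ∀ n, r n = r (1 - n))
    (hTneg : ∀ n, T (-n) = -T n) (hT : ∀ n, Complex.exp (T (n - 1) - T n) = r n) :
    2 ^ N * pairing M (fermiVec 1 (xVar (N := N)) univ)
        (fermiVec (fun s => algebraMap ℂ (XYField N) (Complex.exp (-T s))) (yVar (N := N)) univ) =
      delta (xVar (N := N)) * delta (yVar (N := N)) *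
        pairing M (hamiltonianVec N) (flowVec N r) := by
  have h2 : (2 : XYField N) * (1 / 2) = 1 := by norm_num
  rw [fermiVec_xVar, fermiVec_yVar N hr hTneg hT, pairing_smul_smul]
  rcases Nat.even_or_odd' N with ⟨n, hn | hn⟩
  · have h3 : N / 2 = n := by omega
    have he : Even N := ⟨n, by omega⟩
    have h4 : (2 : XYField N) ^ N * ((1 / 2) ^ n * (1 / 2) ^ n) = 1 := by
      rw [← pow_add, ← two_mul, ← hn, ← mul_pow, h2, one_pow]
    rw [if_pos he, if_pos he, h3]
    linear_combination delta (xVar (N := N)) * delta (yVar (N := N)) *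
        pairing M (hamiltonianVec N) (flowVec N r) * h4
  · have h3 : N / 2 = n := by omega
    have he : ¬ Even N := Nat.not_even_iff_odd.2 ⟨n, hn⟩
    have h4 : (2 : XYField N) ^ N * ((1 / 2) ^ n * (1 / 2) ^ n * (1 / 2)) = 1 := by
      rw [← pow_add, ← pow_succ, ← two_mul, ← hn, ← mul_pow, h2, one_pow]
    rw [if_neg he, if_neg he, h3, pairing_toggle hM]
    linear_combination delta (xVar (N := N)) * delta (yVar (N := N)) *
        pairing M (hamiltonianVec N) (flowVec N r) * h4

/-! ### The Pfaffian with truncated mixed entries -/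

/-- The numbering of the rows and columns. -/
def blockEquiv (N : ℕ) : Fin N ⊕ Fin N ≃ Fin (2 * N) :=
  finSumFinEquiv.trans (finCongr (two_mul N).symm)

/-- The skew-symmetric matrix with diagonal blocks given by `x` and `y`. -/
def corrBlocks {N : ℕ} {K : Type*} [Field K] (x y : Fin N → K) :
    Matrix (Fin (2 * N)) (Fin (2 * N)) K :=
  Matrix.reindex (blockEquiv N) (blockEquiv N)
    (Matrix.fromBlocks (Matrix.of fun k m => corr x m.rev k.rev) 0 0 (Matrix.of fun k m => corr y k m))

/-- The skew-symmetric matrix with off-diagonal blocks given by `c`. -/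
def mixedBlocks {N : ℕ} {R : Type*} [CommRing R] (c : Fin N → Fin N → R) :
    Matrix (Fin (2 * N)) (Fin (2 * N)) R :=
  Matrix.reindex (blockEquiv N) (blockEquiv N)
    (Matrix.fromBlocks 0 (Matrix.of fun k m => c k.rev m) (Matrix.of fun k m => -c m.rev k) 0)

theorem mixedBlocks_map {N : ℕ} {R R' : Type*} [CommRing R] [CommRing R'] (f : R →+* R')
    (c : Fin N → Fin N → R) :
    (mixedBlocks c).map f = mixedBlocks fun i j => f (c i j) := by
  ext a b
  obtain ⟨a, rfl⟩ := (blockEquiv N).surjective a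
  obtain ⟨b, rfl⟩ := (blockEquiv N).surjective b
  rcases a with a | a <;> rcases b with b | b <;> simp [mixedBlocks]

theorem pfaffMatrix_eq (N : ℕ) (T : ℤ → ℂ) :
    pfaffMatrix N T = corrBlocks xVar yVar +
      (mixedBlocks fun i j => mixedSeries T i j).map (algebraMap (XYSeries N) (XYField N)) := by
  rw [mixedBlocks_map]
  ext a b
  obtain ⟨a, rfl⟩ := (blockEquiv N).surjective a
  obtain ⟨b, rfl⟩ := (blockEquiv N).surjective b
  change corrMatrix N T ((blockEquiv N).symm _) ((blockEquiv N).symm _) = _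
  rcases a with a | a <;> rcases b with b | b <;>
    simp only [mixedBlocks, corrBlocks, Matrix.add_apply, Matrix.reindex_apply, Matrix.submatrix_apply,
      Equiv.symm_apply_apply, Matrix.fromBlocks_apply₁₁, Matrix.fromBlocks_apply₁₂,
      Matrix.fromBlocks_apply₂₁, Matrix.fromBlocks_apply₂₂, Matrix.of_apply, Matrix.zero_apply, add_zero,
      zero_add] <;> rfl

/-- The rows are labelled x_N, …, x_1, y_1, …, y_N, so the x's enter in reversed order through
`Fin.rev`, as `pf_eq_pairing` requires. -/
theorem pfaffian_mixedCorr {N : ℕ} {K : Type*} [Field K] [CharZero K] (M : ℕ) (w : ℕ → K)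
    (x y : Fin N → K) :
    pfaffian (corrBlocks x y + mixedBlocks (mixedCorr M w x y)) =
      pairing M (fermiVec 1 x univ) (fermiVec w y univ) := by
  set A := corrBlocks x y + mixedBlocks (mixedCorr M w x y) with hA
  have hskew : ∀ i j, A i j = -A j i := by
    intro a b
    obtain ⟨a, rfl⟩ := (blockEquiv N).surjective a
    obtain ⟨b, rfl⟩ := (blockEquiv N).surjective b
    rcases a with a | a <;> rcases b with b | b <;> simp [hA, mixedBlocks, corrBlocks]
    · exact eq_neg_of_add_eq_zero_left (corr_add_swap x _ _)
    · exact eq_neg_of_add_eq_zero_left (corr_add_swap y _ _)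
  have h1 := pf_image_eq_pfaffian (fun i j => A i j) hskew id strictMono_id
  refine h1.symm.trans ?_
  have h2 := pf_eq_pairing M w x y (ex := fun i : Fin N => blockEquiv N (Sum.inl i.rev))
    (ey := fun j => blockEquiv N (Sum.inr j)) (g := fun i j => A i j) ?_ ?_ ?_ ?_ ?_ ?_ univ univ
  · rw [← h2]
    congr 1
    ext a
    obtain ⟨a, rfl⟩ := (blockEquiv N).surjective a
    rcases a with a | a
    · simp only [image_id, mem_univ, mem_union, mem_image, true_and, true_iff]
      exact Or.inl ⟨a.rev, by rw [Fin.rev_rev]⟩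
    · simp
  · intro i j hij
    have : j.rev < i.rev := Fin.rev_lt_rev.2 hij
    exact this
  · intro i j hij
    exact Nat.add_lt_add_left hij N
  · intro i j
    exact Fin.lt_def.2 (lt_of_lt_of_le i.rev.isLt (Nat.le_add_right N j))
  · intro i j
    simp [hA, mixedBlocks, corrBlocks]
  · intro i j
    simp [hA, mixedBlocks, corrBlocks]
  · intro i j
    simp [hA, mixedBlocks, corrBlocks]

/-! ### Pfaffians and limits -/

/-- The sum over permutations in the definition of the Pfaffian. -/
def pfSum {R : Type*} [CommRing R] {n : ℕ} (A : Matrix (Fin (2 * n)) (Fin (2 * n)) R) : R :=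
  ∑ σ : Equiv.Perm (Fin (2 * n)), ((Equiv.Perm.sign σ : ℤ) : R) *
    ∏ i : Fin n, A (σ ⟨2 * i, by omega⟩) (σ ⟨2 * i + 1, by omega⟩)

theorem map_pfSum {R R' : Type*} [CommRing R] [CommRing R'] (f : R →+* R') {n : ℕ}
    (A : Matrix (Fin (2 * n)) (Fin (2 * n)) R) : f (pfSum A) = pfSum (A.map f) := by
  simp [pfSum]

theorem pfSum_smul {R : Type*} [CommRing R] (b : R) {n : ℕ}
    (A : Matrix (Fin (2 * n)) (Fin (2 * n)) R) : pfSum (b • A) = b ^ n * pfSum A := by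
  unfold pfSum
  rw [mul_sum]
  refine sum_congr rfl fun σ _ => ?_
  simp only [Matrix.smul_apply, smul_eq_mul, prod_mul_distrib, prod_const, card_univ, Fintype.card_fin]
  ring

theorem two_pow_mul_pfaffian {K : Type*} [Field K] [CharZero K] {n : ℕ}
    (A : Matrix (Fin (2 * n)) (Fin (2 * n)) K) :
    2 ^ n * pfaffian A = (n.factorial : K)⁻¹ * pfSum A := by
  have h : (2 : K) ^ n ≠ 0 := pow_ne_zero _ two_ne_zero
  unfold pfaffian pfSum
  rw [mul_inv, ← mul_assoc, ← mul_assoc, mul_inv_cancel₀ h, one_mul]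

/-- Passage to the limit in an identity for Pfaffians over a field of fractions. -/
theorem pfaffian_limit {R K : Type*} [CommRing R] [Nontrivial R] [Field K] [CharZero K] [Algebra R K]
    [IsFractionRing R K] (I : ℕ → Ideal R) (hI : ∀ f, (∀ M, f ∈ I M) → f = 0) {n : ℕ}
    (B : Matrix (Fin (2 * n)) (Fin (2 * n)) K) (C : Matrix (Fin (2 * n)) (Fin (2 * n)) R)
    (C' : ℕ → Matrix (Fin (2 * n)) (Fin (2 * n)) R) (hC : ∀ M i j, C i j - C' M i j ∈ I M)
    (δ : K) (t : R) (t' : ℕ → R) (ht : ∀ M, t - t' M ∈ I M)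
    (h : ∀ M, 2 ^ n * pfaffian (B + (C' M).map (algebraMap R K)) = δ * algebraMap R K (t' M)) :
    2 ^ n * pfaffian (B + C.map (algebraMap R K)) = δ * algebraMap R K t := by
  obtain ⟨b, hb⟩ := IsLocalization.exist_integer_multiples_of_finite (nonZeroDivisors R)
    fun p : Fin (2 * n) × Fin (2 * n) => B p.1 p.2
  choose β hβ using hb
  replace hβ := fun p => (hβ p).trans (Algebra.smul_def _ _)
  obtain ⟨e, he⟩ := IsLocalization.exist_integer_multiples_of_finite (nonZeroDivisors R)
    fun _ : Unit => δ
  obtain ⟨ε, hε⟩ := he ()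
  replace hε := hε.trans (Algebra.smul_def _ _)
  have hinj : Function.Injective (algebraMap R K) := IsFractionRing.injective R K
  have hb0 : algebraMap R K b ≠ 0 :=
    (map_ne_zero_iff _ hinj).2 (nonZeroDivisors.coe_ne_zero b)
  have he0 : algebraMap R K e ≠ 0 :=
    (map_ne_zero_iff _ hinj).2 (nonZeroDivisors.coe_ne_zero e)
  have hn0 : (n.factorial : K) ≠ 0 := by exact_mod_cast n.factorial_ne_zero
  -- With common denominators b of B and e of δ, the expression G is the difference of the two sides
  -- multiplied by e b^n n!. It is a polynomial in the entries of D and in s with coefficients in R.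
  let A : Matrix (Fin (2 * n)) (Fin (2 * n)) R → Matrix (Fin (2 * n)) (Fin (2 * n)) R :=
    fun D => (Matrix.of fun i j => β (i, j)) + (b : R) • D
  let G : Matrix (Fin (2 * n)) (Fin (2 * n)) R → R → R :=
    fun D s => e * pfSum (A D) - (n.factorial : R) * b ^ n * ε * s
  have hA : ∀ D, (A D).map (algebraMap R K) = algebraMap R K b • (B + D.map (algebraMap R K)) := by
    intro D
    ext i j
    simp only [A, Matrix.map_apply, Matrix.add_apply, Matrix.of_apply, Matrix.smul_apply, map_add,
      smul_eq_mul, map_mul, mul_add, hβ]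
  have hG : ∀ D s, algebraMap R K (G D s) = algebraMap R K e * algebraMap R K b ^ n * (n.factorial : K) *
      (2 ^ n * pfaffian (B + D.map (algebraMap R K)) - δ * algebraMap R K s) := by
    intro D s
    simp only [G, map_sub, map_mul, map_pow, map_natCast, map_pfSum, hA, pfSum_smul, hε,
      two_pow_mul_pfaffian]
    field_simp
  have h0 : G C t = 0 := by
    refine hI _ fun M => ?_
    have h1 : G (C' M) (t' M) = 0 := by
      refine hinj ?_
      rw [hG, h, sub_self, mul_zero, map_zero]
    -- Being polynomial, G respects congruences modulo I_M, although its fractional form has no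
    -- meaning there. Hence G(C, t) lies in every I_M and vanishes.
    have h2 : Ideal.Quotient.mk (I M) (G C t) = Ideal.Quotient.mk (I M) (G (C' M) (t' M)) := by
      have h3 : Ideal.Quotient.mk (I M) t = Ideal.Quotient.mk (I M) (t' M) :=
        Ideal.Quotient.eq.2 (ht M)
      have h4 : (A C).map (Ideal.Quotient.mk (I M)) = (A (C' M)).map (Ideal.Quotient.mk (I M)) := by
        ext i j
        simp only [A, Matrix.map_apply, Matrix.add_apply, Matrix.of_apply, Matrix.smul_apply, map_add,
          smul_eq_mul, map_mul, Ideal.Quotient.eq.2 (hC M i j)]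
      simp only [G, map_sub, map_mul, map_pfSum, h3, h4]
    rw [h1, map_zero] at h2
    exact Ideal.Quotient.eq_zero_iff_mem.1 h2
  have h5 := hG C t
  rw [h0, map_zero] at h5
  have h6 := (mul_eq_zero.1 h5.symm).resolve_left
    (mul_ne_zero (mul_ne_zero he0 (pow_ne_zero _ hb0)) hn0)
  exact sub_eq_zero.1 h6

/-! ### Truncation of power series -/

/-- The ideal of the power series of order at least `M`. -/
def orderIdeal (σ : Type*) (M : ℕ) : Ideal (MvPowerSeries σ ℂ) where
  carrier := {f | (M : ℕ∞) ≤ f.order}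
  add_mem' {f g} hf hg := (le_min hf hg).trans MvPowerSeries.min_order_le_add
  zero_mem' := by simp
  smul_mem' c f hf := (le_trans hf le_add_self).trans MvPowerSeries.le_order_mul

theorem mem_orderIdeal_iff {σ : Type*} {M : ℕ} {f : MvPowerSeries σ ℂ} :
    f ∈ orderIdeal σ M ↔ ∀ d : σ →₀ ℕ, d.degree < M → MvPowerSeries.coeff d f = 0 :=
  ⟨fun h d hd => MvPowerSeries.coeff_of_lt_order (lt_of_lt_of_le (by exact_mod_cast hd) h),
    MvPowerSeries.nat_le_order⟩

theorem eq_zero_of_forall_mem_orderIdeal {σ : Type*} {f : MvPowerSeries σ ℂ}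
    (h : ∀ M, f ∈ orderIdeal σ (M + 1)) : f = 0 := by
  ext d
  exact mem_orderIdeal_iff.1 (h d.degree) d (by omega)

theorem powerTime_mem_orderIdeal {N : ℕ} (z : Fin N → Fin N ⊕ Fin N) (j : ℕ) :
    powerTime (fun k => (MvPowerSeries.X (z k) : XYSeries N)) j ∈ orderIdeal _ (2 * j + 1) := by
  have hodd : Odd (2 * j + 1) := ⟨j, rfl⟩
  rw [mem_orderIdeal_iff]
  intro d hd
  have hX : ∀ s : Fin N ⊕ Fin N,
      MvPowerSeries.coeff d ((MvPowerSeries.X s : XYSeries N) ^ (2 * j + 1)) = 0 := by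
    intro s
    rw [MvPowerSeries.coeff_X_pow, if_neg]
    rintro rfl
    rw [Finsupp.degree_single] at hd
    exact lt_irrefl _ hd
  simp [powerTime, hodd.neg_pow, hX]

theorem monWeight_le_order_prod (N : ℕ) (d : ℕ ⊕ ℕ →₀ ℕ) :
    ((monWeight timeWeight d : ℕ) : ℕ∞) ≤ (d.prod fun s e => xyTimes N s ^ e).order := by
  refine le_trans ?_ (MvPowerSeries.le_order_prod _ _)
  rw [monWeight, Finsupp.sum, Nat.cast_sum]
  refine sum_le_sum fun i _ => le_trans ?_ (MvPowerSeries.le_order_pow _)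
  have h : (timeWeight i : ℕ∞) ≤ (xyTimes N i).order := by
    rcases i with j | j
    · exact powerTime_mem_orderIdeal Sum.inl j
    · exact powerTime_mem_orderIdeal Sum.inr j
  rw [smul_eq_mul, Nat.cast_mul, ← nsmul_eq_mul]
  exact nsmul_le_nsmul_right h _

/-- The time of weight m becomes a series of order at least m, so a monomial of weight at least M
becomes a series of order at least M. -/
theorem subst_mem_orderIdeal {N M : ℕ} {f : MvPowerSeries (ℕ ⊕ ℕ) ℂ}
    (hf : ∀ d, monWeight timeWeight d < M → MvPowerSeries.coeff d f = 0) :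
    MvPowerSeries.subst (xyTimes N) f ∈ orderIdeal _ M := by
  rw [mem_orderIdeal_iff]
  intro e he
  rw [MvPowerSeries.coeff_subst (hasSubst_xyTimes N)]
  refine finsum_eq_zero_of_forall_eq_zero fun d => ?_
  rcases lt_or_ge (monWeight timeWeight d) M with h | h
  · rw [hf d h, zero_smul]
  · have h1 : ((e.degree : ℕ) : ℕ∞) < (monWeight timeWeight d : ℕ) := by exact_mod_cast he.trans_le h
    rw [MvPowerSeries.coeff_of_lt_order (h1.trans_le (monWeight_le_order_prod N d)), smul_zero]

/-- The truncation of the tau function. -/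
def tauTrunc (r : ℤ → ℂ) (M : ℕ) : MvPowerSeries (ℕ ⊕ ℕ) ℂ :=
  ∑ S ∈ (range M).powerset, zeroWeight ℂ S •
    (ofCoeff (fun d => hamiltonianCoeff d S) * ofCoeff fun d => flowCoeff r d S)

theorem specialize_tauTrunc (N : ℕ) (r : ℤ → ℂ) (M : ℕ) :
    specialize N (tauTrunc r M) = pairing M (hamiltonianVec N) (flowVec N r) := by
  rw [tauTrunc, map_sum, pairing]
  refine sum_congr rfl fun S _ => ?_
  rw [map_smul, map_mul, Algebra.smul_def, mul_assoc]
  congr 1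
  unfold zeroWeight
  split_ifs
  · rw [map_div₀, map_one, map_ofNat]
  · rw [map_one]

/-- By `coeff_tau` the tau function and its truncation have the same coefficients at all monomials
of weight less than M. -/
theorem tauXY_sub_mem_orderIdeal (N : ℕ) (r : ℤ → ℂ) (M : ℕ) :
    tauXY N r - MvPowerSeries.subst (xyTimes N) (tauTrunc r M) ∈ orderIdeal _ M := by
  rw [tauXY, ← MvPowerSeries.subst_sub (hasSubst_xyTimes N)]
  refine subst_mem_orderIdeal fun d hd => ?_
  rw [map_sub, coeff_tau r hd, tauTrunc, map_sum, sub_eq_zero]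
  refine sum_congr rfl fun S _ => ?_
  rw [map_smul, MvPowerSeries.coeff_mul, smul_eq_mul, mul_sum]
  rfl

/-- The truncation of the mixed entries. -/
def mixedTrunc {N : ℕ} (T : ℤ → ℂ) (M : ℕ) (i j : Fin N) : XYSeries N :=
  ∑ s ∈ range M, (if s = 0 then (1 / 2 : ℂ) else Complex.exp (-T s)) •
    (MvPowerSeries.X (Sum.inl i) * MvPowerSeries.X (Sum.inr j)) ^ s

theorem mixedSeries_sub_mem_orderIdeal {N : ℕ} (T : ℤ → ℂ) (M : ℕ) (i j : Fin N) :
    mixedSeries T i j - mixedTrunc T M i j ∈ orderIdeal _ M := by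
  have hc : MvPowerSeries.constantCoeff
      (MvPowerSeries.X (Sum.inl i) * MvPowerSeries.X (Sum.inr j) : XYSeries N) = 0 := by simp
  rw [mem_orderIdeal_iff]
  intro e he
  rw [map_sub, mixedSeries, PowerSeries.coeff_subst (PowerSeries.HasSubst.of_constantCoeff_zero hc),
    mixedTrunc, map_sum, finsum_eq_sum_of_support_subset (s := range M), sub_eq_zero]
  · refine sum_congr rfl fun s _ => ?_
    rw [PowerSeries.coeff_mk, map_smul]
  · intro s hs
    by_contra hsM
    rw [coe_range, Set.mem_Iio, not_lt] at hsM
    refine hs ?_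
    dsimp only
    rw [MvPowerSeries.coeff_of_lt_order, smul_zero]
    refine lt_of_lt_of_le ?_ (MvPowerSeries.le_order_pow_of_constantCoeff_eq_zero s hc)
    exact_mod_cast he.trans_le hsM

/-- T_0 = 0 is needed to fit the constant term 1/2 into the uniform weight e^{-T_n} halved at n = 0.
-/
theorem algebraMap_mixedTrunc {N : ℕ} {T : ℤ → ℂ} (h0 : T 0 = 0) (M : ℕ) (i j : Fin N) :
    algebraMap (XYSeries N) (XYField N) (mixedTrunc T M i j) =
      mixedCorr M (fun s => algebraMap ℂ (XYField N) (Complex.exp (-T s))) xVar yVar i j := by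
  rw [mixedTrunc, map_sum, mixedCorr]
  refine sum_congr rfl fun s _ => ?_
  rw [Algebra.smul_def, map_mul, ← IsScalarTower.algebraMap_apply, map_pow, map_mul, mul_pow, ← mul_assoc]
  congr 2
  split_ifs with hs
  · subst hs
    simp only [Nat.cast_zero, h0, neg_zero, Complex.exp_zero, map_one, mul_one, map_div₀, map_ofNat]
  · simp

/-! ### The exponents `T_n` -/

theorem exists_exponents (r : ℤ → ℂ) (hsymm : ∀ n, r n = r (1 - n)) (hne : ∀ n, r n ≠ 0) :
    ∃ T : ℤ → ℂ, (∀ n, T (-n) = -T n) ∧ ∀ n, Complex.exp (T (n - 1) - T n) = r n := by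
  -- T is a sum of logarithms of r(1), …, r(n) on n ≥ 0 and is extended as an odd function; for n ≤
  -- 0 the required identity is the one at 1 - n, by the symmetry of r.
  let L : ℕ → ℂ := fun k => -∑ j ∈ range k, Complex.log (r (j + 1))
  have hL : ∀ k, L k - L (k + 1) = Complex.log (r (k + 1)) := by
    intro k
    simp only [L, sum_range_succ]
    ring
  have hL0 : L 0 = 0 := by simp [L]
  let T : ℤ → ℂ := fun n => if 0 ≤ n then L n.natAbs else -L n.natAbs
  have hpos : ∀ k : ℕ, T k = L k := fun k => by simp [T]
  have hneg : ∀ k : ℕ, T (-k) = -L k := by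
    intro k
    rcases Nat.eq_zero_or_pos k with rfl | h
    · simp [T, hL0]
    · simp only [T]
      rw [if_neg (by omega)]
      simp
  refine ⟨T, fun n => ?_, fun n => ?_⟩
  · rcases Int.eq_nat_or_neg n with ⟨k, rfl | rfl⟩
    · rw [hneg, hpos]
    · rw [neg_neg, hneg, hpos, neg_neg]
  · rcases le_or_gt n 0 with h | h
    · obtain ⟨k, hk⟩ := Int.eq_ofNat_of_zero_le (neg_nonneg.2 h)
      obtain rfl : n = -(k : ℤ) := by omega
      have h1 : -(k : ℤ) - 1 = -((k + 1 : ℕ) : ℤ) := by push_cast; ring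
      rw [h1, hneg, hneg, show -L (k + 1) - -L k = L k - L (k + 1) by ring, hL, hsymm,
        Complex.exp_log (hne _)]
      congr 1
      ring
    · obtain ⟨k, hk⟩ := Int.eq_ofNat_of_zero_le (show 0 ≤ n - 1 by omega)
      obtain rfl : n = ((k + 1 : ℕ) : ℤ) := by push_cast; omega
      have h1 : ((k + 1 : ℕ) : ℤ) - 1 = k := by push_cast; ring
      rw [h1, hpos, hpos, hL, Complex.exp_log (hne _)]
      congr 1

theorem delta_ne_zero {N : ℕ} {K : Type*} [Field K] {z : Fin N → K} (hinj : Function.Injective z)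
    (hz : ∀ i j, z i + z j ≠ 0) : delta z ≠ 0 := by
  refine prod_ne_zero_iff.2 fun i _ => prod_ne_zero_iff.2 fun j hj => div_ne_zero ?_ (hz i j)
  exact sub_ne_zero.2 fun h => (mem_Ioi.1 hj).ne (hinj h)

end BKP

end

/-! ### Assembly: the truncated identities and the passage to the limit -/

theorem proposition6 (N : ℕ) (r : ℤ → ℂ) (hsymm : ∀ n, r n = r (1 - n)) (hne : ∀ n, r n ≠ 0) :
    (∃ T : ℤ → ℂ, (∀ n, T (-n) = -T n) ∧ ∀ n, Complex.exp (T (n - 1) - T n) = r n) ∧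
    ∀ T : ℤ → ℂ, (∀ n, T (-n) = -T n) → (∀ n, Complex.exp (T (n - 1) - T n) = r n) →
      algebraMap (BKP.XYSeries N) (BKP.XYField N) (BKP.tauXY N r) =
        2 ^ N * BKP.pfaffian (BKP.pfaffMatrix N T) /
          (BKP.delta (BKP.xVar (N := N)) * BKP.delta (BKP.yVar (N := N))) := by
  refine ⟨BKP.exists_exponents r hsymm hne, fun T hneg hT => ?_⟩
  have h0 : T 0 = 0 := by
    have := hneg 0
    rw [neg_zero] at this
    exact self_eq_neg.1 this
  have hδ := mul_ne_zero (BKP.delta_ne_zero (BKP.xVar_injective N) BKP.xVar_add_ne_zero)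
    (BKP.delta_ne_zero (BKP.yVar_injective N) BKP.yVar_add_ne_zero)
  rw [eq_div_iff hδ, mul_comm, BKP.pfaffMatrix_eq]
  symm
  -- The truncation level is M + 1 because for odd N the mode 0 must be present in the pairing.
  refine BKP.pfaffian_limit (R := BKP.XYSeries N) (K := BKP.XYField N) (fun M => BKP.orderIdeal _ (M + 1))
    (fun f hf => BKP.eq_zero_of_forall_mem_orderIdeal hf) _ _
    (fun M => BKP.mixedBlocks (BKP.mixedTrunc T (M + 1))) ?_ _ _
    (fun M => MvPowerSeries.subst (BKP.xyTimes N) (BKP.tauTrunc r (M + 1)))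
    (fun M => BKP.tauXY_sub_mem_orderIdeal N r (M + 1)) ?_
  · intro M a b
    obtain ⟨a, rfl⟩ := (BKP.blockEquiv N).surjective a
    obtain ⟨b, rfl⟩ := (BKP.blockEquiv N).surjective b
    have h := fun i j => BKP.mixedSeries_sub_mem_orderIdeal (N := N) T (M + 1) i j
    rcases a with a | a <;> rcases b with b | b
    · simp [BKP.mixedBlocks]
    · simpa [BKP.mixedBlocks] using h a.rev b
    · have h1 := neg_mem (h b.rev a)
      simpa [BKP.mixedBlocks, neg_add_eq_sub] using h1
    · simp [BKP.mixedBlocks]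
  · intro M
    rw [← BKP.specialize_apply, BKP.specialize_tauTrunc,
      ← BKP.pairing_fermiVec (Nat.succ_ne_zero M) N hsymm hneg hT, ← BKP.pfaffian_mixedCorr,
      BKP.mixedBlocks_map]
    simp only [BKP.algebraMap_mixedTrunc h0]
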